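/- **Setting.** Let $n\ge 1$ and let $\mathcal K\subset\mathbb R^n$ be a convex body that contains a unit ball and has diameter at most $T$. In round $t=1,\dots,T$ an adversary, who may use the past, chooses a convex, $T$-Lipschitz loss $\ell_t:\mathcal K\to[0,1]$, and simultaneously the player plays $x_t\in\mathcal K$ and observes $\ell_t(x_t)$. Put $\mathcal F_{t-1}=\sigma(\ell_1,x_1,\dots,\ell_{t-1},x_{t-1},\ell_t)$. Parameters: $\epsilon=\frac{1}{80e\cdot 20}$, $\alpha=(2e)^{17}n^2\log^2T$, $\lambda=\frac{\epsilon^4}{10^6\,n^4\alpha^2\log^2T}$, $\gamma=\frac1{5n\log_2T}$, $\beta=4$, $\eta_1=\frac1{20e^2\sqrt{nT\log T}}$. **Kernel.** For a probability measure $p$ with mean $\mu(p)$ and covariance $\mathrm{Cov}(p)$ let $\mathcal E_p(r)=\{x:(x-\mu(p))^\top\mathrm{Cov}(p)^{-1}(x-\mu(p))\le r^2\}$ and $c[p]=\mathcal N\big(\mu(p),\frac{\epsilon^2}{n\log T}\frac{\lambda}{2-\lambda}\mathrm{Cov}(p)\big)$. Let $K[p](\cdot,y)$ be the density of $(1-\lambda)C+\lambda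 y$ with $C\sim c[p]$, and put $K[p]q(x)=\int K[p](x,y)\,dq(y)$ and $K[p]^*f(y)=\int f(x)K[p](x,y)\,dx$. **Algorithm.** Let $F_1=\mathcal K$. In round $t$, $p_t$ is the probability measure on $\mathcal K$ with density proportional to $\exp(-\sum_{s<t}\eta_s\tilde\ell_s)$, where $e^{-\infty}=0$. A point $X_t$ is drawn from the law $K[p_t]p_t$ conditionally on $\mathcal F_{t-1}$; one plays $x_t=X_t$ if $X_t\in\mathcal K$, and an arbitrary point $x_t$ of $\mathcal K$ otherwise. With $\Omega_t=\mathcal K\cap\mathcal E_{p_t}(10n\alpha\lambda+20\sqrt\lambda\,\epsilon)$, put $$\tilde\ell_t(y)=\frac{\ell_t(x_t)\mathbf 1\{x_t\in\Omega_t\}}{K[p_t]p_t(x_t)}K[p_t](x_t,y)\ \text{ for } y\in F_t,\qquad \tilde\ell_t(y)=+\infty\ \text{ for } y\notin F_t .$$ If $\mathrm{Vol}(F_t\cap\mathcal E_{p_{t+1}}(\alpha))\le\frac12\mathrm{Vol}(F_t)$, then $F_{t+1}=F_t\cap\mathcal E_{p_{t+1}}(\alpha)$ and $\eta_{t+1}=(1+\gamma)\eta_t$;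 otherwise $F_{t+1}=F_t$ and $\eta_{t+1}=\eta_t$. Let $\tilde L_t=\sum_{s\le t}\tilde\ell_s$. The algorithm restarts after round $t$ if some $z\in\partial F_{t+1}\cap\mathrm{int}(\mathcal K)$ satisfies $\eta_1(\tilde L_t(z)-\min_{\mathcal K}\tilde L_t)\le\beta$. Let $\tau$ be the minimum of $T$ and the first time at which the algorithm restarts. **Fault time.** For $f:\mathcal K\to\mathbb R$ let $f^{ext}(y)=\max(\sup_h h(y),\inf_{\mathcal K}f)$ on $\mathbb R^n$, the supremum being over affine $h$ with $h\le f$ on $\mathcal K$ and $h=f$ at some point of $\mathrm{int}(\mathcal K)$. Let $\underline\ell_t=\ell_t\mathbf 1_{\Omega_t}$, $L_t=\sum_{s\le t}K[p_s]^*\ell_s^{ext}$, and $$\Delta^{(1)}_t=\eta_1\Big|\sum_{s\le t}\Big(\int K[p_s]^*\underline\ell_s\,dp_s-\ell_s(x_s)\Big)\Big|,\qquad \Delta^{(2)}_t=\max_{y\in F_t}\eta_1|\tilde L_t(y)-L_t(y)|,$$ $$\Delta^{(3)}_t=\max_{y\in F_t}\Big|\sum_{s\le t}\eta_s\big(\tilde\ell_s(y)-K[p_s]^*\ell^{ext}_s(y)\big)\Big|,\qquad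 \Delta^{(4)}_t=\eta_1\Big|\sum_{s\le t}\int_{F_s}\big(\tilde\ell_s-K[p_s]^*\ell_s^{ext}\big)\,dp_s\Big| .$$ Let $B_t$ be the event that $\max_{1\le i\le4}\Delta^{(i)}_t\le1$, and let $\mathcal T$ be the minimum of $\tau$ and the first $t\le\tau$ such that $B_t$ fails or $x_t\notin\Omega_t$. **Proposition.** There is a universal constant $T_0$ such that, whenever $T\ge T_0$ and $2^{30}n^8\log^8(T)\le\sqrt T$, $$\mathbb P(\mathcal T<\tau)<\frac{2}{T^2}.$$ -/

import Mathlib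

open MeasureTheory ProbabilityTheory Set
open scoped ENNReal NNReal Matrix

noncomputable section

namespace KernelBCO

/-- `ℝⁿ` with its Euclidean norm. -/
abbrev Pt (n : ℕ) := EuclideanSpace ℝ (Fin n)

/-- Parameters of the algorithm: the horizon `T`, the kernel parameters `ε` and `lam`, the dilation
`α` of the focus ellipsoids, the learning-rate increment `γ`, the restart level `β` and the initial
learning rate `η₁`. -/
structure Params where
  T : ℕ
  ε : ℝ
  lam : ℝ
  α : ℝ
  γ : ℝ
  β : ℝ
  η₁ : ℝ

/-- The values `ε = 1 / (80 e · 20)`, `α = (2e)¹⁷ n² log² T`,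
`lam = ε⁴ / ((10³)² n⁴ α² log² T)`, `γ = 1 / (5 n log₂ T)`, `β = 4`,
`η₁ = 1 / (20 e² √(n T log T))`. -/
def params (n T : ℕ) : Params :=
  let ε : ℝ := 1 / (80 * Real.exp 1 * 20)
  let α : ℝ := (2 * Real.exp 1) ^ 17 * (n : ℝ) ^ 2 * Real.log T ^ 2
  { T := T
    ε := ε
    α := α
    lam := ε ^ 4 / ((10 ^ 3) ^ 2 * (n : ℝ) ^ 4 * α ^ 2 * Real.log T ^ 2)
    γ := 1 / (5 * n * Real.logb 2 T)
    β := 4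
    η₁ := 1 / (20 * Real.exp 1 ^ 2 * √(n * T * Real.log T)) }

section Kernel

variable {n : ℕ}

/-- The mean `μ(p)`. -/
def meanOf (p : Measure (Pt n)) : Pt n := ∫ x, x ∂p

/-- The covariance matrix `Cov(p)`. -/
def covMat (p : Measure (Pt n)) : Matrix (Fin n) (Fin n) ℝ :=
  Matrix.of fun i j => cov[fun x : Pt n => x i, fun x : Pt n => x j; p]

/-- `‖v‖_A = √(vᵀ A v)`. -/
def matNorm (A : Matrix (Fin n) (Fin n) ℝ) (v : Pt n) : ℝ :=
  √(v.ofLp ⬝ᵥ (A *ᵥ v.ofLp))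

/-- The ellipsoid `𝓔_p(r) = {x : ‖x - μ(p)‖_{Cov(p)⁻¹} ≤ r}`. -/
def ellipsoid (p : Measure (Pt n)) (r : ℝ) : Set (Pt n) :=
  {x | matNorm (covMat p)⁻¹ (x - meanOf p) ≤ r}

/-- The density at `x` of the Gaussian law `𝓝(m, A)`. -/
def gaussianDensity (m : Pt n) (A : Matrix (Fin n) (Fin n) ℝ) (x : Pt n) : ℝ :=
  (√((2 * Real.pi) ^ n * A.det))⁻¹ * Real.exp (-(matNorm A⁻¹ (x - m) ^ 2) / 2)

/-- The density of the Gaussian core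
`c[p] = 𝓝(μ(p), ε² / (n log T) · lam / (2 - lam) · Cov(p))`. -/
def coreDensity (P : Params) (p : Measure (Pt n)) (x : Pt n) : ℝ :=
  gaussianDensity (meanOf p)
    ((P.ε ^ 2 / (n * Real.log P.T) * (P.lam / (2 - P.lam))) • covMat p) x

/-- `K[p](x, y)`: the density at `x` of `(1 - lam) C + lam y` with `C ∼ c[p]`. -/
def kernel (P : Params) (p : Measure (Pt n)) (x y : Pt n) : ℝ :=
  coreDensity P p ((1 - P.lam)⁻¹ • (x - P.lam • y)) * ((1 - P.lam) ^ n)⁻¹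

/-- The density `K[p]q(x) = ∫ K[p](x, y) dq(y)` of the measure `K[p]q`, the law of
`(1 - lam) C + lam X` with independent `C ∼ c[p]` and `X ∼ q`. -/
def kernelDensity (P : Params) (p q : Measure (Pt n)) (x : Pt n) : ℝ :=
  ∫ y, kernel P p x y ∂q

/-- The measure `K[p]q`. -/
def kernelLaw (P : Params) (p q : Measure (Pt n)) : Measure (Pt n) :=
  volume.withDensity fun x => ENNReal.ofReal (kernelDensity P p q x)

/-- The adjoint `K[p]^* f (y) = ∫ f(x) K[p](x, y) dx`. -/
def kernelAdjoint (P : Params) (p : Measure (Pt n)) (f : Pt n → ℝ) (y : Pt n) : ℝ :=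
  ∫ x, f x * kernel P p x y

end Kernel

section Algorithm

variable {n : ℕ} (P : Params) (K : Set (Pt n))

/-- The set `K ∩ 𝓔_p(10 n α lam + 20 √lam ε)` of typical points. -/
def typical (p : Measure (Pt n)) : Set (Pt n) :=
  K ∩ ellipsoid p (10 * n * P.α * P.lam + 20 * √P.lam * P.ε)

open Classical in
/-- The loss estimate after the point `x` was played and the loss `v` was observed, with
exponential weights `p` and focus region `F`: the function of `y` equal to
`v 1{x typical} / K[p]p(x) · K[p](x, y)` for `y ∈ F` and to `+∞` elsewhere. -/
def lossEstimate (F : Set (Pt n)) (p : Measure (Pt n)) (x : Pt n) (v : ℝ) (y : Pt n) : ℝ≥0∞ :=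
  if y ∈ F then
    ENNReal.ofReal
      (v * (typical P K p).indicator (fun _ => (1 : ℝ)) x / kernelDensity P p p x * kernel P p x y)
  else ∞

/-- The probability measure on `K` with density proportional to `exp(-S)`, where `exp(-∞) = 0`.
Adding a constant to `S` does not change it. -/
def expWeights (S : Pt n → ℝ≥0∞) : Measure (Pt n) :=
  let w := (volume.restrict K).withDensity fun x => EReal.exp (-(S x : EReal))
  (w univ)⁻¹ • w

/-- What the algorithm stores between two rounds: the focus region `F`, the learning rate `η` and
the sum `S` of the past loss estimates, each multiplied by the learning rate of its round. -/
structure State (n : ℕ) where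
  F : Set (Pt n)
  η : ℝ
  S : Pt n → ℝ≥0∞

open Classical in
/-- One round: the point `x` is played and the loss `v` is observed. The weights are updated; then
the focus region is intersected with the ellipsoid `𝓔(α)` of the new weights, and the learning rate
is multiplied by `1 + γ`, if this intersection has at most half of the volume of the region. -/
def step (σ : State n) (x : Pt n) (v : ℝ) : State n :=
  let S' : Pt n → ℝ≥0∞ := fun y =>
    σ.S y + ENNReal.ofReal σ.η * lossEstimate P K σ.F (expWeights K σ.S) x v y
  let E := ellipsoid (expWeights K S') P.α
  if volume (σ.F ∩ E) ≤ 2⁻¹ * volume σ.F then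
    { F := σ.F ∩ E, η := (1 + P.γ) * σ.η, S := S' }
  else
    { F := σ.F, η := σ.η, S := S' }

/- Below, `ℓ t` is the loss function of round `t` and `x t` the point played in round `t`. Rounds
are numbered from `1`. Quantities are those of the algorithm run without a restart; they are those
of the algorithm up to its first restart. -/
variable (ℓ : ℕ → Pt n → ℝ) (x : ℕ → Pt n)

/-- The state after `t` rounds. The state in round `t ≥ 1` is `stateAfter (t - 1)`. -/
def stateAfter : ℕ → State n
  | 0 => { F := K, η := P.η₁, S := fun _ => 0 }
  | t + 1 => step P K (stateAfter t) (x (t + 1)) (ℓ (t + 1) (x (t + 1)))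

/-- The focus region `F_t`, for `t ≥ 1`. -/
def focus (t : ℕ) : Set (Pt n) := (stateAfter P K ℓ x (t - 1)).F

/-- The learning rate `η_t`, for `t ≥ 1`. -/
def rate (t : ℕ) : ℝ := (stateAfter P K ℓ x (t - 1)).η

/-- The exponential weights measure `p_t`, for `t ≥ 1`. -/
def weights (t : ℕ) : Measure (Pt n) := expWeights K (stateAfter P K ℓ x (t - 1)).S

/-- The set `Ω_t` of typical points of round `t`. -/
def typicalAt (t : ℕ) : Set (Pt n) := typical P K (weights P K ℓ x t)

/-- The loss estimate `ℓ̃_t`. -/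
def estimate (t : ℕ) (y : Pt n) : ℝ≥0∞ :=
  lossEstimate P K (focus P K ℓ x t) (weights P K ℓ x t) (x t) (ℓ t (x t)) y

/-- The cumulative loss estimate `L̃_t`. -/
def cumEstimate (t : ℕ) (y : Pt n) : ℝ≥0∞ :=
  ∑ s ∈ Finset.Icc 1 t, estimate P K ℓ x s y

/-- The restart condition at the end of round `t`: there is `z ∈ ∂F_{t+1} ∩ int K` with
`η₁ (L̃_t(z) - min L̃_t) ≤ β`. -/
def Restarts (t : ℕ) : Prop :=
  ∃ z ∈ frontier (focus P K ℓ x (t + 1)) ∩ interior K,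
    P.η₁ * ((cumEstimate P K ℓ x t z).toReal - (⨅ y ∈ K, cumEstimate P K ℓ x t y).toReal) ≤ P.β

/-- `τ`: the minimum of `T` and the first time at which the algorithm restarts. -/
def restartTime : ℕ :=
  sInf ({t | 1 ≤ t ∧ t ≤ P.T ∧ Restarts P K ℓ x t} ∪ {P.T})

/-- The convex extension `ℓ^ext` to `ℝⁿ` of a function `f` on `K`: the maximum of `inf_K f` and the
supremum of the affine functions that are at most `f` on `K` and equal to `f` somewhere in the
interior of `K`. -/
def convexExtension (f : Pt n → ℝ) (y : Pt n) : ℝ :=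
  max
    (⨆ h : {h : Pt n →ᵃ[ℝ] ℝ // (∀ z ∈ K, h z ≤ f z) ∧ ∃ z ∈ interior K, h z = f z}, h.1 y)
    (sInf (f '' K))

/-- `K[p_s]^* ℓ_s^ext`. -/
def adjExt (s : ℕ) : Pt n → ℝ := kernelAdjoint P (weights P K ℓ x s) (convexExtension K (ℓ s))

/-- `K[p_s]^* (ℓ_s 1_{Ω_s})`. -/
def adjTypical (s : ℕ) : Pt n → ℝ :=
  kernelAdjoint P (weights P K ℓ x s) ((typicalAt P K ℓ x s).indicator (ℓ s))

/-- `Δ_t⁽¹⁾ = η₁ |∑_{s ≤ t} (⟨p_s, K[p_s]^* (ℓ_s 1_{Ω_s})⟩ - ℓ_s(x_s))|`. -/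
def dev₁ (t : ℕ) : ℝ≥0∞ :=
  ENNReal.ofReal (P.η₁ * |∑ s ∈ Finset.Icc 1 t,
    ((∫ y, adjTypical P K ℓ x s y ∂(weights P K ℓ x s)) - ℓ s (x s))|)

/-- `Δ_t⁽²⁾ = max_{y ∈ F_t} η₁ |L̃_t(y) - L_t(y)|` with `L_t = ∑_{s ≤ t} K[p_s]^* ℓ_s^ext`. -/
def dev₂ (t : ℕ) : ℝ≥0∞ :=
  ⨆ y ∈ focus P K ℓ x t, ENNReal.ofReal (P.η₁ *
    |(cumEstimate P K ℓ x t y).toReal - ∑ s ∈ Finset.Icc 1 t, adjExt P K ℓ x s y|)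

/-- `Δ_t⁽³⁾ = max_{y ∈ F_t} |∑_{s ≤ t} η_s (ℓ̃_s(y) - K[p_s]^* ℓ_s^ext(y))|`. -/
def dev₃ (t : ℕ) : ℝ≥0∞ :=
  ⨆ y ∈ focus P K ℓ x t, ENNReal.ofReal
    |∑ s ∈ Finset.Icc 1 t,
      rate P K ℓ x s * ((estimate P K ℓ x s y).toReal - adjExt P K ℓ x s y)|

/-- `Δ_t⁽⁴⁾ = η₁ |∑_{s ≤ t} ⟨p_s, ℓ̃_s - K[p_s]^* ℓ_s^ext⟩|`, where the bracket is the integral over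
the region `F_s` on which `ℓ̃_s` is finite (`p_s` may charge the complement of `F_s`). -/
def dev₄ (t : ℕ) : ℝ≥0∞ :=
  ENNReal.ofReal (P.η₁ * |∑ s ∈ Finset.Icc 1 t,
    ∫ y in focus P K ℓ x s, ((estimate P K ℓ x s y).toReal - adjExt P K ℓ x s y)
      ∂(weights P K ℓ x s)|)

/-- The concentration event `B_t`. -/
def Concentrated (t : ℕ) : Prop :=
  max (max (dev₁ P K ℓ x t) (dev₂ P K ℓ x t)) (max (dev₃ P K ℓ x t) (dev₄ P K ℓ x t)) ≤ 1

/-- The fault time `𝒯`: the minimum of `τ` and the first `t ≤ τ` such that `B_t` fails or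
`x_t ∉ Ω_t`. -/
def faultTime : ℕ :=
  sInf ({t | 1 ≤ t ∧ t ≤ restartTime P K ℓ x ∧
      (¬ Concentrated P K ℓ x t ∨ x t ∉ typicalAt P K ℓ x t)} ∪ {restartTime P K ℓ x})

end Algorithm

/-- The σ-algebra generated by `ℓ_1, x_1, …, ℓ_{t-1}, x_{t-1}, ℓ_t`, where a loss function is
identified with its values at the points of `K`. -/
@[reducible] def history {n : ℕ} {Ω : Type*} (K : Set (Pt n)) (ℓ : ℕ → Ω → Pt n → ℝ) (x : ℕ → Ω → Pt n)
    (t : ℕ) : MeasurableSpace Ω :=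
  (⨆ s ∈ Finset.Icc 1 t, ⨆ y ∈ K, MeasurableSpace.comap (fun ω => ℓ s ω y) inferInstance) ⊔
    ⨆ s ∈ Finset.Ico 1 t, MeasurableSpace.comap (x s) inferInstance

end KernelBCO

end

open KernelBCO

noncomputable section


namespace KernelBCO

/-! ### Norms given by positive definite matrices, and their duality -/

section MatNorm

open scoped MatrixOrder InnerProductSpace

variable {n : ℕ} {C : Matrix (Fin n) (Fin n) ℝ}

/-! A fault before the restart time has a first round `t`. Every earlier round was concentrated and
did not restart, and along the path alone this forces the algorithm to be in a good state in all
rounds up to and including `t`. In a good state the law of the drawn point is under control, so a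
fault in round `t` can only come from an atypical draw or from a large deviation of one of finitely
many sums of centred bounded statistics. These events are summed over the statistics and over `t`.

The good state is `Healthy`: the learning rate is at most `e η₁`; `F_{t-1}`, which carries `p_t`,
contains a copy of `int K` scaled by `T⁻⁴` and lies in a dilated ellipsoid of `p_t`; and `p_t` gives
mass at most `T⁻⁸` to the complement of `𝓔(α)`. These properties sustain one another
(`healthy_of_forall_lt`). Concentration puts the exponent of the weights within 1 of a convex
function, so the weights are approximately log-concave and have an exponential tail
(`measure_compl_ellipsoid_le_of_approx_convex`). A small tail and a bounded rate make consecutive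
weights comparable; hence the mean moves little, the covariance hardly decreases, and two
consecutive rounds never both cut the region (`Healthy.not_cut_succ`). If the region is unchanged
and there is no restart, the estimate on `∂F ∩ int K` exceeds its minimum by more than `4 / η₁`; by
concentration a convex function of polynomial size also rises there, and it cannot do so within a
contraction by `T⁻⁴` (`hasCopy_of_not_restarts`). The copy bounds the volume of the region from
below, thus the number of halvings, thus the rate (`rate_le_of_hasCopy`).

In a good state the small ellipsoid that defines typical points lies in `int K`, where the convex
extension agrees with the loss, so that truncation to typical points costs a bias of at most `1 /
T`. The kernel is nearly constant in its second argument over an ellipsoid that contains the region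
and most of the mass, so the estimates are at most 2. Importance weighting makes them unbiased for
the truncated target (`integral_psi`), and they vary by at most `1 / T` at distance `T⁻⁷`. The
maxima over `F_t` therefore reduce to a grid of at most `T ^ (10 n)` points
(`concentrated_of_deviations`).

The probabilistic part bounds exponential moments. The law of the draw is prescribed only until the
restart, so increments are set to zero off an event of the history on which the prescription holds
and an atypical draw is unlikely (`goodSet`). When the draw leaves `K` the played point is
arbitrary; the error is charged to the probability `T⁻⁴` of an atypical draw. Each deviation then
has probability at most `T ^ (-20 n)` (`Game.measure_sum_increment_le`), each round contributes at
most `2 T⁻⁴`, and the total is at most `2 T⁻³`. -/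

theorem mulVec_dotProduct_of_symm {A : Matrix (Fin n) (Fin n) ℝ} (hA : Aᵀ = A)
    (v w : Fin n → ℝ) : (A *ᵥ v) ⬝ᵥ w = v ⬝ᵥ (A *ᵥ w) := by
  rw [Matrix.dotProduct_mulVec, ← Matrix.mulVec_transpose, hA]

/-- `B` is the positive square root of `C⁻¹`. It carries the norm of `C⁻¹` to the Euclidean norm, so
triangle inequalities and Gaussian integrals can be imported from there; the determinant is its
Jacobian. -/
theorem exists_linearEquiv_inner (hC : C.PosDef) :
    ∃ B : Pt n ≃L[ℝ] Pt n, (∀ v w : Pt n, v.ofLp ⬝ᵥ (C⁻¹ *ᵥ w.ofLp) = ⟪B v, B w⟫_ℝ) ∧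
      |LinearMap.det (B : Pt n →ₗ[ℝ] Pt n)| = (√C.det)⁻¹ := by
  have hI : C⁻¹.PosDef := hC.inv
  set S := CFC.sqrt C⁻¹ with hS
  have hnn : (0 : Matrix (Fin n) (Fin n) ℝ) ≤ C⁻¹ := Matrix.nonneg_iff_posSemidef.2 hI.posSemidef
  have hSS : S * S = C⁻¹ := CFC.sqrt_mul_sqrt_self _ hnn
  have hSp : S.PosSemidef := Matrix.nonneg_iff_posSemidef.1 (CFC.sqrt_nonneg _)
  have hSt : Sᵀ = S := by simpa using hSp.isHermitian.eq
  have hdet : S.det * S.det = C.det⁻¹ := by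
    rw [← Matrix.det_mul, hSS, Matrix.det_nonsing_inv]; simp
  have hCd : 0 < C.det := hC.det_pos
  have hSd : S.det ≠ 0 := by
    intro h; rw [h] at hdet; have := inv_pos.2 hCd; simp_all
  have hLd : LinearMap.det (S.toEuclideanLin) = S.det := by
    simp
  let e : Pt n ≃ₗ[ℝ] Pt n := LinearEquiv.ofIsUnitDet
    (f := S.toEuclideanLin) (v := (EuclideanSpace.basisFun (Fin n) ℝ).toBasis)
    (v' := (EuclideanSpace.basisFun (Fin n) ℝ).toBasis) (by
      rw [LinearMap.det_toMatrix, hLd]; exact isUnit_iff_ne_zero.2 hSd)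
  have he : ∀ v, e v = S.toEuclideanLin v := fun v => rfl
  refine ⟨e.toContinuousLinearEquiv, ?_, ?_⟩
  · intro v w
    change _ = ⟪e v, e w⟫_ℝ
    rw [he, he, EuclideanSpace.inner_eq_star_dotProduct]
    simp only [star_trivial, Matrix.toLpLin_apply]
    rw [mulVec_dotProduct_of_symm hSt, Matrix.mulVec_mulVec, hSS,
      ← mulVec_dotProduct_of_symm (by simpa using hI.isHermitian.eq), dotProduct_comm]
  · have h1 : LinearMap.det ((e.toContinuousLinearEquiv : Pt n ≃L[ℝ] Pt n) : Pt n →ₗ[ℝ] Pt n)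
        = S.det := by rw [← hLd]; rfl
    rw [h1, ← Real.sqrt_mul_self_eq_abs, hdet, Real.sqrt_inv]

theorem matNorm_nonneg (A : Matrix (Fin n) (Fin n) ℝ) (v : Pt n) : 0 ≤ matNorm A v :=
  Real.sqrt_nonneg _

theorem exists_linearEquiv_matNorm (hC : C.PosDef) :
    ∃ B : Pt n ≃L[ℝ] Pt n, (∀ v : Pt n, matNorm C⁻¹ v = ‖B v‖) ∧
      |LinearMap.det (B : Pt n →ₗ[ℝ] Pt n)| = (√C.det)⁻¹ := by
  obtain ⟨B, h1, h2⟩ := exists_linearEquiv_inner hC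
  refine ⟨B, fun v => ?_, h2⟩
  rw [matNorm, h1, real_inner_self_eq_norm_sq, Real.sqrt_sq (norm_nonneg _)]

theorem continuous_matNorm (A : Matrix (Fin n) (Fin n) ℝ) : Continuous (matNorm A) := by
  unfold matNorm
  refine Real.continuous_sqrt.comp ?_
  have : Continuous fun v : Pt n => v.ofLp := PiLp.continuous_ofLp 2 _
  exact this.dotProduct (continuous_const.matrix_mulVec this)

theorem matNorm_zero (A : Matrix (Fin n) (Fin n) ℝ) : matNorm A 0 = 0 := by simp [matNorm]

theorem matNorm_smul (A : Matrix (Fin n) (Fin n) ℝ) (c : ℝ) (v : Pt n) :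
    matNorm A (c • v) = |c| * matNorm A v := by
  simp only [matNorm, WithLp.ofLp_smul, Matrix.mulVec_smul, dotProduct_smul, smul_dotProduct,
    smul_eq_mul]
  rw [← mul_assoc, Real.sqrt_mul (mul_self_nonneg c), Real.sqrt_mul_self_eq_abs]

theorem matNorm_neg (A : Matrix (Fin n) (Fin n) ℝ) (v : Pt n) : matNorm A (-v) = matNorm A v := by
  simpa using matNorm_smul A (-1) v

theorem matNorm_sub_comm (A : Matrix (Fin n) (Fin n) ℝ) (v w : Pt n) :
    matNorm A (v - w) = matNorm A (w - v) := by
  rw [← neg_sub, matNorm_neg]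

theorem matNorm_add_le (hC : C.PosDef) (v w : Pt n) :
    matNorm C⁻¹ (v + w) ≤ matNorm C⁻¹ v + matNorm C⁻¹ w := by
  obtain ⟨B, h1, -⟩ := exists_linearEquiv_matNorm hC
  simp only [h1, map_add]; exact norm_add_le _ _

theorem matNorm_sub_le (hC : C.PosDef) (v w : Pt n) :
    matNorm C⁻¹ (v - w) ≤ matNorm C⁻¹ v + matNorm C⁻¹ w := by
  obtain ⟨B, h1, -⟩ := exists_linearEquiv_matNorm hC
  simp only [h1, map_sub]; exact norm_sub_le _ _

theorem matNorm_sub_le_matNorm_sub (hC : C.PosDef) (v w : Pt n) :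
    matNorm C⁻¹ v - matNorm C⁻¹ w ≤ matNorm C⁻¹ (v - w) := by
  obtain ⟨B, h1, -⟩ := exists_linearEquiv_matNorm hC
  simp only [h1, map_sub]; exact norm_sub_norm_le _ _

theorem matNorm_sq (hC : C.PosSemidef) (v : Pt n) :
    matNorm C v ^ 2 = v.ofLp ⬝ᵥ (C *ᵥ v.ofLp) :=
  Real.sq_sqrt (by simpa using hC.dotProduct_mulVec_nonneg v.ofLp)

/-- The vector `C⁻¹ v` attains equality in Cauchy–Schwarz. This duality converts bounds on variances
of linear functionals into bounds on the norm of the inverse covariance. -/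
theorem exists_dual_matNorm (hC : C.PosDef) (v : Pt n) :
    ∃ u : Pt n, ⟪u, v⟫_ℝ = matNorm C⁻¹ v ^ 2 ∧ matNorm C u = matNorm C⁻¹ v := by
  have hI : C⁻¹.PosDef := hC.inv
  have ht : (C⁻¹)ᵀ = C⁻¹ := by simpa using hI.isHermitian.eq
  refine ⟨WithLp.toLp 2 (C⁻¹ *ᵥ v.ofLp), ?_, ?_⟩
  · rw [matNorm_sq hI.posSemidef, EuclideanSpace.inner_eq_star_dotProduct]
    simp
  · unfold matNorm
    simp only [Matrix.mulVec_mulVec, Matrix.mul_nonsing_inv _ (isUnit_iff_ne_zero.2 hC.det_pos.ne'),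
      Matrix.one_mulVec]
    rw [dotProduct_comm]

theorem inner_le_matNorm_mul (hC : C.PosDef) (u v : Pt n) :
    ⟪u, v⟫_ℝ ≤ matNorm C u * matNorm C⁻¹ v := by
  obtain ⟨B, h1, -⟩ := exists_linearEquiv_inner hC
  have hI : C⁻¹.PosDef := hC.inv
  have hu : IsUnit C.det := isUnit_iff_ne_zero.2 hC.det_pos.ne'
  have hct : Cᵀ = C := by simpa using hC.isHermitian.eq
  set w : Pt n := WithLp.toLp 2 (C *ᵥ u.ofLp)
  have e1 : ⟪u, v⟫_ℝ = ⟪B w, B v⟫_ℝ := by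
    rw [← h1, EuclideanSpace.inner_eq_star_dotProduct]
    simp only [w, star_trivial]
    rw [mulVec_dotProduct_of_symm hct, Matrix.mulVec_mulVec, Matrix.mul_nonsing_inv _ hu,
      Matrix.one_mulVec, dotProduct_comm]
  have e2 : ‖B w‖ = matNorm C u := by
    rw [matNorm, ← Real.sqrt_sq (norm_nonneg (B w)), ← real_inner_self_eq_norm_sq, ← h1]
    simp only [w, Matrix.mulVec_mulVec, Matrix.nonsing_inv_mul _ hu, Matrix.one_mulVec]
    rw [dotProduct_comm]
  have e3 : ‖B v‖ = matNorm C⁻¹ v := by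
    rw [matNorm, ← Real.sqrt_sq (norm_nonneg (B v)), ← real_inner_self_eq_norm_sq, ← h1]
  rw [e1, ← e2, ← e3]
  exact real_inner_le_norm _ _

end MatNorm

end KernelBCO

namespace KernelBCO

/-! ### Mean and covariance of an absolutely continuous measure -/

section Moments

open scoped InnerProductSpace

variable {n : ℕ} {p : Measure (Pt n)}

/-- An absolutely continuous probability measure with bounded support. -/
structure Regular (p : Measure (Pt n)) : Prop where
  prob : IsProbabilityMeasure p
  ac : p ≪ volume
  bdd : ∃ R : ℝ, ∀ᵐ y ∂p, ‖y‖ ≤ R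

theorem Regular.integrable (hp : Regular p) {E : Type*} [NormedAddCommGroup E] {f : Pt n → E}
    [SecondCountableTopologyEither (Pt n) E] (hf : Continuous f) : Integrable f p := by
  have := hp.prob
  obtain ⟨R, hR⟩ := hp.bdd
  obtain ⟨M, hM⟩ := (isCompact_closedBall (0 : Pt n) R).exists_bound_of_continuousOn hf.continuousOn
  refine Integrable.of_bound hf.aestronglyMeasurable M ?_
  filter_upwards [hR] with y hy
  exact hM y (by simpa using hy)

theorem Regular.inner_meanOf (hp : Regular p) (u : Pt n) :
    ⟪u, meanOf p⟫_ℝ = ∫ y, ⟪u, y⟫_ℝ ∂p :=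
  (integral_inner (hp.integrable continuous_id) u).symm

theorem Regular.integral_inner_sub_meanOf (hp : Regular p) (u : Pt n) :
    ∫ y, ⟪u, y - meanOf p⟫_ℝ ∂p = 0 := by
  have := hp.prob
  simp only [inner_sub_right]
  rw [integral_sub (hp.integrable (by fun_prop)) (integrable_const _), hp.inner_meanOf]
  simp

theorem Regular.meanOf_apply (hp : Regular p) (i : Fin n) : meanOf p i = ∫ y, y i ∂p := by
  have := hp.inner_meanOf (EuclideanSpace.single i 1)
  simpa [EuclideanSpace.inner_single_left] using this

theorem Regular.covMat_apply (hp : Regular p) (i j : Fin n) :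
    covMat p i j = ∫ y, (y - meanOf p) i * (y - meanOf p) j ∂p := by
  simp only [covMat, Matrix.of_apply, covariance, PiLp.sub_apply, hp.meanOf_apply]

theorem Regular.sum_mul_covMat (hp : Regular p) (A : Matrix (Fin n) (Fin n) ℝ) :
    ∑ i, ∑ j, A i j * covMat p i j =
      ∫ y, (y - meanOf p).ofLp ⬝ᵥ (A *ᵥ (y - meanOf p).ofLp) ∂p := by
  have h : ∀ i j, Integrable (fun y : Pt n => A i j * ((y - meanOf p) i * (y - meanOf p) j)) p :=
    fun i j => hp.integrable (by fun_prop)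
  simp only [hp.covMat_apply, ← integral_const_mul]
  rw [eq_comm]
  calc _ = ∫ y, ∑ i, ∑ j, A i j * ((y - meanOf p) i * (y - meanOf p) j) ∂p := by
        congr 1 with y
        simp only [dotProduct, Matrix.mulVec, Finset.mul_sum]
        refine Finset.sum_congr rfl fun i _ => Finset.sum_congr rfl fun j _ => ?_
        ring
    _ = _ := by
        rw [integral_finsetSum _ fun i _ => integrable_finsetSum _ fun j _ => h i j]
        refine Finset.sum_congr rfl fun i _ => ?_
        rw [integral_finsetSum _ fun j _ => h i j]

theorem covMat_transpose (p : Measure (Pt n)) : (covMat p)ᵀ = covMat p := by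
  ext i j
  simp only [covMat, Matrix.transpose_apply, Matrix.of_apply]
  exact covariance_comm _ _

theorem Regular.dotProduct_covMat (hp : Regular p) (u : Pt n) :
    u.ofLp ⬝ᵥ (covMat p *ᵥ u.ofLp) = ∫ y, ⟪u, y - meanOf p⟫_ℝ ^ 2 ∂p := by
  have := hp.sum_mul_covMat (Matrix.of fun i j => u i * u j)
  calc _ = ∑ i, ∑ j, (Matrix.of fun i j => u i * u j) i j * covMat p i j := by
        simp only [dotProduct, Matrix.mulVec, Finset.mul_sum, Matrix.of_apply]
        refine Finset.sum_congr rfl fun i _ => Finset.sum_congr rfl fun j _ => ?_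
        ring
    _ = _ := by
        rw [this]
        congr 1 with y
        simp only [dotProduct, Matrix.mulVec, Finset.mul_sum, Matrix.of_apply,
          EuclideanSpace.inner_eq_star_dotProduct, star_trivial, sq, Finset.sum_mul]
        refine Finset.sum_congr rfl fun i _ => Finset.sum_congr rfl fun j _ => ?_
        ring

/-- A zero variance would put the measure on a hyperplane, which is Lebesgue null. -/
theorem Regular.integral_inner_sq_pos (hp : Regular p) {u : Pt n} (hu : u ≠ 0) :
    0 < ∫ y, ⟪u, y - meanOf p⟫_ℝ ^ 2 ∂p := by
  have := hp.prob
  have hc : Continuous fun y : Pt n => ⟪u, y - meanOf p⟫_ℝ ^ 2 := by fun_prop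
  refine lt_of_le_of_ne (integral_nonneg fun y => sq_nonneg _) fun h0 => ?_
  have h1 := (integral_eq_zero_iff_of_nonneg (fun y => sq_nonneg _) (hp.integrable hc)).1 h0.symm
  have h2 : volume {y : Pt n | ⟪u, y - meanOf p⟫_ℝ = 0} = 0 := by
    have e : {y : Pt n | ⟪u, y - meanOf p⟫_ℝ = 0} =
        (fun y => -meanOf p + y) ⁻¹' ((LinearMap.ker (innerₛₗ ℝ u) : Submodule ℝ (Pt n)) : Set (Pt n)) := by
      ext y; simp [sub_eq_neg_add]
    rw [e, measure_preimage_add]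
    refine Measure.addHaar_submodule _ _ fun htop => hu ?_
    have : u ∈ (LinearMap.ker (innerₛₗ ℝ u) : Submodule ℝ (Pt n)) := htop ▸ Submodule.mem_top
    simpa using this
  have h3 : ∀ᵐ y ∂p, ⟪u, y - meanOf p⟫_ℝ ≠ 0 := hp.ac h2 |> fun h => by
    rw [ae_iff]; simpa using h
  have h4 : ∀ᵐ y ∂p, False := by
    filter_upwards [h1, h3] with y hy hy'
    exact hy' (pow_eq_zero_iff two_ne_zero |>.1 hy)
  rw [ae_iff] at h4
  simp at h4

theorem Regular.posDef (hp : Regular p) : (covMat p).PosDef := by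
  refine Matrix.PosDef.of_dotProduct_mulVec_pos ?_ fun x hx => ?_
  · rw [Matrix.IsHermitian, Matrix.conjTranspose_eq_transpose_of_trivial]; exact covMat_transpose p
  · have hx' : (WithLp.toLp 2 x : Pt n) ≠ 0 := by simpa using hx
    have := hp.dotProduct_covMat (WithLp.toLp 2 x)
    simp only [star_trivial]
    simp only at this
    rw [this]
    exact hp.integral_inner_sq_pos hx'

theorem Regular.matNorm_covMat_sq (hp : Regular p) (u : Pt n) :
    matNorm (covMat p) u ^ 2 = ∫ y, ⟪u, y - meanOf p⟫_ℝ ^ 2 ∂p := by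
  rw [matNorm_sq hp.posDef.posSemidef, hp.dotProduct_covMat]

/-- The integral is the trace of `Cov⁻¹ Cov`. -/
theorem Regular.integral_matNorm_sq (hp : Regular p) :
    ∫ y, matNorm (covMat p)⁻¹ (y - meanOf p) ^ 2 ∂p = n := by
  have hC := hp.posDef
  simp only [matNorm_sq hC.inv.posSemidef]
  rw [← hp.sum_mul_covMat]
  have : ∑ i, ∑ j, (covMat p)⁻¹ i j * covMat p i j = ((covMat p)⁻¹ * covMat p).trace := by
    simp only [Matrix.trace, Matrix.diag, Matrix.mul_apply]
    refine Finset.sum_congr rfl fun i _ => Finset.sum_congr rfl fun j _ => ?_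
    rw [← Matrix.transpose_apply (covMat p), covMat_transpose]
  rw [this, Matrix.nonsing_inv_mul _ (isUnit_iff_ne_zero.2 hC.det_pos.ne')]
  simp

/-- Chebyshev's inequality for the norm given by the inverse covariance. -/
theorem Regular.measureReal_compl_ellipsoid_le (hp : Regular p) {R : ℝ} (hR : 0 < R) :
    p.real (ellipsoid p R)ᶜ ≤ n / R ^ 2 := by
  have := hp.prob
  have hc : Continuous fun y : Pt n => matNorm (covMat p)⁻¹ (y - meanOf p) ^ 2 :=
    ((continuous_matNorm _).comp (by fun_prop)).pow 2
  have h := mul_meas_ge_le_integral_of_nonneg (μ := p) (Filter.Eventually.of_forall fun y => by positivity)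
    (hp.integrable hc) (R ^ 2)
  rw [hp.integral_matNorm_sq] at h
  rw [le_div_iff₀ (by positivity), mul_comm]
  refine le_trans (mul_le_mul_of_nonneg_left (measureReal_mono fun y hy => ?_) (by positivity)) h
  simp only [ellipsoid, mem_compl_iff, mem_ofPred_eq, not_le] at hy ⊢
  gcongr

theorem isClosed_ellipsoid (p : Measure (Pt n)) (R : ℝ) : IsClosed (ellipsoid p R) :=
  isClosed_le ((continuous_matNorm _).comp (by fun_prop)) continuous_const

theorem convex_ellipsoid (hC : (covMat p).PosDef) (R : ℝ) : Convex ℝ (ellipsoid p R) := by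
  intro x hx y hy a b ha hb hab
  simp only [ellipsoid, mem_ofPred_eq] at *
  have : a • x + b • y - meanOf p = a • (x - meanOf p) + b • (y - meanOf p) := by
    have : meanOf p = a • meanOf p + b • meanOf p := by rw [← add_smul, hab, one_smul]
    nth_rewrite 1 [this]; module
  rw [this]
  refine (matNorm_add_le hC _ _).trans ?_
  rw [matNorm_smul, matNorm_smul, abs_of_nonneg ha, abs_of_nonneg hb]
  calc _ ≤ a * R + b * R := by gcongr
    _ = R := by rw [← add_mul, hab, one_mul]

theorem ellipsoid_mono {R R' : ℝ} (h : R ≤ R') : ellipsoid p R ⊆ ellipsoid p R' :=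
  fun _ hx => le_trans (show matNorm _ _ ≤ R from hx) h

end Moments

end KernelBCO

namespace KernelBCO

/-! ### The Gaussian kernel: normalization, tails, and comparison with its average -/

section GaussianKernel

open scoped InnerProductSpace

variable {n : ℕ} {P : Params} {p : Measure (Pt n)} {C : Matrix (Fin n) (Fin n) ℝ}

/-- The factor of `Cov(p)` in the covariance of the core. -/
def coreVar (P : Params) (n : ℕ) : ℝ := P.ε ^ 2 / (n * Real.log P.T) * (P.lam / (2 - P.lam))

/-- The factor in the exponent of the kernel. -/
def sharpness (P : Params) (n : ℕ) : ℝ := (2 * coreVar P n * (1 - P.lam) ^ 2)⁻¹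

/-- The normalizing factor of the kernel. -/
def kernelScale (P : Params) (p : Measure (Pt n)) : ℝ :=
  (√((2 * Real.pi) ^ n * (coreVar P n • covMat p).det))⁻¹ * ((1 - P.lam) ^ n)⁻¹

/-- The parameters give a nondegenerate kernel in dimension `n`. -/
structure Proper (P : Params) (n : ℕ) : Prop where
  lam_pos : 0 < P.lam
  lam_lt : P.lam < 1
  coreVar_pos : 0 < coreVar P n

theorem Proper.sharpness_pos (hP : Proper P n) : 0 < sharpness P n := by
  have := hP.coreVar_pos
  have := sub_pos.2 hP.lam_lt
  unfold sharpness; positivity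

theorem Proper.kernelScale_pos (hP : Proper P n) (hC : (covMat p).PosDef) :
    0 < kernelScale P p := by
  have h1 := (hC.smul hP.coreVar_pos).det_pos
  have := sub_pos.2 hP.lam_lt
  unfold kernelScale; positivity

/-- The displacement of `x` from the mean of the kernel at `y`. -/
def disp (P : Params) (p : Measure (Pt n)) (x y : Pt n) : Pt n :=
  (x - meanOf p) - P.lam • (y - meanOf p)

/-- Centred at the mean, the affine change of variables only rescales the displacement `x - μ - lam
(y - μ)`. All later estimates see the single exponent `sharpness` times the squared norm of this
vector. -/
theorem kernel_eq (hP : Proper P n) (x y : Pt n) :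
    kernel P p x y = kernelScale P p *
      Real.exp (-(sharpness P n * matNorm (covMat p)⁻¹ (disp P p x y) ^ 2)) := by
  have hl : (1 - P.lam) ≠ 0 := (sub_pos.2 hP.lam_lt).ne'
  have ha := hP.coreVar_pos
  have e1 : (1 - P.lam)⁻¹ • (x - P.lam • y) - meanOf p = (1 - P.lam)⁻¹ • disp P p x y := by
    have : meanOf p = (1 - P.lam)⁻¹ • ((1 - P.lam) • meanOf p) := by
      rw [smul_smul, inv_mul_cancel₀ hl, one_smul]
    nth_rewrite 1 [this]; rw [← smul_sub, disp]; congr 1; module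
  have e2 : ∀ v : Pt n, matNorm (coreVar P n • covMat p)⁻¹ v ^ 2 =
      (coreVar P n)⁻¹ * matNorm (covMat p)⁻¹ v ^ 2 := by
    intro v
    have : (coreVar P n • covMat p)⁻¹ = (coreVar P n)⁻¹ • (covMat p)⁻¹ := by
      -- The covariance need not be invertible here: for a singular matrix both inverses are zero by
      -- convention.
      by_cases hd : IsUnit (covMat p).det
      · have := Matrix.inv_smul' (A := covMat p) (Units.mk0 _ ha.ne') hd
        simpa [Units.smul_def] using this
      · rw [Matrix.nonsing_inv_apply_not_isUnit _ hd, Matrix.nonsing_inv_apply_not_isUnit, smul_zero]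
        rw [Matrix.det_smul]
        simp only [isUnit_iff_ne_zero, ne_eq, not_not] at hd ⊢
        simp [hd]
    rw [this, matNorm, matNorm, Matrix.smul_mulVec, dotProduct_smul, smul_eq_mul,
      Real.sqrt_mul (by positivity), mul_pow, Real.sq_sqrt (by positivity)]
  rw [kernel, coreDensity, gaussianDensity]
  change _ * Real.exp (-(matNorm (coreVar P n • covMat p)⁻¹ _ ^ 2) / 2) * _ = _
  rw [e2, e1, matNorm_smul, kernelScale]
  change (√((2 * Real.pi) ^ n * (coreVar P n • covMat p).det))⁻¹ * _ * _ = _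
  have e3 : -((coreVar P n)⁻¹ * (|(1 - P.lam)⁻¹| * matNorm (covMat p)⁻¹ (disp P p x y)) ^ 2) / 2
      = -(sharpness P n * matNorm (covMat p)⁻¹ (disp P p x y) ^ 2) := by
    rw [mul_pow, sq_abs, sharpness, mul_inv, mul_inv, inv_pow]; ring
  rw [e3]; ring

theorem kernel_pos (hP : Proper P n) (hC : (covMat p).PosDef) (x y : Pt n) :
    0 < kernel P p x y := by
  rw [kernel_eq hP]
  have := hP.kernelScale_pos hC
  positivity

theorem kernel_nonneg (hP : Proper P n) (x y : Pt n) : 0 ≤ kernel P p x y := by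
  rw [kernel_eq hP]
  have := sub_pos.2 hP.lam_lt
  unfold kernelScale
  positivity

theorem continuous_kernel (hP : Proper P n) :
    Continuous fun z : Pt n × Pt n => kernel P p z.1 z.2 := by
  simp only [kernel_eq hP]
  have : Continuous fun z : Pt n × Pt n => matNorm (covMat p)⁻¹ (disp P p z.1 z.2) :=
    (continuous_matNorm _).comp (by unfold disp; fun_prop)
  fun_prop

theorem continuous_kernel_right (hP : Proper P n) (x : Pt n) :
    Continuous (kernel P p x) := by
  have := (continuous_kernel (p := p) hP).comp (Continuous.prodMk_right x)
  exact this

theorem continuous_kernel_left (hP : Proper P n) (y : Pt n) :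
    Continuous fun x => kernel P p x y := by
  have := (continuous_kernel (p := p) hP).comp (Continuous.prodMk_left y)
  exact this

/-- The Gaussian integral for a nondegenerate quadratic form. -/
theorem integral_exp_matNorm (hC : C.PosDef) {b : ℝ} (hb : 0 < b) (c : Pt n) :
    ∫ x, Real.exp (-(b * matNorm C⁻¹ (x - c) ^ 2)) = √C.det * √((Real.pi / b) ^ n) := by
  obtain ⟨B, h1, h2⟩ := exists_linearEquiv_matNorm hC
  have hd := hC.det_pos
  simp only [h1]
  rw [integral_sub_right_eq_self (fun x => Real.exp (-(b * ‖B x‖ ^ 2))) c]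
  have h3 : ∫ v : Pt n, Real.exp (-b * ‖v‖ ^ 2) = √((Real.pi / b) ^ n) := by
    rw [GaussianFourier.integral_rexp_neg_mul_sq_norm hb, Real.sqrt_eq_rpow,
      ← Real.rpow_natCast, ← Real.rpow_mul (by positivity)]
    simp [div_eq_mul_inv]
  have hdet : LinearMap.det (B : Pt n →ₗ[ℝ] Pt n) ≠ 0 := fun h => by
    rw [h, abs_zero] at h2
    have := inv_pos.2 (Real.sqrt_pos.2 hd); linarith
  have h4 := Measure.map_linearMap_addHaar_eq_smul_addHaar (volume : Measure (Pt n)) hdet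
  have h5 : ∫ v, Real.exp (-b * ‖v‖ ^ 2) ∂(Measure.map (B : Pt n →ₗ[ℝ] Pt n) volume) =
      ∫ x, Real.exp (-(b * ‖B x‖ ^ 2)) := by
    change ∫ v, Real.exp (-b * ‖v‖ ^ 2) ∂(Measure.map (fun v => B v) volume) = _
    rw [integral_map B.continuous.aemeasurable (by fun_prop : Continuous _).aestronglyMeasurable]
    simp
  rw [← h5, h4, integral_smul_measure, h3, abs_inv, h2, inv_inv,
    ENNReal.toReal_ofReal (Real.sqrt_nonneg _), smul_eq_mul]

theorem integrable_exp_matNorm (hC : C.PosDef) {b : ℝ} (hb : 0 < b) (c : Pt n) :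
    Integrable fun x => Real.exp (-(b * matNorm C⁻¹ (x - c) ^ 2)) := by
  refine Integrable.of_integral_ne_zero ?_
  rw [integral_exp_matNorm hC hb]
  have := hC.det_pos
  have := Real.pi_pos
  positivity

theorem disp_eq_sub (x y : Pt n) :
    disp P p x y = x - (meanOf p + P.lam • (y - meanOf p)) := by unfold disp; module

theorem integrable_kernel (hP : Proper P n) (hC : (covMat p).PosDef) (y : Pt n) :
    Integrable fun x => kernel P p x y := by
  simp only [kernel_eq hP, disp_eq_sub]
  exact (integrable_exp_matNorm hC hP.sharpness_pos _).const_mul _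

theorem integral_kernel (hP : Proper P n) (hC : (covMat p).PosDef) (y : Pt n) :
    ∫ x, kernel P p x y = 1 := by
  simp only [kernel_eq hP, disp_eq_sub]
  rw [integral_const_mul, integral_exp_matNorm hC hP.sharpness_pos, kernelScale, sharpness]
  have hd := hC.det_pos
  have ha := hP.coreVar_pos
  have hl := sub_pos.2 hP.lam_lt
  have hpi := Real.pi_pos
  have e : Real.pi / (2 * coreVar P n * (1 - P.lam) ^ 2)⁻¹ =
      (2 * Real.pi) * coreVar P n * (1 - P.lam) ^ 2 := by field_simp
  have e1 : (2 * Real.pi * coreVar P n * (1 - P.lam) ^ 2) ^ n =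
      ((2 * Real.pi) ^ n * coreVar P n ^ n) * ((1 - P.lam) ^ n) ^ 2 := by
    rw [mul_pow, mul_pow, ← pow_mul, ← pow_mul, mul_comm 2 n]
  rw [e, Matrix.det_smul, Fintype.card_fin, e1, Real.sqrt_mul (by positivity) (((1 - P.lam) ^ n) ^ 2),
    Real.sqrt_sq (by positivity), ← mul_assoc ((2 * Real.pi) ^ n),
    Real.sqrt_mul (by positivity) (covMat p).det, mul_inv]
  have h1 : √((2 * Real.pi) ^ n * coreVar P n ^ n) ≠ 0 := by positivity
  have h2 : √(covMat p).det ≠ 0 := by positivity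
  field_simp

theorem lintegral_kernel (hP : Proper P n) (hC : (covMat p).PosDef) (y : Pt n) :
    ∫⁻ x, ENNReal.ofReal (kernel P p x y) = 1 := by
  rw [← ofReal_integral_eq_lintegral_ofReal (integrable_kernel hP hC y)
    (Filter.Eventually.of_forall fun x => kernel_nonneg hP x y), integral_kernel hP hC]
  simp

/-- A weighted tail bound for the kernel. -/
theorem integral_tail_kernel_le (hP : Proper P n) (hC : (covMat p).PosDef) (y : Pt n)
    {f : Pt n → ℝ} {S : Set (Pt n)} {A D ρ : ℝ} (hA : 0 ≤ A) (hD : 0 ≤ D) (hρ : 0 ≤ ρ)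
    (hf : AEStronglyMeasurable f) (hS : MeasurableSet S)
    (hfb : ∀ x ∈ S, |f x| ≤ A + D * matNorm (covMat p)⁻¹ (disp P p x y))
    (hSρ : ∀ x ∈ S, ρ ≤ matNorm (covMat p)⁻¹ (disp P p x y)) :
    IntegrableOn (fun x => f x * kernel P p x y) S ∧
    ∫ x in S, |f x| * kernel P p x y ≤
      (A + D / √(sharpness P n)) * Real.exp (-(sharpness P n * ρ ^ 2 / 4)) * √(2 ^ n) := by
  set b := sharpness P n with hb
  have hb0 : 0 < b := hP.sharpness_pos
  have hk := hP.kernelScale_pos hC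
  set N : Pt n → ℝ := fun x => matNorm (covMat p)⁻¹ (disp P p x y)
  set c := (A + D / √b) * Real.exp (-(b * ρ ^ 2 / 4))
  -- With `b` the sharpness, `exp(-b N²)` is split in three: a quarter of the exponent absorbs the
  -- linear growth of `f`, a quarter gives the decay `exp(-b ρ² / 4)`, and the remaining half is a
  -- Gaussian of doubled variance, of total mass `2 ^ (n / 2)`.
  set g : Pt n → ℝ := fun x => c * (kernelScale P p * Real.exp (-(b / 2 * N x ^ 2)))
  have hgi : Integrable g := by
    simp only [g, N, disp_eq_sub]
    exact ((integrable_exp_matNorm hC (half_pos hb0) _).const_mul _).const_mul _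
  have hgint : ∫ x, g x = c * √(2 ^ n) := by
    simp only [g, N, disp_eq_sub]
    rw [integral_const_mul, integral_const_mul, integral_exp_matNorm hC (half_pos hb0)]
    have h1 := integral_kernel hP hC y
    simp only [kernel_eq hP, disp_eq_sub] at h1
    rw [integral_const_mul, integral_exp_matNorm hC hb0] at h1
    have : Real.pi / (b / 2) = (Real.pi / b) * 2 := by field_simp
    have hpi := Real.pi_pos
    rw [this, mul_pow, Real.sqrt_mul (by positivity), ← mul_assoc, ← mul_assoc, ← mul_assoc,
      mul_assoc c, mul_assoc c, mul_assoc (kernelScale P p), h1, mul_one]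
  have hg0 : ∀ x, 0 ≤ g x := fun x => by positivity
  have hpt : ∀ x ∈ S, |f x| * kernel P p x y ≤ g x := by
    intro x hx
    have hN : 0 ≤ N x := matNorm_nonneg _ _
    have h1 : |f x| ≤ (A + D / √b) * Real.exp (b * N x ^ 2 / 4) := by
      refine (hfb x hx).trans ?_
      have e1 : (1 : ℝ) ≤ Real.exp (b * N x ^ 2 / 4) := Real.one_le_exp (by positivity)
      have hs : √b * √b = b := Real.mul_self_sqrt hb0.le
      have hsp : 0 < √b := Real.sqrt_pos.2 hb0
      have e2 : √b * N x ≤ Real.exp (b * N x ^ 2 / 4) := by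
        refine le_trans ?_ (Real.add_one_le_exp _)
        nlinarith [sq_nonneg (√b * N x / 2 - 1)]
      have e3 : N x ≤ (√b)⁻¹ * Real.exp (b * N x ^ 2 / 4) := by
        rw [le_inv_mul_iff₀ hsp]; exact e2
      have e4 : D / √b * Real.exp (b * N x ^ 2 / 4) =
          D * ((√b)⁻¹ * Real.exp (b * N x ^ 2 / 4)) := by ring
      rw [add_mul, e4]
      exact add_le_add (le_mul_of_one_le_right hA e1) (mul_le_mul_of_nonneg_left e3 hD)
    rw [kernel_eq hP]
    have h2 : Real.exp (b * N x ^ 2 / 4) * Real.exp (-(b * N x ^ 2)) ≤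
        Real.exp (-(b * ρ ^ 2 / 4)) * Real.exp (-(b / 2 * N x ^ 2)) := by
      rw [← Real.exp_add, ← Real.exp_add, Real.exp_le_exp]
      have : ρ ^ 2 ≤ N x ^ 2 := by gcongr; exact hSρ x hx
      nlinarith [mul_le_mul_of_nonneg_left this hb0.le]
    calc _ ≤ (A + D / √b) * Real.exp (b * N x ^ 2 / 4) *
          (kernelScale P p * Real.exp (-(b * N x ^ 2))) := by
          gcongr
      _ = (A + D / √b) * kernelScale P p *
          (Real.exp (b * N x ^ 2 / 4) * Real.exp (-(b * N x ^ 2))) := by ring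
      _ ≤ (A + D / √b) * kernelScale P p *
          (Real.exp (-(b * ρ ^ 2 / 4)) * Real.exp (-(b / 2 * N x ^ 2))) := by gcongr
      _ = g x := by simp only [g, c]; ring
  have hm : AEStronglyMeasurable (fun x => f x * kernel P p x y) :=
    hf.mul (continuous_kernel_left hP y).aestronglyMeasurable
  have hi : IntegrableOn (fun x => f x * kernel P p x y) S := by
    refine hgi.integrableOn.mono' hm.restrict ?_
    refine (ae_restrict_mem hS).mono fun x hx => ?_
    rw [norm_mul, Real.norm_eq_abs, Real.norm_of_nonneg (kernel_nonneg hP x y)]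
    exact hpt x hx
  refine ⟨hi, ?_⟩
  have hi' : IntegrableOn (fun x => |f x| * kernel P p x y) S := by
    refine hi.norm.congr (Filter.Eventually.of_forall fun x => ?_)
    simp only [norm_mul, Real.norm_eq_abs, abs_of_nonneg (kernel_nonneg hP x y)]
  calc _ ≤ ∫ x in S, g x := by
        refine setIntegral_mono_on hi' hgi.integrableOn hS hpt
    _ ≤ ∫ x, g x := setIntegral_le_integral hgi (Filter.Eventually.of_forall hg0)
    _ = _ := hgint

/-- The kernel changes little when its second argument moves within an ellipsoid. -/
theorem kernel_le_exp_mul (hP : Proper P n) (hC : (covMat p).PosDef) {x y y' : Pt n} {r R δ : ℝ}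
    (hx : matNorm (covMat p)⁻¹ (x - meanOf p) ≤ r) (hy : matNorm (covMat p)⁻¹ (y - meanOf p) ≤ R)
    (hy' : matNorm (covMat p)⁻¹ (y' - meanOf p) ≤ R)
    (hδ : sharpness P n * (P.lam * matNorm (covMat p)⁻¹ (y - y') * (2 * r + 2 * P.lam * R)) ≤ δ) :
    kernel P p x y' ≤ Real.exp δ * kernel P p x y := by
  rw [kernel_eq hP, kernel_eq hP, mul_left_comm, ← Real.exp_add]
  have hk := hP.kernelScale_pos hC
  have hb := hP.sharpness_pos
  have hl := hP.lam_pos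
  set N := matNorm (covMat p)⁻¹
  have b1 : ∀ z : Pt n, N (z - meanOf p) ≤ R → N (disp P p x z) ≤ r + P.lam * R := by
    intro z hz
    refine (matNorm_sub_le hC _ _).trans ?_
    rw [matNorm_smul, abs_of_pos hl]
    change N _ + P.lam * N _ ≤ _
    gcongr
  have b2 : N (disp P p x y) - N (disp P p x y') ≤ P.lam * N (y - y') := by
    refine (matNorm_sub_le_matNorm_sub hC _ _).trans ?_
    have : disp P p x y - disp P p x y' = (-P.lam) • (y - y') := by unfold disp; module
    rw [this, matNorm_smul, abs_neg, abs_of_pos hl]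
  have n1 : 0 ≤ N (disp P p x y) := matNorm_nonneg _ _
  have n2 : 0 ≤ N (disp P p x y') := matNorm_nonneg _ _
  have n3 : 0 ≤ N (y - y') := matNorm_nonneg _ _
  -- The difference of squares factors: the first factor is Lipschitz in `y` with constant `lam`,
  -- the second is bounded on the ellipsoids.
  have key : N (disp P p x y) ^ 2 - N (disp P p x y') ^ 2 ≤
      P.lam * N (y - y') * (2 * r + 2 * P.lam * R) := by
    have h1 := b1 y hy
    have h2 := b1 y' hy'
    have h3 : 0 ≤ P.lam * N (y - y') := by positivity
    calc _ = (N (disp P p x y) - N (disp P p x y')) * (N (disp P p x y) + N (disp P p x y')) := by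
          ring
      _ ≤ (P.lam * N (y - y')) * (N (disp P p x y) + N (disp P p x y')) := by gcongr
      _ ≤ _ := mul_le_mul_of_nonneg_left (by linarith) h3
  gcongr
  have := mul_le_mul_of_nonneg_left key hb.le
  linarith

theorem integrable_kernel_right (hP : Proper P n) (hp : Regular p) (x : Pt n) :
    Integrable (kernel P p x) p := hp.integrable (continuous_kernel_right hP x)

theorem kernelDensity_pos (hP : Proper P n) (hp : Regular p) (x : Pt n) :
    0 < kernelDensity P p p x := by
  have := hp.prob
  unfold kernelDensity
  rw [integral_pos_iff_support_of_nonneg (fun y => kernel_nonneg hP x y)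
    (integrable_kernel_right hP hp x)]
  have : Function.support (kernel P p x) = univ := by
    ext y; simpa using (kernel_pos hP hp.posDef x y).ne'
  rw [this]; simp

theorem measurable_kernelDensity (hP : Proper P n) (hp : Regular p) :
    Measurable (kernelDensity P p p) := by
  have := hp.prob
  exact ((continuous_kernel (p := p) hP).stronglyMeasurable.integral_prod_right).measurable

/-- The density at `x` is the average of the kernel over `p`. On the ellipsoid the kernel varies at
most by the factor `exp δ`, so already the part of the average over the ellipsoid dominates any
single value there, up to the mass of the ellipsoid. -/
theorem kernel_le_mul_kernelDensity (hP : Proper P n) (hp : Regular p) {x y : Pt n} {r R δ c : ℝ}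
    (hr : 0 ≤ r) (hR : 0 ≤ R)
    (hx : x ∈ ellipsoid p r) (hy : y ∈ ellipsoid p R)
    (hδ : sharpness P n * (P.lam * (2 * R) * (2 * r + 2 * P.lam * R)) ≤ δ)
    (hc : Real.exp δ ≤ c * p.real (ellipsoid p R)) :
    kernel P p x y ≤ c * kernelDensity P p p x := by
  have := hp.prob
  have hb := hP.sharpness_pos
  have hl := hP.lam_pos
  have h1 : ∀ z ∈ ellipsoid p R, kernel P p x y ≤ Real.exp δ * kernel P p x z := by
    intro z hz
    refine kernel_le_exp_mul hP hp.posDef hx hz hy (le_trans ?_ hδ)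
    gcongr
    have := matNorm_sub_le hp.posDef (z - meanOf p) (y - meanOf p)
    rw [sub_sub_sub_cancel_right] at this
    have h1 : matNorm _ _ ≤ R := hz
    have h2 : matNorm _ _ ≤ R := hy
    linarith
  have h2 : p.real (ellipsoid p R) * kernel P p x y ≤ Real.exp δ * kernelDensity P p p x := by
    calc _ = ∫ z in ellipsoid p R, kernel P p x y ∂p := by simp
      _ ≤ ∫ z in ellipsoid p R, Real.exp δ * kernel P p x z ∂p := by
          refine setIntegral_mono_on (by simp) ?_ (isClosed_ellipsoid p R).measurableSet h1
          exact ((integrable_kernel_right hP hp x).const_mul _).integrableOn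
      _ ≤ ∫ z, Real.exp δ * kernel P p x z ∂p :=
          setIntegral_le_integral ((integrable_kernel_right hP hp x).const_mul _)
            (Filter.Eventually.of_forall fun z =>
              mul_nonneg (Real.exp_nonneg _) (kernel_nonneg hP x z))
      _ = _ := by rw [integral_const_mul]; rfl
  have hk := kernelDensity_pos hP hp x
  have hkk := kernel_pos hP hp.posDef x y
  have hpe : 0 < p.real (ellipsoid p R) := by
    rcases (measureReal_nonneg (μ := p) (s := ellipsoid p R)).lt_or_eq with h | h
    · exact h
    · rw [← h, mul_zero] at hc; exact absurd hc (not_le.2 (Real.exp_pos _))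
  have h3 : p.real (ellipsoid p R) * kernel P p x y ≤
      p.real (ellipsoid p R) * (c * kernelDensity P p p x) := by
    refine h2.trans ?_
    calc _ ≤ (c * p.real (ellipsoid p R)) * kernelDensity P p p x := by gcongr
      _ = _ := by ring
  exact le_of_mul_le_mul_left h3 hpe

theorem lintegral_kernelLaw (hP : Proper P n) (hp : Regular p) {g : Pt n → ℝ≥0∞}
    (hg : Measurable g) :
    ∫⁻ x, g x ∂(kernelLaw P p p) = ∫⁻ y, (∫⁻ x, g x * ENNReal.ofReal (kernel P p x y)) ∂p := by
  have := hp.prob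
  have hm : Measurable fun z : Pt n × Pt n => ENNReal.ofReal (kernel P p z.1 z.2) :=
    (continuous_kernel hP).measurable.ennreal_ofReal
  rw [kernelLaw, lintegral_withDensity_eq_lintegral_mul _
    (measurable_kernelDensity hP hp).ennreal_ofReal hg]
  rw [lintegral_lintegral_swap]
  · refine lintegral_congr fun x => ?_
    rw [Pi.mul_apply, kernelDensity, ofReal_integral_eq_lintegral_ofReal
      (integrable_kernel_right hP hp x) (Filter.Eventually.of_forall fun y => kernel_nonneg hP x y),
      mul_comm, lintegral_const_mul]
    exact (continuous_kernel_right hP x).measurable.ennreal_ofReal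
  · exact ((hg.comp measurable_snd).mul (hm.comp measurable_swap)).aemeasurable

theorem isProbabilityMeasure_kernelLaw (hP : Proper P n) (hp : Regular p) :
    IsProbabilityMeasure (kernelLaw P p p) := by
  have := hp.prob
  constructor
  have h := lintegral_kernelLaw hP hp (g := fun _ => 1) measurable_const
  simpa [lintegral_kernel hP hp.posDef] using h

theorem integral_kernelLaw (hP : Proper P n) (hp : Regular p) (g : Pt n → ℝ) :
    ∫ x, g x ∂(kernelLaw P p p) = ∫ x, kernelDensity P p p x * g x := by
  rw [kernelLaw, integral_withDensity_eq_integral_toReal_smul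
    (measurable_kernelDensity hP hp).ennreal_ofReal (by simp)]
  simp [ENNReal.toReal_ofReal (kernelDensity_pos hP hp _).le]

end GaussianKernel

end KernelBCO

namespace KernelBCO

/-! ### Convex sets, approximately log-concave measures and ellipsoids -/

section ConvexGeometry

open scoped InnerProductSpace

variable {n : ℕ} {p q : Measure (Pt n)} {F K : Set (Pt n)}

theorem lintegral_image_smul_add {c : ℝ} (hc : 0 < c) (v : Pt n) {A : Set (Pt n)}
    (hA : MeasurableSet A) (w : Pt n → ℝ≥0∞) :
    ∫⁻ x in (fun x => c • x + v) '' A, w x =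
      ENNReal.ofReal (c ^ n) * ∫⁻ x in A, w (c • x + v) := by
  have hf : ∀ x ∈ A, HasFDerivWithinAt (fun x : Pt n => c • x + v)
      (c • ContinuousLinearMap.id ℝ (Pt n)) A x := fun x _ => by
    simpa using (((hasFDerivAt_id x).const_smul c).add_const v).hasFDerivWithinAt
  rw [lintegral_image_eq_lintegral_abs_det_fderiv_mul _ hA hf, lintegral_const_mul']
  · congr 2
    rw [ContinuousLinearMap.det, ContinuousLinearMap.toLinearMap_smul, LinearMap.det_smul]
    simp [abs_of_pos hc]
  · exact ENNReal.ofReal_ne_top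
  · intro x _ y _ h
    simpa [hc.ne'] using h

theorem volume_image_smul_add {c : ℝ} (hc : 0 < c) (v : Pt n) {A : Set (Pt n)}
    (hA : MeasurableSet A) :
    volume ((fun x => c • x + v) '' A) = ENNReal.ofReal (c ^ n) * volume A := by
  have := lintegral_image_smul_add hc v hA (fun _ => 1)
  simpa using this

theorem mul_sub_le_matNorm_combo (hC : (covMat p).PosDef) {s : ℝ} (hs0 : 0 ≤ s) (hs1 : s ≤ 1)
    (x y : Pt n) :
    s * matNorm (covMat p)⁻¹ (y - meanOf p) - (1 - s) * matNorm (covMat p)⁻¹ (x - meanOf p) ≤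
      matNorm (covMat p)⁻¹ ((1 - s) • x + s • y - meanOf p) := by
  have h := matNorm_sub_le_matNorm_sub hC (s • (y - meanOf p)) (-((1 - s) • (x - meanOf p)))
  rw [matNorm_neg, matNorm_smul, matNorm_smul, abs_of_nonneg hs0, abs_of_nonneg (by linarith)] at h
  refine h.trans (le_of_eq ?_)
  congr 1; module

theorem matNorm_combo_le (hC : (covMat p).PosDef) {s : ℝ} (hs0 : 0 ≤ s) (hs1 : s ≤ 1)
    (x y : Pt n) :
    matNorm (covMat p)⁻¹ ((1 - s) • x + s • y - meanOf p) ≤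
      (1 - s) * matNorm (covMat p)⁻¹ (x - meanOf p) + s * matNorm (covMat p)⁻¹ (y - meanOf p) := by
  have h := matNorm_add_le hC ((1 - s) • (x - meanOf p)) (s • (y - meanOf p))
  rw [matNorm_smul, matNorm_smul, abs_of_nonneg hs0, abs_of_nonneg (by linarith)] at h
  refine le_trans (le_of_eq ?_) h
  congr 1; module

theorem one_sub_mul_le_pow (n : ℕ) {s : ℝ} (hs : s ≤ 1) : 1 - n * s ≤ (1 - s) ^ n := by
  have := one_add_mul_le_pow (a := -s) (by linarith) n
  calc _ = 1 + n * (-s) := by ring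
    _ ≤ _ := this
    _ = _ := by ring

/-- A convex set more than half of whose volume is in an ellipsoid is contained in a dilation of
the ellipsoid. -/
theorem subset_ellipsoid_of_half_volume (hn : 1 ≤ n) (hC : (covMat p).PosDef) (hF : Convex ℝ F)
    (hFm : MeasurableSet F) (hFt : volume F ≠ ∞) {ρ : ℝ} (hρ : 0 < ρ)
    (hvol : ¬ volume (F ∩ ellipsoid p ρ) ≤ 2⁻¹ * volume F) :
    F ⊆ ellipsoid p (10 * n * ρ) := by
  intro y hy
  by_contra hyE
  set N : Pt n → ℝ := fun x => matNorm (covMat p)⁻¹ (x - meanOf p)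
  have hY : 10 * n * ρ < N y := not_le.1 hyE
  have hn' : (1 : ℝ) ≤ n := by exact_mod_cast hn
  set Y := N y
  have hY0 : 0 < Y := lt_trans (by positivity) hY
  set A := F ∩ ellipsoid p ρ
  have hA : MeasurableSet A := hFm.inter (isClosed_ellipsoid p ρ).measurableSet
  have hE3 : MeasurableSet (ellipsoid p (3 * ρ)) := (isClosed_ellipsoid p _).measurableSet
  have key : ∀ k : ℝ, 0 < k → k ≤ 4 → ENNReal.ofReal (1 - k / 10) * volume A ≤
      volume ((fun x => (1 - k * ρ / Y) • x + (k * ρ / Y) • y) '' A) ∧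
      (fun x => (1 - k * ρ / Y) • x + (k * ρ / Y) • y) '' A ⊆
        F ∩ {x | (k - 1) * ρ < N x ∧ N x ≤ (k + 1) * ρ} := by
    intro k hk hk4
    have hs0 : 0 < k * ρ / Y := by positivity
    have hs : k * ρ / Y ≤ k / (10 * n) := by
      rw [div_le_div_iff₀ hY0 (by positivity)]
      nlinarith
    have hs1 : k * ρ / Y < 1 := by
      refine hs.trans_lt ?_
      rw [div_lt_one (by positivity)]; linarith
    constructor
    · rw [volume_image_smul_add (by linarith) _ hA]
      gcongr
      refine le_trans ?_ (one_sub_mul_le_pow n hs1.le)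
      have : n * (k * ρ / Y) ≤ n * (k / (10 * n)) := by gcongr
      have e : n * (k / (10 * n)) = k / 10 := by field_simp
      linarith
    · rintro _ ⟨x, hx, rfl⟩
      have hxN : N x ≤ ρ := hx.2
      have e : k * ρ / Y * Y = k * ρ := by field_simp
      refine ⟨hF hx.1 hy (by linarith) hs0.le (by ring), ?_, ?_⟩
      · refine lt_of_lt_of_le ?_ (mul_sub_le_matNorm_combo hC hs0.le hs1.le x y)
        change _ < k * ρ / Y * Y - (1 - k * ρ / Y) * N x
        nlinarith [mul_le_mul_of_nonneg_left hxN (by linarith : 0 ≤ 1 - k * ρ / Y),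
          mul_pos hs0 hρ]
      · refine (matNorm_combo_le hC hs0.le hs1.le x y).trans ?_
        change (1 - k * ρ / Y) * N x + k * ρ / Y * Y ≤ _
        nlinarith [mul_le_mul_of_nonneg_left hxN (by linarith : 0 ≤ 1 - k * ρ / Y),
          mul_pos hs0 hρ]
  obtain ⟨v1, s1⟩ := key 2 (by norm_num) (by norm_num)
  obtain ⟨v2, s2⟩ := key 4 (by norm_num) (by norm_num)
  have t1 : volume ((fun x => (1 - 2 * ρ / Y) • x + (2 * ρ / Y) • y) '' A) ≤
      volume ((F \ ellipsoid p ρ) ∩ ellipsoid p (3 * ρ)) := by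
    refine measure_mono fun z hz => ?_
    obtain ⟨a, b, c⟩ := s1 hz
    exact ⟨⟨a, fun h => absurd (show N z ≤ ρ from h) (by linarith)⟩,
      show N z ≤ 3 * ρ by linarith⟩
  have t2 : volume ((fun x => (1 - 4 * ρ / Y) • x + (4 * ρ / Y) • y) '' A) ≤
      volume ((F \ ellipsoid p ρ) \ ellipsoid p (3 * ρ)) := by
    refine measure_mono fun z hz => ?_
    obtain ⟨a, b, c⟩ := s2 hz
    exact ⟨⟨a, fun h => absurd (show N z ≤ ρ from h) (by linarith)⟩,
      fun h => absurd (show N z ≤ 3 * ρ from h) (by linarith)⟩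
  -- `A` and its images for `k = 2` and `k = 4` lie in disjoint shells of `F`, and `1 + 4/5 + 3/5 >
  -- 2`.
  have hsum : volume A + (ENNReal.ofReal (1 - 2 / 10) * volume A +
      ENNReal.ofReal (1 - 4 / 10) * volume A) ≤ volume F := by
    rw [← measure_inter_add_sdiff F (isClosed_ellipsoid p ρ).measurableSet,
      ← measure_inter_add_sdiff (F \ ellipsoid p ρ) hE3]
    gcongr
    · exact v1.trans t1
    · exact v2.trans t2
  apply hvol
  have hAt : volume A ≠ ∞ := measure_ne_top_of_subset inter_subset_left hFt
  have : 2 * volume A ≤ volume F := by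
    refine le_trans ?_ hsum
    rw [← add_mul, ← ENNReal.ofReal_add (by norm_num) (by norm_num), two_mul]
    gcongr
    refine le_mul_of_one_le_left (by positivity) ?_
    rw [ENNReal.one_le_ofReal]; norm_num
  calc volume A = 2⁻¹ * (2 * volume A) := by
        rw [← mul_assoc, ENNReal.inv_mul_cancel (by norm_num) (by norm_num), one_mul]
    _ ≤ _ := by gcongr

/-- An approximately log-concave density gives little mass to the complement of a large
ellipsoid. -/
theorem measure_compl_ellipsoid_le_of_approx_convex (hn : 1 ≤ n) (hp : Regular p)
    (hF : Convex ℝ F) (hFm : MeasurableSet F) (hF0 : volume F ≠ 0) (hFt : volume F ≠ ∞)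
    {S g : Pt n → ℝ} (hpS : p = (∫⁻ y in F, ENNReal.ofReal (Real.exp (-S y)))⁻¹ •
      (volume.restrict F).withDensity fun y => ENNReal.ofReal (Real.exp (-S y)))
    (hg : ConvexOn ℝ F g) (hSg : ∀ y ∈ F, |S y - g y| ≤ 1) {V θ α : ℝ}
    (hS : ∀ y ∈ F, 0 ≤ S y ∧ S y ≤ V) (hθ : 0 < θ) (hθ1 : θ < 1) (hθV : θ * (V + 2) ≤ 1)
    (hα : 80 * n * √n ≤ α) :
    p.real (ellipsoid p α)ᶜ ≤ Real.exp (4 - 3 * α / (40 * √n)) * (θ ^ n)⁻¹ := by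
  have hprob := hp.prob
  have hC := hp.posDef
  have hn' : (1 : ℝ) ≤ n := by exact_mod_cast hn
  have hsn : 1 ≤ √(n : ℝ) := Real.one_le_sqrt.2 hn'
  have hα0 : 0 < α := lt_of_lt_of_le (by positivity) hα
  set w : Pt n → ℝ≥0∞ := fun y => ENNReal.ofReal (Real.exp (-S y))
  set Z := ∫⁻ y in F, w y
  have hpB : ∀ B, MeasurableSet B → p B = Z⁻¹ * ∫⁻ y in B ∩ F, w y := by
    intro B hB
    rw [hpS, Measure.smul_apply, withDensity_apply _ hB, Measure.restrict_restrict hB, smul_eq_mul]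
  have hZ : Z ≠ 0 ∧ Z ≠ ∞ := by
    have h1 := hpB univ .univ
    rw [measure_univ, univ_inter] at h1
    constructor
    · intro h
      rw [show ∫⁻ y in F, w y = 0 from h, mul_zero] at h1; simp at h1
    · intro h
      rw [h] at h1; simp at h1
  have hpB' : ∀ B, MeasurableSet B → ∫⁻ y in B ∩ F, w y = p B * Z := by
    intro B hB
    rw [hpB B hB, mul_comm, ← mul_assoc, ENNReal.mul_inv_cancel hZ.1 hZ.2, one_mul]
  obtain ⟨y₁, hy₁⟩ : F.Nonempty := nonempty_of_measure_ne_zero hF0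
  have hgm1 : ∀ y ∈ F, -1 ≤ g y := fun y hy => by
    have := abs_le.1 (hSg y hy); have := hS y hy; linarith
  have hbdd : BddBelow (g '' F) := ⟨-1, by rintro _ ⟨y, hy, rfl⟩; exact hgm1 y hy⟩
  set m := sInf (g '' F)
  have hm : ∀ y ∈ F, m ≤ g y := fun y hy => csInf_le hbdd ⟨y, hy, rfl⟩
  have hm1 : -1 ≤ m := le_csInf ⟨_, y₁, hy₁, rfl⟩ (by rintro _ ⟨y, hy, rfl⟩; exact hgm1 y hy)
  obtain ⟨_, ⟨y₀, hy₀, rfl⟩, hy₀m⟩ := exists_lt_of_csInf_lt (s := g '' F) ⟨_, y₁, hy₁, rfl⟩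
    (show sInf (g '' F) < m + 1 by simp [m])
  -- the partition function is not too small
  have hZlow : ENNReal.ofReal (θ ^ n * Real.exp (-m - 3)) * volume F ≤ Z := by
    -- On the copy of `F` contracted by `θ` about a near minimizer of `g`, convexity and `θ (V + 2)
    -- ≤ 1` keep `g` below `m + 2`, hence `S` below `m + 3`.
    have hsub : (fun x => θ • x + (1 - θ) • y₀) '' F ⊆ F := by
      rintro _ ⟨x, hx, rfl⟩
      exact hF hx hy₀ hθ.le (by linarith) (by ring)
    calc _ = ENNReal.ofReal (θ ^ n) * ∫⁻ x in F, ENNReal.ofReal (Real.exp (-m - 3)) := by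
          rw [setLIntegral_const, ← mul_assoc, ENNReal.ofReal_mul (by positivity)]
      _ ≤ ENNReal.ofReal (θ ^ n) * ∫⁻ x in F, w (θ • x + (1 - θ) • y₀) := by
          gcongr ENNReal.ofReal (θ ^ n) * ?_
          refine setLIntegral_mono_ae' hFm (Filter.Eventually.of_forall fun x hx => ?_)
          refine ENNReal.ofReal_le_ofReal (Real.exp_le_exp.2 ?_)
          have hz : θ • x + (1 - θ) • y₀ ∈ F := hsub ⟨x, hx, rfl⟩
          have h1 := hg.2 hx hy₀ hθ.le (by linarith : 0 ≤ 1 - θ) (by ring)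
          simp only [smul_eq_mul] at h1
          have h2 := abs_le.1 (hSg _ hz)
          have h3 := abs_le.1 (hSg _ hx)
          have h4 := (hS x hx).2
          have h5 : θ * g x ≤ θ * (V + 1) := by gcongr; linarith
          have h6 : (1 - θ) * g y₀ ≤ (1 - θ) * (m + 1) :=
            mul_le_mul_of_nonneg_left hy₀m.le (by linarith)
          have h7 : θ * (-1) ≤ θ * m := by gcongr
          nlinarith
      _ = ∫⁻ x in (fun x => θ • x + (1 - θ) • y₀) '' F, w x :=
          (lintegral_image_smul_add hθ _ hFm w).symm
      _ ≤ Z := lintegral_mono_set hsub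
  -- pointwise bound outside the ellipsoid
  set R := 20 * √(n : ℝ)
  have hR : 0 < R := by positivity
  -- Since `s α = 2 R`, moving `𝓔(R)` with weight `s` towards a point outside `𝓔(α)` moves it off
  -- itself, while `n s ≤ 1/2` preserves half of the volume.
  set s := 2 * R / α
  have hs0 : 0 < s := by positivity
  have hns : n * s ≤ 1 / 2 := by
    rw [show n * s = (40 * n * √n) / α by simp only [s, R]; ring, div_le_iff₀ hα0]; linarith
  have hs1 : s ≤ 1 / 2 := le_trans (le_mul_of_one_le_left hs0.le hn') hns
  have hEm : ∀ r, MeasurableSet (ellipsoid p r) := fun r => (isClosed_ellipsoid p r).measurableSet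
  have hcheb : p.real (ellipsoid p R)ᶜ ≤ 1 / 400 := by
    refine (hp.measureReal_compl_ellipsoid_le hR).trans (le_of_eq ?_)
    rw [mul_pow, Real.sq_sqrt (by positivity)]; field_simp; norm_num
  -- The displaced copy of `𝓔(R) ∩ F` has mass at most `1/400`. It keeps half of the volume and its
  -- density falls at most by the factor `exp(-2 + s (m - g y))`, so this factor is at most `2/399 ≤
  -- exp(-5)`, which says `s (g y - m) ≥ 3`.
  have hptw : ∀ y ∈ F, y ∉ ellipsoid p α → m + 3 / s ≤ g y := by
    intro y hy hyE
    have hyN : α < matNorm (covMat p)⁻¹ (y - meanOf p) := not_le.1 hyE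
    set A := ellipsoid p R ∩ F
    have hA : MeasurableSet A := (hEm R).inter hFm
    have hc : 0 < 1 - s := by linarith
    have hsub : (fun x => (1 - s) • x + s • y) '' A ⊆ (ellipsoid p R)ᶜ ∩ F := by
      rintro _ ⟨x, hx, rfl⟩
      refine ⟨fun h => ?_, hF hx.2 hy hc.le hs0.le (by ring)⟩
      have h1 := mul_sub_le_matNorm_combo hC hs0.le (by linarith) x y
      have h2 : matNorm (covMat p)⁻¹ ((1 - s) • x + s • y - meanOf p) ≤ R := h
      have h3 : matNorm (covMat p)⁻¹ (x - meanOf p) ≤ R := hx.1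
      have h4 : s * α = 2 * R := by simp only [s]; field_simp
      nlinarith [mul_lt_mul_of_pos_left hyN hs0, mul_le_mul_of_nonneg_left h3 hc.le, mul_pos hs0 hR]
    have h1 : ENNReal.ofReal (1 / 2 * Real.exp (-2 + s * (m - g y))) * (p (ellipsoid p R) * Z) ≤
        p (ellipsoid p R)ᶜ * Z := by
      rw [← hpB' _ (hEm R), ← hpB' _ (hEm R).compl]
      calc _ ≤ ENNReal.ofReal ((1 - s) ^ n) * (ENNReal.ofReal (Real.exp (-2 + s * (m - g y))) *
            ∫⁻ x in A, w x) := by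
            rw [ENNReal.ofReal_mul (by norm_num), mul_assoc]
            gcongr
            refine le_trans ?_ (one_sub_mul_le_pow n (by linarith))
            linarith
        _ ≤ ENNReal.ofReal ((1 - s) ^ n) * ∫⁻ x in A, w ((1 - s) • x + s • y) := by
            rw [← lintegral_const_mul' _ _ ENNReal.ofReal_ne_top]
            gcongr ENNReal.ofReal ((1 - s) ^ n) * ?_
            refine setLIntegral_mono_ae' hA (Filter.Eventually.of_forall fun x hx => ?_)
            simp only [w]
            rw [← ENNReal.ofReal_mul (by positivity), ← Real.exp_add]
            refine ENNReal.ofReal_le_ofReal (Real.exp_le_exp.2 ?_)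
            have hz : (1 - s) • x + s • y ∈ F := (hsub ⟨x, hx, rfl⟩).2
            have h1 := hg.2 hx.2 hy hc.le hs0.le (by ring)
            simp only [smul_eq_mul] at h1
            have h2 := abs_le.1 (hSg _ hz)
            have h3 := abs_le.1 (hSg _ hx.2)
            have h4 := mul_le_mul_of_nonneg_left (hm x hx.2) hs0.le
            nlinarith
        _ = ∫⁻ x in (fun x => (1 - s) • x + s • y) '' A, w x :=
            (lintegral_image_smul_add hc _ hA w).symm
        _ ≤ _ := lintegral_mono_set hsub
    rw [← mul_assoc] at h1
    have h2 := (ENNReal.mul_le_mul_iff_left hZ.1 hZ.2).1 h1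
    have h3 : 1 / 2 * Real.exp (-2 + s * (m - g y)) * p.real (ellipsoid p R) ≤
        p.real (ellipsoid p R)ᶜ := by
      have := ENNReal.toReal_mono (measure_ne_top _ _) h2
      rwa [ENNReal.toReal_mul, ENNReal.toReal_ofReal (by positivity)] at this
    have h4 : p.real (ellipsoid p R)ᶜ = 1 - p.real (ellipsoid p R) := by
      rw [measureReal_compl (hEm R)]; simp
    have h5 : Real.exp (-2 + s * (m - g y)) ≤ 2 / 399 := by
      nlinarith [Real.exp_pos (-2 + s * (m - g y))]
    have h6 : (2 / 399 : ℝ) ≤ Real.exp (-5) := by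
      rw [Real.exp_neg, div_le_iff₀ (by norm_num), ← div_eq_inv_mul, le_div_iff₀ (by positivity)]
      have : Real.exp 5 = Real.exp 1 ^ 5 := by rw [← Real.exp_nat_mul]; norm_num
      rw [this]
      have := Real.exp_one_lt_d9
      calc 2 * Real.exp 1 ^ 5 ≤ 2 * 2.7182818286 ^ 5 := by gcongr
        _ ≤ 399 := by norm_num
    have h7 := Real.exp_le_exp.1 (h5.trans h6)
    have : 3 / s ≤ g y - m := by rw [div_le_iff₀ hs0]; linarith
    linarith
  -- conclusion
  have hfin : (p (ellipsoid p α)ᶜ) * Z ≤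
      ENNReal.ofReal (Real.exp (1 - m - 3 / s)) * volume F := by
    rw [← hpB' _ (hEm α).compl]
    calc _ ≤ ∫⁻ y in (ellipsoid p α)ᶜ ∩ F, ENNReal.ofReal (Real.exp (1 - m - 3 / s)) := by
          refine setLIntegral_mono_ae' ((hEm α).compl.inter hFm)
            (Filter.Eventually.of_forall fun y hy => ?_)
          refine ENNReal.ofReal_le_ofReal (Real.exp_le_exp.2 ?_)
          have := hptw y hy.2 hy.1
          have := abs_le.1 (hSg y hy.2)
          linarith
      _ ≤ ∫⁻ y in F, ENNReal.ofReal (Real.exp (1 - m - 3 / s)) :=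
          lintegral_mono_set inter_subset_right
      _ = _ := setLIntegral_const _ _
  have h8 : p (ellipsoid p α)ᶜ * ENNReal.ofReal (θ ^ n * Real.exp (-m - 3)) ≤
      ENNReal.ofReal (Real.exp (1 - m - 3 / s)) := by
    refine (ENNReal.mul_le_mul_iff_left hF0 hFt).1 ?_
    rw [mul_assoc]
    exact le_trans (by gcongr) hfin
  have h9 := ENNReal.toReal_mono ENNReal.ofReal_ne_top h8
  rw [ENNReal.toReal_mul, ENNReal.toReal_ofReal (by positivity),
    ENNReal.toReal_ofReal (by positivity), ← mul_assoc, ← le_div_iff₀ (Real.exp_pos _),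
    ← Real.exp_sub, ← le_div_iff₀ (by positivity)] at h9
  refine h9.trans (le_of_eq ?_)
  rw [div_eq_mul_inv]
  congr 2
  simp only [s, R]
  field_simp
  ring

end ConvexGeometry

end KernelBCO

namespace KernelBCO

/-! ### Stability of mean and covariance, and ellipsoids inside the body -/

section CovarianceComparison

open scoped InnerProductSpace

variable {n : ℕ} {p q : Measure (Pt n)} {F K : Set (Pt n)}

/-- It suffices to test the hypothesis on the vector dual to `v`. -/
theorem matNorm_le_of_forall_inner_sq_le (hC : (covMat p).PosDef) {v : Pt n} {c : ℝ} (hc : 0 ≤ c)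
    (h : ∀ u : Pt n, ⟪u, v⟫_ℝ ^ 2 ≤ c ^ 2 * matNorm (covMat p) u ^ 2) :
    matNorm (covMat p)⁻¹ v ≤ c := by
  obtain ⟨u, h1, h2⟩ := exists_dual_matNorm hC v
  have := h u
  rw [h1, h2] at this
  have hN := matNorm_nonneg (covMat p)⁻¹ v
  by_contra hlt
  push Not at hlt
  have : c ^ 2 < matNorm (covMat p)⁻¹ v ^ 2 := by gcongr
  have h0 : 0 < matNorm (covMat p)⁻¹ v := lt_of_le_of_lt hc hlt
  nlinarith [mul_lt_mul_of_pos_right this (pow_pos h0 2)]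

theorem inner_sq_le_matNorm (hC : (covMat p).PosDef) (u v : Pt n) :
    ⟪u, v⟫_ℝ ^ 2 ≤ matNorm (covMat p) u ^ 2 * matNorm (covMat p)⁻¹ v ^ 2 := by
  rw [← mul_pow, sq_le_sq]
  rw [abs_of_nonneg (mul_nonneg (matNorm_nonneg _ _) (matNorm_nonneg _ _))]
  refine abs_le.2 ⟨?_, inner_le_matNorm_mul hC u v⟩
  have := inner_le_matNorm_mul hC u (-v)
  rw [matNorm_neg, inner_neg_right] at this
  linarith

theorem sq_integral_le [IsProbabilityMeasure p] {f : Pt n → ℝ} (hf : Integrable f p)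
    (hf2 : Integrable (fun x => f x ^ 2) p) : (∫ x, f x ∂p) ^ 2 ≤ ∫ x, f x ^ 2 ∂p := by
  set c := ∫ x, f x ∂p
  have h : 0 ≤ ∫ x, (f x - c) ^ 2 ∂p := integral_nonneg fun _ => sq_nonneg _
  have e : ∀ x, (f x - c) ^ 2 = f x ^ 2 - ((2 * c) * f x - c ^ 2) := fun x => by ring
  simp only [e] at h
  have hi : Integrable (fun x => (2 * c) * f x - c ^ 2) p :=
    (hf.const_mul _).sub (integrable_const _)
  rw [integral_sub hf2 hi, integral_sub (hf.const_mul _) (integrable_const _),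
    integral_const_mul] at h
  simp only [integral_const, probReal_univ, one_smul] at h
  change 0 ≤ _ - (2 * c * c - c ^ 2) at h
  nlinarith

theorem integral_le_integral_of_le_smul (hp : Regular p) (hq2 : q ≤ (2 : ℝ≥0∞) • p)
    {f : Pt n → ℝ} (hf : Continuous f) (hf0 : ∀ x, 0 ≤ f x) : ∫ x, f x ∂q ≤ 2 * ∫ x, f x ∂p := by
  have h := integral_mono_measure (f := f) hq2 (Filter.Eventually.of_forall hf0)
    ((hp.integrable hf).smul_measure (by norm_num))
  rw [integral_smul_measure] at h
  simpa using h

/-- Covariances of measures with comparable densities are comparable. -/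
theorem matNorm_le_mul_of_comparable (hp : Regular p) (hq : Regular q) {δ R κ : ℝ}
    (hFm : MeasurableSet F)
    (hqF : ENNReal.ofReal (Real.exp (-δ)) • p.restrict F ≤ q) (hq2 : q ≤ (2 : ℝ≥0∞) • p)
    (hsupp : ∀ᵐ y ∂p, y ∈ ellipsoid p R) (hκ : 0 ≤ κ)
    (h : 1 ≤ κ ^ 2 * (Real.exp (-δ) * (1 - (R + 2) ^ 2 * p.real Fᶜ))) :
    matNorm (covMat p)⁻¹ (meanOf q - meanOf p) ≤ 2 ∧
      ∀ v, matNorm (covMat q)⁻¹ v ≤ κ * matNorm (covMat p)⁻¹ v := by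
  have := hp.prob
  have := hq.prob
  have hC := hp.posDef
  -- In each direction the squared shift of the mean is, by Jensen, at most the second moment of `q`
  -- about the mean of `p`, which is at most twice the variance of `p`.
  have hmean : matNorm (covMat p)⁻¹ (meanOf q - meanOf p) ≤ 2 := by
    refine matNorm_le_of_forall_inner_sq_le hC (by norm_num) fun u => ?_
    have e : ⟪u, meanOf q - meanOf p⟫_ℝ = ∫ y, ⟪u, y - meanOf p⟫_ℝ ∂q := by
      simp only [inner_sub_right]
      rw [integral_sub (hq.integrable (by fun_prop)) (integrable_const _), hq.inner_meanOf]
      simp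
    rw [e]
    refine (sq_integral_le (hq.integrable (by fun_prop)) (hq.integrable (by fun_prop))).trans ?_
    have h1 := integral_le_integral_of_le_smul hp hq2
      (f := fun y => ⟪u, y - meanOf p⟫_ℝ ^ 2) (by fun_prop) fun _ => sq_nonneg _
    rw [← hp.matNorm_covMat_sq] at h1
    nlinarith [sq_nonneg (matNorm (covMat p) u)]
  refine ⟨hmean, fun v => ?_⟩
  have hcov : ∀ u, matNorm (covMat p) u ^ 2 ≤ κ ^ 2 * matNorm (covMat q) u ^ 2 := by
    intro u
    set f : Pt n → ℝ := fun y => ⟪u, y - meanOf q⟫_ℝ ^ 2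
    have hfc : Continuous f := by fun_prop
    set σ := matNorm (covMat p) u ^ 2
    have hσ0 : 0 ≤ σ := sq_nonneg _
    have hf0 : ∀ y, 0 ≤ f y := fun _ => sq_nonneg _
    have h1 : Real.exp (-δ) * ∫ y in F, f y ∂p ≤ matNorm (covMat q) u ^ 2 := by
      rw [hq.matNorm_covMat_sq]
      have := integral_mono_measure (f := f) hqF (Filter.Eventually.of_forall hf0)
        (hq.integrable hfc)
      rw [integral_smul_measure, ENNReal.toReal_ofReal (Real.exp_nonneg _)] at this
      exact this
    -- Moving the centre from the mean of `p` to that of `q` can only increase the second moment.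
    have h2 : σ ≤ ∫ y, f y ∂p := by
      have e : ∀ y, f y = ⟪u, y - meanOf p⟫_ℝ ^ 2 +
          2 * ⟪u, meanOf p - meanOf q⟫_ℝ * ⟪u, y - meanOf p⟫_ℝ + ⟪u, meanOf p - meanOf q⟫_ℝ ^ 2 := by
        intro y
        have : y - meanOf q = (y - meanOf p) + (meanOf p - meanOf q) := by abel
        simp only [f]
        rw [this, inner_add_right]; ring
      simp only [e]
      rw [integral_add (hp.integrable (by fun_prop)) (integrable_const _),
        integral_add (hp.integrable (by fun_prop)) (hp.integrable (by fun_prop)),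
        integral_const_mul, hp.integral_inner_sub_meanOf, ← hp.matNorm_covMat_sq]
      simp only [mul_zero, add_zero, integral_const, probReal_univ, one_smul]
      exact le_add_of_nonneg_right (sq_nonneg _)
    -- Outside `F` there is no lower bound on `q`. The loss is small because `f` is bounded on the
    -- support and `p` gives little mass to the complement; the summand 2 is the shift of the mean.
    have h3 : ∫ y in Fᶜ, f y ∂p ≤ σ * (R + 2) ^ 2 * p.real Fᶜ := by
      have hb : ∀ᵐ y ∂p.restrict Fᶜ, f y ≤ σ * (R + 2) ^ 2 := by
        refine ae_restrict_of_ae (hsupp.mono fun y hy => ?_)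
        refine (inner_sq_le_matNorm hC u _).trans ?_
        gcongr
        · exact matNorm_nonneg _ _
        · have e : y - meanOf q = (y - meanOf p) - (meanOf q - meanOf p) := by abel
          rw [e]
          exact (matNorm_sub_le hC _ _).trans (add_le_add hy hmean)
      calc _ ≤ ∫ y in Fᶜ, σ * (R + 2) ^ 2 ∂p :=
            integral_mono_ae (hp.integrable hfc).integrableOn (integrable_const _) hb
        _ = _ := by simp [mul_comm]
    have h4 : ∫ y in F, f y ∂p + ∫ y in Fᶜ, f y ∂p = ∫ y, f y ∂p :=
      integral_add_compl hFm (hp.integrable hfc)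
    have h5 : σ * (1 - (R + 2) ^ 2 * p.real Fᶜ) ≤ ∫ y in F, f y ∂p := by nlinarith
    have h6 : σ * (Real.exp (-δ) * (1 - (R + 2) ^ 2 * p.real Fᶜ)) ≤ matNorm (covMat q) u ^ 2 := by
      refine le_trans ?_ h1
      calc _ = Real.exp (-δ) * (σ * (1 - (R + 2) ^ 2 * p.real Fᶜ)) := by ring
        _ ≤ _ := by gcongr
    calc σ = σ * 1 := (mul_one _).symm
      _ ≤ σ * (κ ^ 2 * (Real.exp (-δ) * (1 - (R + 2) ^ 2 * p.real Fᶜ))) := by gcongr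
      _ = κ ^ 2 * (σ * (Real.exp (-δ) * (1 - (R + 2) ^ 2 * p.real Fᶜ))) := by ring
      _ ≤ _ := by gcongr
  refine matNorm_le_of_forall_inner_sq_le hq.posDef
    (mul_nonneg hκ (matNorm_nonneg _ _)) fun u => ?_
  refine (inner_sq_le_matNorm hC u v).trans ?_
  rw [mul_pow]
  calc _ ≤ κ ^ 2 * matNorm (covMat q) u ^ 2 * matNorm (covMat p)⁻¹ v ^ 2 := by
        gcongr; exact hcov u
    _ = _ := by ring

/-- A small ellipsoid is in the interior of a convex set that carries the measure. -/
theorem ellipsoid_subset_interior (hp : Regular p) (hK : Convex ℝ K) (hKi : (interior K).Nonempty)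
    (hpK : ∀ᵐ y ∂p, y ∈ K) {r R : ℝ} (hR : 0 ≤ R)
    (hsupp : ∀ᵐ y ∂p, y ∈ ellipsoid p R) (hrR : 2 * R * r < 1) :
    ellipsoid p r ⊆ interior K := by
  intro x hx
  by_contra hxK
  have := hp.prob
  have hC := hp.posDef
  obtain ⟨f, hf⟩ := geometric_hahn_banach_open_point hK.interior isOpen_interior hxK
  obtain ⟨u, hu⟩ : ∃ u : Pt n, ∀ z, f z = ⟪u, z⟫_ℝ :=
    ⟨(InnerProductSpace.toDual ℝ (Pt n)).symm f, fun z => by simp⟩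
  have hu0 : u ≠ 0 := by
    rintro rfl
    obtain ⟨z, hz⟩ := hKi
    have := hf z hz
    simp [hu] at this
  have hfK : ∀ z ∈ K, f z ≤ f x := by
    intro z hz
    have hz' : z ∈ closure (interior K) := by
      rw [hK.closure_interior_eq_closure_of_nonempty_interior hKi]; exact subset_closure hz
    have hcl : IsClosed {z | f z ≤ f x} := isClosed_le f.continuous continuous_const
    exact closure_minimal (fun z hz => (hf z hz).le) hcl hz'
  set σ := matNorm (covMat p) u
  have hσ2 : σ ^ 2 = ∫ y, ⟪u, y - meanOf p⟫_ℝ ^ 2 ∂p := hp.matNorm_covMat_sq u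
  have hσ : 0 < σ := by
    have := hp.integral_inner_sq_pos hu0
    rw [← hσ2] at this
    exact lt_of_le_of_ne (matNorm_nonneg _ _) fun h => by rw [← h] at this; simp at this
  set Z : Pt n → ℝ := fun y => ⟪u, y - meanOf p⟫_ℝ
  have hZc : Continuous Z := by fun_prop
  have hx' : matNorm (covMat p)⁻¹ (x - meanOf p) ≤ r := hx
  have hr : 0 ≤ r := (matNorm_nonneg _ _).trans hx'
  have hZle : ∀ᵐ y ∂p, Z y ≤ σ * r := by
    filter_upwards [hpK] with y hy
    have h1 := hfK y hy
    rw [hu, hu] at h1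
    calc Z y ≤ ⟪u, x - meanOf p⟫_ℝ := by simp only [Z, inner_sub_right]; linarith
      _ ≤ σ * matNorm (covMat p)⁻¹ (x - meanOf p) := inner_le_matNorm_mul hC _ _
      _ ≤ _ := by gcongr
  -- `Z` is centred and at most `σ r`, so `|Z| ≤ 2 σ r - Z`, whose mean is `2 σ r`. With `|Z| ≤ σ R`
  -- the variance `σ²` would be at most `2 R r σ²`, which is less than `σ²`.
  have hZsq : ∀ᵐ y ∂p, Z y ^ 2 ≤ R * σ * (2 * (σ * r) - Z y) := by
    filter_upwards [hZle, hsupp] with y hy hyR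
    have h1 : Z y ^ 2 ≤ σ ^ 2 * R ^ 2 := by
      refine (inner_sq_le_matNorm hC u _).trans ?_
      gcongr
      · exact matNorm_nonneg _ _
      · exact hyR
    have h2 : |Z y| ≤ σ * R := abs_le_of_sq_le_sq (by rw [mul_pow]; exact h1) (by positivity)
    have h3 : |Z y| ≤ 2 * (σ * r) - Z y := by
      rcases abs_cases (Z y) with ⟨h, _⟩ | ⟨h, _⟩ <;> rw [h]
      · linarith
      · have : 0 ≤ σ * r := by positivity
        linarith
    calc Z y ^ 2 = |Z y| * |Z y| := by rw [← sq, sq_abs]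
      _ ≤ (σ * R) * (2 * (σ * r) - Z y) := by gcongr
      _ = _ := by ring
  have h1 : ∫ y, Z y ^ 2 ∂p ≤ ∫ y, R * σ * (2 * (σ * r) - Z y) ∂p :=
    integral_mono_ae (hp.integrable (by fun_prop)) (hp.integrable (by fun_prop)) hZsq
  rw [← hσ2, integral_const_mul, integral_sub (integrable_const _) (hp.integrable hZc),
    hp.integral_inner_sub_meanOf] at h1
  simp only [integral_const, probReal_univ, one_smul, sub_zero] at h1
  have : σ ^ 2 * (2 * R * r) < σ ^ 2 * 1 := by gcongr
  nlinarith

theorem Regular.meanOf_mem (hp : Regular p) (hF : Convex ℝ F) (hFc : IsClosed F)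
    (hpF : ∀ᵐ y ∂p, y ∈ F) : meanOf p ∈ F := by
  have := hp.prob
  exact hF.integral_mem hFc hpF (hp.integrable continuous_id)

/-- A convex set inside one ellipsoid has most of its volume in the ellipsoid of the same radius
of a measure with comparable mean and covariance. -/
theorem half_volume_lt_of_comparable (hn : 1 ≤ n) (hC : (covMat p).PosDef)
    (hF : Convex ℝ F)
    (hFm : MeasurableSet F) (hF0 : volume F ≠ 0) (hFt : volume F ≠ ∞) {α κ : ℝ}
    (hμ : meanOf p ∈ F) (hFα : F ⊆ ellipsoid p α) (hκ : 0 ≤ κ)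
    (hmean : matNorm (covMat p)⁻¹ (meanOf q - meanOf p) ≤ 2)
    (hcov : ∀ v, matNorm (covMat q)⁻¹ v ≤ κ * matNorm (covMat p)⁻¹ v)
    (hκα : κ * ((1 - 1 / (4 * n)) * α + 2) ≤ α) :
    ¬ volume (F ∩ ellipsoid q α) ≤ 2⁻¹ * volume F := by
  have hn' : (1 : ℝ) ≤ n := by exact_mod_cast hn
  set s : ℝ := 1 / (4 * n)
  have hs0 : 0 < s := by positivity
  have hs1 : s ≤ 1 / 4 := by
    simp only [s]; rw [div_le_div_iff₀ (by positivity) (by norm_num)]; linarith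
  -- Contracting `F` by `1 - 1/(4n)` about the mean of `p` keeps at least `3/4` of the volume. The
  -- radius gained pays for the shift of the mean and for the factor `κ`.
  have hsub : (fun x => (1 - s) • x + s • meanOf p) '' F ⊆ F ∩ ellipsoid q α := by
    rintro _ ⟨x, hx, rfl⟩
    refine ⟨hF hx hμ (by linarith) hs0.le (by ring), ?_⟩
    have h1 : matNorm (covMat p)⁻¹ (x - meanOf p) ≤ α := hFα hx
    change matNorm (covMat q)⁻¹ _ ≤ α
    refine (hcov _).trans (le_trans ?_ hκα)
    gcongr
    have e : (1 - s) • x + s • meanOf p - meanOf q =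
        (1 - s) • (x - meanOf p) - (meanOf q - meanOf p) := by module
    simp only [e]
    refine (matNorm_sub_le hC _ _).trans ?_
    rw [matNorm_smul, abs_of_nonneg (by linarith)]
    have : (1 - s) * matNorm (covMat p)⁻¹ (x - meanOf p) ≤ (1 - s) * α :=
      mul_le_mul_of_nonneg_left h1 (by linarith)
    linarith
  have hv := measure_mono (μ := volume) hsub
  rw [volume_image_smul_add (by linarith) _ hFm] at hv
  intro hle
  have h1 := hv.trans hle
  rw [ENNReal.mul_le_mul_iff_left hF0 hFt] at h1
  have h2 : (3 / 4 : ℝ) ≤ (1 - s) ^ n := by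
    refine le_trans ?_ (one_sub_mul_le_pow n (by linarith))
    have : n * s = 1 / 4 := by simp only [s]; field_simp
    linarith
  have h3 : ENNReal.ofReal (3 / 4) ≤ 2⁻¹ := (ENNReal.ofReal_le_ofReal h2).trans h1
  rw [show (2⁻¹ : ℝ≥0∞) = ENNReal.ofReal (1 / 2) by
    rw [one_div, ENNReal.ofReal_inv_of_pos (by norm_num)]; simp] at h3
  rw [ENNReal.ofReal_le_ofReal_iff (by norm_num)] at h3
  norm_num at h3

end CovarianceComparison

end KernelBCO

namespace KernelBCO

/-! ### The convex extension of a loss -/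

section Extension

open scoped InnerProductSpace

variable {n : ℕ} {K : Set (Pt n)} {f : Pt n → ℝ} {L : ℝ≥0}

/-- A bounded convex Lipschitz loss on a convex body. -/
structure IsLoss (K : Set (Pt n)) (L : ℝ≥0) (f : Pt n → ℝ) : Prop where
  convex : ConvexOn ℝ K f
  maps : MapsTo f K (Icc 0 1)
  lip : LipschitzOnWith L f K

/-- The affine minorants that touch `f` in the interior of `K`. -/
abbrev Tangent (K : Set (Pt n)) (f : Pt n → ℝ) :=
  {h : Pt n →ᵃ[ℝ] ℝ // (∀ z ∈ K, h z ≤ f z) ∧ ∃ z ∈ interior K, h z = f z}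

/-- At the interior touching point a small step in any direction stays in `K`, where the affine
function is below `f` and `f` grows at most at rate `L`. Hence its slope is at most `L`, globally.
-/
theorem IsLoss.tangent_le_add (hf : IsLoss K L f) (h : Tangent K f) (y y' : Pt n) :
    h.1 y ≤ h.1 y' + L * ‖y - y'‖ := by
  obtain ⟨h, hK, z, hz, hzf⟩ := h
  have hzK := interior_subset hz
  have e : h y = h y' + h.linear (y - y') := by
    have := h.linearMap_vsub y y'
    simp only [vsub_eq_sub] at this
    rw [this]; ring
  rw [e]
  gcongr
  set d := y - y'
  have hcont : Filter.Tendsto (fun t : ℝ => z + t • d) (nhdsWithin 0 (Ioi 0)) (nhds z) := by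
    have : Continuous fun t : ℝ => z + t • d := by fun_prop
    have := this.tendsto 0
    simp only [zero_smul, add_zero] at this
    exact this.mono_left nhdsWithin_le_nhds
  have hev := (hcont.eventually (isOpen_interior.mem_nhds hz)).and self_mem_nhdsWithin
  obtain ⟨t, ht, ht0⟩ := hev.exists
  have ht0' : 0 < t := ht0
  have h1 := hK _ (interior_subset ht)
  have h2 : h (z + t • d) = h z + t * h.linear d := by
    have := h.map_vadd z (t • d)
    simp only [vadd_eq_add, map_smul, smul_eq_mul] at this
    rw [add_comm z, this, add_comm]
  have h3 := hf.lip.dist_le_mul _ (interior_subset ht) _ hzK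
  rw [Real.dist_eq, dist_eq_norm, add_sub_cancel_left, norm_smul, Real.norm_of_nonneg ht0'.le] at h3
  have h4 := (abs_le.1 h3).2
  have : t * h.linear d ≤ t * (L * ‖d‖) := by rw [h2, hzf] at h1; linarith
  exact le_of_mul_le_mul_left this ht0'

/-- The point `(z, f z)` is separated from the open strict epigraph of `f` over the interior; the
vertical coefficient is negative since the epigraph is unbounded above. The inequality extends from
the interior to `K` because `f` is continuous on `K` and the interior is dense in it. -/
theorem IsLoss.exists_tangent (hf : IsLoss K L f) {z : Pt n} (hz : z ∈ interior K) :
    ∃ h : Tangent K f, h.1 z = f z := by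
  have hc := hf.convex
  have hKi := hc.1.interior
  have hcont : ContinuousOn f (interior K) := hf.lip.continuousOn.mono interior_subset
  set E : Set (Pt n × ℝ) := {w | w.1 ∈ interior K ∧ f w.1 < w.2}
  have hEconv : Convex ℝ E := (hc.subset interior_subset hKi).convex_strict_epigraph
  have hEopen : IsOpen E := by
    rw [isOpen_iff_mem_nhds]
    rintro ⟨x, t⟩ ⟨hx, ht⟩
    have h1 : ContinuousAt (fun w : Pt n × ℝ => f w.1) (x, t) :=
      (hcont.continuousAt (isOpen_interior.mem_nhds hx)).comp_of_eq continuousAt_fst rfl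
    have h2 := h1.eventually_lt (continuousAt_snd : ContinuousAt Prod.snd (x, t)) ht
    have h3 : ∀ᶠ w : Pt n × ℝ in nhds (x, t), w.1 ∈ interior K :=
      continuousAt_fst.eventually (isOpen_interior.mem_nhds hx)
    filter_upwards [h2, h3] with w hw hw'
    exact ⟨hw', hw⟩
  obtain ⟨φ, hφ⟩ := geometric_hahn_banach_open_point (x := (z, f z)) hEconv hEopen
    fun h => lt_irrefl _ h.2
  set A : Pt n →ₗ[ℝ] ℝ := (φ : Pt n × ℝ →ₗ[ℝ] ℝ).comp (LinearMap.inl ℝ (Pt n) ℝ)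
  set c := φ (0, 1)
  have hdec : ∀ x t, φ (x, t) = A x + c * t := by
    intro x t
    have : ((x, t) : Pt n × ℝ) = (x, 0) + t • ((0 : Pt n), (1 : ℝ)) := by simp
    rw [this, map_add, map_smul, smul_eq_mul, mul_comm]; rfl
  have hcneg : c < 0 := by
    have := hφ (z, f z + 1) ⟨hz, by simp⟩
    rw [hdec, hdec] at this; linarith
  have hint : ∀ x ∈ interior K, A x + c * f x ≤ A z + c * f z := by
    intro x hx
    refine le_of_forall_pos_lt_add fun ε hε => ?_
    have := hφ (x, f x + ε / (-c)) ⟨hx, by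
      have : 0 < ε / (-c) := div_pos hε (by linarith)
      linarith⟩
    rw [hdec, hdec] at this
    have e : c * (f x + ε / -c) = c * f x - ε := by
      rw [mul_add, div_neg, mul_neg, mul_div_cancel₀ _ hcneg.ne]; ring
    linarith
  have hAc : Continuous A := A.continuous_of_finiteDimensional
  have hall : ∀ x ∈ K, A x + c * f x ≤ A z + c * f z := by
    intro x hx
    have hxc : x ∈ closure (interior K) := by
      rw [hc.1.closure_interior_eq_closure_of_nonempty_interior ⟨z, hz⟩]; exact subset_closure hx
    have hne : (nhdsWithin x (interior K)).NeBot := mem_closure_iff_nhdsWithin_neBot.1 hxc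
    have ht : Filter.Tendsto (fun x => A x + c * f x) (nhdsWithin x (interior K))
        (nhds (A x + c * f x)) := by
      have h1 : ContinuousWithinAt f (interior K) x :=
        (hf.lip.continuousOn x hx).mono interior_subset
      exact (hAc.continuousWithinAt.add (h1.const_mul c))
    exact le_of_tendsto ht (Filter.eventually_of_mem self_mem_nhdsWithin fun w hw => hint w hw)
  refine ⟨⟨((-c)⁻¹ • A).toAffineMap + AffineMap.const ℝ _ (f z - (-c)⁻¹ * A z), ?_, z, hz, ?_⟩, ?_⟩
  · intro x hx
    have h1 := hall x hx
    have hc' : 0 < -c := by linarith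
    have h2 : (-c)⁻¹ * (A x - A z) ≤ f x - f z := by
      rw [inv_mul_le_iff₀ hc']; linarith
    simp only [AffineMap.coe_add, Pi.add_apply, LinearMap.coe_toAffineMap, LinearMap.smul_apply,
      smul_eq_mul, AffineMap.const_apply]
    linarith
  · simp
  · simp

theorem IsLoss.tangent_le_one_add (hf : IsLoss K L f) (h : Tangent K f) {z : Pt n} (hz : z ∈ K)
    (y : Pt n) : h.1 y ≤ 1 + L * ‖y - z‖ :=
  (hf.tangent_le_add h y z).trans (by
    have := h.2.1 z hz
    have := (hf.maps hz).2
    gcongr; linarith)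

theorem IsLoss.bddAbove_tangent (hf : IsLoss K L f) (hKi : (interior K).Nonempty) (y : Pt n) :
    BddAbove (range fun h : Tangent K f => h.1 y) := by
  obtain ⟨z, hz⟩ := hKi
  exact ⟨_, by rintro _ ⟨h, rfl⟩; exact hf.tangent_le_one_add h (interior_subset hz) y⟩

theorem IsLoss.bddBelow_image (hf : IsLoss K L f) : BddBelow (f '' K) :=
  ⟨0, by rintro _ ⟨z, hz, rfl⟩; exact (hf.maps hz).1⟩

theorem IsLoss.convexExtension_eq (hf : IsLoss K L f) {y : Pt n} (hy : y ∈ interior K) :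
    convexExtension K f y = f y := by
  have hyK := interior_subset hy
  obtain ⟨h, hh⟩ := hf.exists_tangent hy
  have : Nonempty (Tangent K f) := ⟨h⟩
  have h1 : (⨆ h : Tangent K f, h.1 y) = f y :=
    le_antisymm (ciSup_le fun h => h.2.1 y hyK)
      (hh ▸ le_ciSup (hf.bddAbove_tangent ⟨y, hy⟩ y) h)
  unfold convexExtension
  rw [h1]
  exact max_eq_left (csInf_le hf.bddBelow_image ⟨y, hyK, rfl⟩)

theorem IsLoss.convexExtension_nonneg (hf : IsLoss K L f) (y : Pt n) :
    0 ≤ convexExtension K f y :=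
  le_max_of_le_right (Real.sInf_nonneg (by rintro _ ⟨z, hz, rfl⟩; exact (hf.maps hz).1))

theorem IsLoss.convexExtension_le (hf : IsLoss K L f) (hKi : (interior K).Nonempty) {z : Pt n}
    (hz : z ∈ K) (y : Pt n) : convexExtension K f y ≤ 1 + L * ‖y - z‖ := by
  obtain ⟨h, -⟩ := hf.exists_tangent hKi.choose_spec
  have : Nonempty (Tangent K f) := ⟨h⟩
  refine max_le (ciSup_le fun h => hf.tangent_le_one_add h hz y) ?_
  have h1 : sInf (f '' K) ≤ f z := csInf_le hf.bddBelow_image ⟨z, hz, rfl⟩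
  have h2 := (hf.maps hz).2
  have : 0 ≤ L * ‖y - z‖ := by positivity
  linarith

theorem IsLoss.lipschitz_convexExtension (hf : IsLoss K L f) (hKi : (interior K).Nonempty) :
    LipschitzWith L (convexExtension K f) := by
  obtain ⟨h, -⟩ := hf.exists_tangent hKi.choose_spec
  have : Nonempty (Tangent K f) := ⟨h⟩
  refine LipschitzWith.of_le_add_mul L fun y y' => ?_
  rw [dist_eq_norm]
  have h0 : 0 ≤ L * ‖y - y'‖ := by positivity
  refine max_le (ciSup_le fun h => ?_) ?_
  · refine (hf.tangent_le_add h y y').trans ?_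
    gcongr
    exact le_max_of_le_left (le_ciSup (hf.bddAbove_tangent hKi y') h)
  · have : sInf (f '' K) ≤ convexExtension K f y' := le_max_right _ _
    linarith

theorem IsLoss.convexOn_convexExtension (hf : IsLoss K L f) (hKi : (interior K).Nonempty) :
    ConvexOn ℝ univ (convexExtension K f) := by
  obtain ⟨h, -⟩ := hf.exists_tangent hKi.choose_spec
  have : Nonempty (Tangent K f) := ⟨h⟩
  refine ConvexOn.sup (f := fun y => ⨆ h : Tangent K f, h.1 y) (g := fun _ => sInf (f '' K)) ?_
    (convexOn_const _ convex_univ)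
  refine ⟨convex_univ, fun x _ y _ a b ha hb hab => ciSup_le fun h => ?_⟩
  rw [Convex.combo_affine_apply hab]
  simp only [smul_eq_mul]
  gcongr
  · exact le_ciSup (hf.bddAbove_tangent hKi x) h
  · exact le_ciSup (hf.bddAbove_tangent hKi y) h

end Extension

/-! ### The adjoint kernel applied to losses, and the sampling law -/

section Adjoint

open scoped InnerProductSpace

variable {n : ℕ} {K : Set (Pt n)} {f : Pt n → ℝ} {L : ℝ≥0} {P : Params} {p : Measure (Pt n)}

/-- Support in a ball of radius `D` about the mean gives `Cov ≤ D²`, hence by duality `Cov⁻¹ ≥ D⁻²`.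
-/
theorem norm_le_mul_matNorm (hp : Regular p) {D : ℝ} (hD0 : 0 ≤ D)
    (hD : ∀ᵐ y ∂p, ‖y - meanOf p‖ ≤ D) (v : Pt n) : ‖v‖ ≤ D * matNorm (covMat p)⁻¹ v := by
  have := hp.prob
  have h1 : matNorm (covMat p) v ≤ D * ‖v‖ := by
    refine abs_le_of_sq_le_sq' ?_ (by positivity) |>.2
    rw [hp.matNorm_covMat_sq]
    calc _ ≤ ∫ y, (D * ‖v‖) ^ 2 ∂p := by
          refine integral_mono_ae (hp.integrable (by fun_prop)) (integrable_const _) ?_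
          filter_upwards [hD] with y hy
          rw [← sq_abs]
          gcongr
          refine (abs_real_inner_le_norm _ _).trans ?_
          rw [mul_comm]; gcongr
      _ = _ := by simp
  have h2 := inner_le_matNorm_mul hp.posDef v v
  rw [real_inner_self_eq_norm_sq] at h2
  rcases (norm_nonneg v).eq_or_lt with h0 | h0
  · rw [← h0]; exact mul_nonneg hD0 (matNorm_nonneg _ _)
  · have h3 : ‖v‖ * ‖v‖ ≤ ‖v‖ * (D * matNorm (covMat p)⁻¹ v) := by
      calc _ = ‖v‖ ^ 2 := (sq _).symm
        _ ≤ _ := h2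
        _ ≤ D * ‖v‖ * matNorm (covMat p)⁻¹ v := by gcongr; exact matNorm_nonneg _ _
        _ = _ := by ring
    exact le_of_mul_le_mul_left h3 h0

/-- A measure carried by a convex body of diameter at most `D`. -/
structure CarriedBy (K : Set (Pt n)) (D : ℝ) (p : Measure (Pt n)) : Prop extends Regular p where
  convexBody : Convex ℝ K
  closed : IsClosed K
  nonempty_interior : (interior K).Nonempty
  diam : ∀ x ∈ K, ∀ y ∈ K, ‖x - y‖ ≤ D
  nonneg : 0 ≤ D
  ae_mem : ∀ᵐ y ∂p, y ∈ K

theorem CarriedBy.meanOf_mem {D : ℝ} (h : CarriedBy K D p) : meanOf p ∈ K :=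
  h.toRegular.meanOf_mem h.convexBody h.closed h.ae_mem

theorem CarriedBy.norm_le {D : ℝ} (h : CarriedBy K D p) (v : Pt n) :
    ‖v‖ ≤ D * matNorm (covMat p)⁻¹ v :=
  norm_le_mul_matNorm h.toRegular h.nonneg
    (h.ae_mem.mono fun y hy => h.diam y hy _ h.meanOf_mem) v

theorem CarriedBy.center_mem {D : ℝ} (h : CarriedBy K D p) (hP : Proper P n) {y : Pt n}
    (hy : y ∈ K) : meanOf p + P.lam • (y - meanOf p) ∈ K := by
  have := h.convexBody h.meanOf_mem hy (by linarith [hP.lam_lt] : 0 ≤ 1 - P.lam) hP.lam_pos.le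
    (by ring)
  convert this using 1; module

/-- The centre of the kernel at `y` is a convex combination of the mean and `y`, so it lies in `K`,
where the loss is at most 1. The extension grows linearly away from it, which is the form required
for the Gaussian tail bound. -/
theorem CarriedBy.abs_convexExtension_le {D : ℝ} (h : CarriedBy K D p) (hP : Proper P n)
    (hf : IsLoss K L f) {y : Pt n} (hy : y ∈ K) (x : Pt n) :
    |convexExtension K f x| ≤ 1 + L * D * matNorm (covMat p)⁻¹ (disp P p x y) := by
  rw [abs_of_nonneg (hf.convexExtension_nonneg x)]
  refine (hf.convexExtension_le h.nonempty_interior (h.center_mem hP hy) x).trans ?_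
  rw [← disp_eq_sub, mul_assoc]
  gcongr
  exact h.norm_le _

theorem CarriedBy.integrable_convexExtension_mul {D : ℝ} (h : CarriedBy K D p) (hP : Proper P n)
    (hf : IsLoss K L f) {y : Pt n} (hy : y ∈ K) :
    Integrable fun x => convexExtension K f x * kernel P p x y := by
  have hD := h.nonneg
  have := (integral_tail_kernel_le hP h.posDef y (f := convexExtension K f) (S := univ) (A := 1)
    (D := L * D) (ρ := 0) zero_le_one (by positivity) le_rfl
    (hf.lipschitz_convexExtension h.nonempty_interior).continuous.aestronglyMeasurable .univ
    (fun x _ => h.abs_convexExtension_le hP hf hy x) (fun x _ => matNorm_nonneg _ _)).1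
  simpa [IntegrableOn] using this

theorem IsLoss.kernelAdjoint_nonneg (hP : Proper P n) (hf : IsLoss K L f) (y : Pt n) :
    0 ≤ kernelAdjoint P p (convexExtension K f) y :=
  integral_nonneg fun x => mul_nonneg (hf.convexExtension_nonneg x) (kernel_nonneg hP x y)

/-- Crude, since only polynomial growth in `T` matters. The integral is split at displacement 1; the
tail bound controls the far part and the growth bound the near part. -/
theorem CarriedBy.kernelAdjoint_le {D : ℝ} (h : CarriedBy K D p) (hP : Proper P n)
    (hf : IsLoss K L f) {y : Pt n} (hy : y ∈ K) (hb : 1 ≤ sharpness P n)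
    (hbn : Real.exp (-(sharpness P n / 4)) * √(2 ^ n) ≤ 1) :
    kernelAdjoint P p (convexExtension K f) y ≤ 2 + 2 * (L * D) := by
  have hD := h.nonneg
  set N : Pt n → ℝ := fun x => matNorm (covMat p)⁻¹ (disp P p x y)
  have hN : Continuous N := (continuous_matNorm _).comp (by unfold disp; fun_prop)
  set B : Set (Pt n) := {x | 1 ≤ N x}
  have hB : MeasurableSet B := (isClosed_le continuous_const hN).measurableSet
  have hi := h.integrable_convexExtension_mul hP hf hy
  rw [kernelAdjoint, ← integral_add_compl hB hi]
  have h1 : ∫ x in B, convexExtension K f x * kernel P p x y ≤ 1 + L * D := by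
    have := (integral_tail_kernel_le hP h.posDef y (f := convexExtension K f) (S := B) (A := 1)
      (D := L * D) (ρ := 1) zero_le_one (by positivity) zero_le_one
      (hf.lipschitz_convexExtension h.nonempty_interior).continuous.aestronglyMeasurable hB
      (fun x _ => h.abs_convexExtension_le hP hf hy x) (fun x hx => hx)).2
    simp only [abs_of_nonneg (hf.convexExtension_nonneg _)] at this
    refine this.trans ?_
    rw [one_pow, mul_one, neg_div', mul_assoc]
    have hs : 1 ≤ √(sharpness P n) := Real.one_le_sqrt.2 hb
    have h2 : L * D / √(sharpness P n) ≤ L * D := div_le_self (by positivity) hs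
    have h3 : 0 ≤ L * D / √(sharpness P n) := by positivity
    calc _ ≤ (1 + L * D / √(sharpness P n)) * 1 := by
          gcongr
          rwa [neg_div]
      _ ≤ _ := by linarith
  have h2 : ∫ x in Bᶜ, convexExtension K f x * kernel P p x y ≤ 1 + L * D := by
    calc _ ≤ ∫ x in Bᶜ, (1 + L * D) * kernel P p x y := by
          refine setIntegral_mono_on hi.integrableOn
            ((integrable_kernel hP h.posDef y).const_mul _).integrableOn hB.compl fun x hx => ?_
          have hx' : N x < 1 := not_le.1 hx
          refine mul_le_mul_of_nonneg_right ?_ (kernel_nonneg hP x y)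
          refine (le_abs_self _).trans ((h.abs_convexExtension_le hP hf hy x).trans ?_)
          exact add_le_add_right (mul_le_of_le_one_right (by positivity) hx'.le) _
      _ ≤ ∫ x, (1 + L * D) * kernel P p x y :=
          setIntegral_le_integral ((integrable_kernel hP h.posDef y).const_mul _)
            (Filter.Eventually.of_forall fun x =>
              mul_nonneg (by positivity) (kernel_nonneg hP x y))
      _ = _ := by rw [integral_const_mul, integral_kernel hP h.posDef, mul_one]
  linarith

/-- The kernel at `y` is a fixed Gaussian translated by a centre that is affine in `y`, so the
adjoint averages convex functions of `y`. -/
theorem CarriedBy.convexOn_kernelAdjoint {D : ℝ} (h : CarriedBy K D p) (hP : Proper P n)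
    (hf : IsLoss K L f) :
    ConvexOn ℝ K (kernelAdjoint P p (convexExtension K f)) := by
  refine ⟨h.convexBody, fun x hx y hy a b ha hb hab => ?_⟩
  set c : Pt n → Pt n := fun y => meanOf p + P.lam • (y - meanOf p)
  set k : Pt n → ℝ := fun z =>
    kernelScale P p * Real.exp (-(sharpness P n * matNorm (covMat p)⁻¹ z ^ 2))
  have hk : ∀ z y, kernel P p (z + c y) y = k z := by
    intro z y
    rw [kernel_eq hP, disp_eq_sub, add_sub_cancel_right]
  have hk0 : ∀ z, 0 ≤ k z := fun z => hk z x ▸ kernel_nonneg hP _ _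
  have hadj : ∀ y, kernelAdjoint P p (convexExtension K f) y =
      ∫ z, convexExtension K f (z + c y) * k z := by
    intro y
    rw [kernelAdjoint, ← integral_add_right_eq_self _ (c y)]
    simp only [hk]
  have hint : ∀ y ∈ K, Integrable fun z => convexExtension K f (z + c y) * k z := by
    intro y hy
    have := (h.integrable_convexExtension_mul hP hf hy).comp_add_right (c y)
    simpa only [hk] using this
  have hxy := h.convexBody hx hy ha hb hab
  rw [hadj, hadj, hadj, smul_eq_mul, smul_eq_mul, ← integral_const_mul, ← integral_const_mul,
    ← integral_add ((hint x hx).const_mul a) ((hint y hy).const_mul b)]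
  refine integral_mono (hint _ hxy) (((hint x hx).const_mul a).add ((hint y hy).const_mul b))
    fun z => ?_
  have e : z + c (a • x + b • y) = a • (z + c x) + b • (z + c y) := by
    have h1 : z = a • z + b • z := by rw [← add_smul, hab, one_smul]
    have h2 : meanOf p = a • meanOf p + b • meanOf p := by rw [← add_smul, hab, one_smul]
    simp only [c]
    nth_rewrite 1 [h1]
    nth_rewrite 1 [h2]
    nth_rewrite 3 [h2]
    module
  have h1 := (hf.convexOn_convexExtension h.nonempty_interior).2 (mem_univ (z + c x))
    (mem_univ (z + c y)) ha hb hab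
  simp only [smul_eq_mul] at h1
  simp only [e]
  calc _ ≤ (a * convexExtension K f (z + c x) + b * convexExtension K f (z + c y)) * k z :=
        mul_le_mul_of_nonneg_right h1 (hk0 z)
    _ = _ := by ring

/-- The bias of the loss estimate. -/
theorem CarriedBy.abs_kernelAdjoint_sub_le {D : ℝ} (h : CarriedBy K D p) (hP : Proper P n)
    (hf : IsLoss K L f) {r R : ℝ} (hr : P.lam * R ≤ r)
    (hE : ellipsoid p r ⊆ interior K)
    {y : Pt n} (hy : y ∈ K) (hyR : y ∈ ellipsoid p R) :
    |kernelAdjoint P p ((K ∩ ellipsoid p r).indicator f) y -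
      kernelAdjoint P p (convexExtension K f) y| ≤
      (1 + L * D / √(sharpness P n)) *
        Real.exp (-(sharpness P n * (r - P.lam * R) ^ 2 / 4)) * √(2 ^ n) := by
  have hD := h.nonneg
  set O := K ∩ ellipsoid p r
  have hO : MeasurableSet O := h.closed.measurableSet.inter (isClosed_ellipsoid p r).measurableSet
  have hi := h.integrable_convexExtension_mul hP hf hy
  -- On `O` the extension agrees with `f`, because the ellipsoid lies in the interior of `K`. The
  -- bias is therefore exactly the integral of the extension over the complement of `O`.
  have e1 : kernelAdjoint P p (O.indicator f) y = ∫ x in O, convexExtension K f x * kernel P p x y := by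
    rw [kernelAdjoint, ← integral_indicator hO]
    congr 1 with x
    by_cases hx : x ∈ O
    · simp only [indicator_of_mem hx, hf.convexExtension_eq (hE hx.2)]
    · simp [indicator_of_notMem hx]
  rw [e1, kernelAdjoint, ← integral_add_compl hO hi, sub_add_cancel_left, abs_neg]
  refine abs_integral_le_integral_abs.trans ?_
  simp only [abs_mul, abs_of_nonneg (kernel_nonneg (p := p) hP _ y)]
  refine (integral_tail_kernel_le hP h.posDef y (f := convexExtension K f) (S := Oᶜ) (A := 1)
    (D := L * D) zero_le_one (by positivity) (by linarith)
    (hf.lipschitz_convexExtension h.nonempty_interior).continuous.aestronglyMeasurable hO.compl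
    (fun x _ => h.abs_convexExtension_le hP hf hy x) (fun x hx => ?_)).2
  have hxr : r < matNorm (covMat p)⁻¹ (x - meanOf p) := by
    by_contra hle
    have hxE : x ∈ ellipsoid p r := not_lt.1 hle
    exact hx ⟨interior_subset (hE hxE), hxE⟩
  have h1 := matNorm_sub_le_matNorm_sub h.posDef (x - meanOf p) (P.lam • (y - meanOf p))
  rw [matNorm_smul, abs_of_pos hP.lam_pos] at h1
  have h2 : matNorm (covMat p)⁻¹ (y - meanOf p) ≤ R := hyR
  have h3 := mul_le_mul_of_nonneg_left h2 hP.lam_pos.le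
  change _ ≤ matNorm (covMat p)⁻¹ (disp P p x y)
  unfold disp
  linarith

/-- The sampling law rarely leaves a small ellipsoid. -/
theorem CarriedBy.kernelLaw_real_compl_le {D : ℝ} (h : CarriedBy K D p) (hP : Proper P n)
    {r R : ℝ} (hr : P.lam * R ≤ r)
    (hE : ellipsoid p r ⊆ interior K) :
    (kernelLaw P p p).real (K ∩ ellipsoid p r)ᶜ ≤ p.real (ellipsoid p R)ᶜ +
        Real.exp (-(sharpness P n * (r - P.lam * R) ^ 2 / 4)) * √(2 ^ n) := by
  have := h.prob
  have := isProbabilityMeasure_kernelLaw hP h.toRegular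
  set O := K ∩ ellipsoid p r
  set ε := Real.exp (-(sharpness P n * (r - P.lam * R) ^ 2 / 4)) * √(2 ^ n)
  have hε : 0 ≤ ε := by positivity
  have hO : MeasurableSet O := h.closed.measurableSet.inter (isClosed_ellipsoid p r).measurableSet
  have hER : MeasurableSet (ellipsoid p R) := (isClosed_ellipsoid p R).measurableSet
  have h1 := lintegral_kernelLaw hP h.toRegular (g := Oᶜ.indicator 1)
    (measurable_one.indicator hO.compl)
  rw [lintegral_indicator_one hO.compl] at h1
  -- For `y` in the large ellipsoid the centre of the kernel is within `lam R` of the mean, so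
  -- leaving the ellipsoid of radius `r` is a Gaussian tail event. For other `y` the trivial bound 1
  -- is used.
  have h2 : ∀ y, ∫⁻ x, Oᶜ.indicator 1 x * ENNReal.ofReal (kernel P p x y) ≤
      (ellipsoid p R)ᶜ.indicator 1 y + ENNReal.ofReal ε := by
    intro y
    by_cases hy : y ∈ ellipsoid p R
    · refine le_add_left ?_
      have e : ∀ x, Oᶜ.indicator (1 : Pt n → ℝ≥0∞) x * ENNReal.ofReal (kernel P p x y) =
          Oᶜ.indicator (fun x => ENNReal.ofReal (kernel P p x y)) x := by
        intro x
        by_cases hx : x ∈ Oᶜ <;> simp [hx]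
      simp only [e]
      rw [lintegral_indicator hO.compl, ← ofReal_integral_eq_lintegral_ofReal
        (integrable_kernel hP h.posDef y).integrableOn
        (Filter.Eventually.of_forall fun x => kernel_nonneg hP x y)]
      refine ENNReal.ofReal_le_ofReal ?_
      have := (integral_tail_kernel_le hP h.posDef y (f := fun _ => 1) (S := Oᶜ) (A := 1)
        (D := 0) (ρ := r - P.lam * R) zero_le_one le_rfl (by linarith)
        aestronglyMeasurable_const hO.compl
        (fun x _ => by simp) (fun x hx => ?_)).2
      · simpa using this
      · have hxr : r < matNorm (covMat p)⁻¹ (x - meanOf p) := by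
          by_contra hle
          have hxE : x ∈ ellipsoid p r := not_lt.1 hle
          exact hx ⟨interior_subset (hE hxE), hxE⟩
        have h1 := matNorm_sub_le_matNorm_sub h.posDef (x - meanOf p) (P.lam • (y - meanOf p))
        rw [matNorm_smul, abs_of_pos hP.lam_pos] at h1
        have h2 : matNorm (covMat p)⁻¹ (y - meanOf p) ≤ R := hy
        have h3 := mul_le_mul_of_nonneg_left h2 hP.lam_pos.le
        change _ ≤ matNorm (covMat p)⁻¹ (disp P p x y)
        unfold disp
        linarith
    · refine le_add_right ?_
      rw [indicator_of_mem (show y ∈ (ellipsoid p R)ᶜ from hy), Pi.one_apply,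
        ← lintegral_kernel hP h.posDef y]
      refine lintegral_mono fun x => mul_le_of_le_one_left (by positivity) ?_
      exact indicator_le_self' (fun _ _ => zero_le_one) x
  have h3 : kernelLaw P p p Oᶜ ≤ p (ellipsoid p R)ᶜ + ENNReal.ofReal ε := by
    rw [h1]
    refine (lintegral_mono h2).trans ?_
    rw [lintegral_add_right _ measurable_const, lintegral_indicator_one hER.compl]
    simp
  have h4 := ENNReal.toReal_mono (by simp) h3
  rwa [ENNReal.toReal_add (measure_ne_top _ _) (by simp), ENNReal.toReal_ofReal hε] at h4

end Adjoint

end KernelBCO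

namespace KernelBCO

/-! ### Exponential weights as Gibbs measures on the focus region -/

section Gibbs

variable {n : ℕ} {F K : Set (Pt n)} {S : Pt n → ℝ}

/-- The probability measure on `F` with density proportional to `exp(-S)`. -/
def gibbs (F : Set (Pt n)) (S : Pt n → ℝ) : Measure (Pt n) :=
  (∫⁻ y in F, ENNReal.ofReal (Real.exp (-S y)))⁻¹ •
    (volume.restrict F).withDensity fun y => ENNReal.ofReal (Real.exp (-S y))

theorem gibbs_apply {B : Set (Pt n)} (hB : MeasurableSet B) :
    gibbs F S B = (∫⁻ y in F, ENNReal.ofReal (Real.exp (-S y)))⁻¹ *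
      ∫⁻ y in B ∩ F, ENNReal.ofReal (Real.exp (-S y)) := by
  rw [gibbs, Measure.smul_apply, withDensity_apply _ hB, Measure.restrict_restrict hB, smul_eq_mul]

theorem lintegral_exp_neg_ne_zero (hF0 : volume F ≠ 0) (hS : Continuous S) :
    ∫⁻ y in F, ENNReal.ofReal (Real.exp (-S y)) ≠ 0 := by
  rw [Ne, lintegral_eq_zero_iff (by fun_prop)]
  intro h
  have h1 : ∀ᵐ y ∂(volume.restrict F), False := by
    filter_upwards [h] with y hy
    simp only [Pi.zero_apply, ENNReal.ofReal_eq_zero] at hy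
    exact absurd hy (not_le.2 (Real.exp_pos _))
  simp at h1
  exact hF0 h1

theorem lintegral_exp_neg_ne_top (hF : MeasurableSet F) (hFt : volume F ≠ ∞)
    (hS : ∀ y ∈ F, 0 ≤ S y) :
    ∫⁻ y in F, ENNReal.ofReal (Real.exp (-S y)) ≠ ∞ := by
  refine ne_top_of_le_ne_top hFt ?_
  calc _ ≤ ∫⁻ y in F, 1 := by
        refine setLIntegral_mono_ae' hF (Filter.Eventually.of_forall fun y hy => ?_)
        rw [ENNReal.ofReal_le_one]
        exact Real.exp_le_one_iff.2 (by linarith [hS y hy])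
    _ = volume F := by simp

theorem gibbs_ae_mem (hF : MeasurableSet F) : ∀ᵐ y ∂(gibbs F S), y ∈ F := by
  refine Measure.ae_smul_measure ?_ _
  exact (withDensity_absolutelyContinuous _ _).ae_le (ae_restrict_mem hF)

theorem regular_gibbs (hF : MeasurableSet F) (hF0 : volume F ≠ 0)
    (hFb : Bornology.IsBounded F) (hSc : Continuous S) (hS : ∀ y ∈ F, 0 ≤ S y) :
    Regular (gibbs F S) := by
  have hFt : volume F ≠ ∞ := hFb.measure_lt_top.ne
  refine ⟨⟨?_⟩, ?_, ?_⟩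
  · rw [gibbs_apply .univ, univ_inter]
    exact ENNReal.inv_mul_cancel (lintegral_exp_neg_ne_zero hF0 hSc)
      (lintegral_exp_neg_ne_top hF hFt hS)
  · refine Measure.AbsolutelyContinuous.smul_left ?_ _
    exact (withDensity_absolutelyContinuous _ _).trans Measure.absolutelyContinuous_restrict
  · obtain ⟨R, hR⟩ := hFb.exists_norm_le
    exact ⟨R, (gibbs_ae_mem hF).mono hR⟩

theorem expWeights_eq_gibbs {S' : Pt n → ℝ≥0∞} (hK : MeasurableSet K) (hF : MeasurableSet F)
    (hFK : F ⊆ K)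
    (hin : ∀ y ∈ F, S' y = ENNReal.ofReal (S y)) (hS : ∀ y ∈ F, 0 ≤ S y)
    (hout : ∀ y ∈ K, y ∉ F → S' y = ∞) : expWeights K S' = gibbs F S := by
  have h1 : (volume.restrict K).withDensity (fun y => EReal.exp (-(S' y : EReal))) =
      (volume.restrict F).withDensity fun y => ENNReal.ofReal (Real.exp (-S y)) := by
    have e : ∀ y ∈ K, EReal.exp (-(S' y : EReal)) =
        F.indicator (fun y => ENNReal.ofReal (Real.exp (-S y))) y := by
      intro y hy
      by_cases hyF : y ∈ F
      · rw [indicator_of_mem hyF, hin y hyF, EReal.coe_ennreal_ofReal, max_eq_left (hS y hyF),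
          ← EReal.coe_neg, EReal.exp_coe]
      · rw [indicator_of_notMem hyF, hout y hy hyF]
        simp
    rw [withDensity_congr_ae (ae_restrict_of_forall_mem hK e), withDensity_indicator hF,
      Measure.restrict_restrict hF, inter_eq_left.2 hFK]
  unfold expWeights gibbs
  simp only [h1]
  rw [withDensity_apply _ .univ, Measure.restrict_univ]

end Gibbs

/-! ### The algorithm on a single path: regions, rates and bounded estimates -/

section Path

variable {n : ℕ} {P : Params} {K : Set (Pt n)} {ℓ : ℕ → Pt n → ℝ} {x : ℕ → Pt n}

/-- The value of the loss estimate at the points of the focus region. -/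
def psi (P : Params) (K : Set (Pt n)) (p : Measure (Pt n)) (x : Pt n) (v : ℝ) (y : Pt n) : ℝ :=
  max (v * (typical P K p).indicator (fun _ => (1 : ℝ)) x / kernelDensity P p p x *
    kernel P p x y) 0

theorem psi_nonneg (p : Measure (Pt n)) (z : Pt n) (v : ℝ) (y : Pt n) : 0 ≤ psi P K p z v y :=
  le_max_right _ _

theorem continuous_psi (hP : Proper P n) (p : Measure (Pt n)) (z : Pt n) (v : ℝ) :
    Continuous (psi P K p z v) := by
  have := continuous_kernel_right (p := p) hP z
  unfold psi; fun_prop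

theorem lossEstimate_of_mem {F : Set (Pt n)} {p : Measure (Pt n)} {z y : Pt n} {v : ℝ}
    (hy : y ∈ F) : lossEstimate P K F p z v y = ENNReal.ofReal (psi P K p z v y) := by
  rw [lossEstimate, if_pos hy, psi]
  rcases le_total 0 (v * (typical P K p).indicator (fun _ => (1 : ℝ)) z / kernelDensity P p p z *
    kernel P p z y) with h | h
  · rw [max_eq_left h]
  · rw [max_eq_right h, ENNReal.ofReal_zero, ENNReal.ofReal_of_nonpos h]

variable (P K ℓ x)

/-- The loss estimate of round `t` on the focus region. -/
abbrev psiAt (t : ℕ) : Pt n → ℝ := psi P K (weights P K ℓ x t) (x t) (ℓ t (x t))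

/-- The exponent of the weights of round `t + 1`. -/
def energy (t : ℕ) (y : Pt n) : ℝ :=
  ∑ s ∈ Finset.Icc 1 t, rate P K ℓ x s * psiAt P K ℓ x s y

/-- Whether the focus region shrinks before round `t`. -/
def Cut (t : ℕ) : Prop :=
  volume (focus P K ℓ x (t - 1) ∩ ellipsoid (weights P K ℓ x t) P.α) ≤
    2⁻¹ * volume (focus P K ℓ x (t - 1))

variable {P K ℓ x}

theorem focus_zero : focus P K ℓ x 0 = K := rfl

theorem focus_one : focus P K ℓ x 1 = K := rfl

theorem rate_one : rate P K ℓ x 1 = P.η₁ := rfl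

theorem stateAfter_succ_S (t : ℕ) (y : Pt n) : (stateAfter P K ℓ x (t + 1)).S y =
    (stateAfter P K ℓ x t).S y +
      ENNReal.ofReal (rate P K ℓ x (t + 1)) * estimate P K ℓ x (t + 1) y := by
  change (step _ _ _ _ _).S y = _
  unfold step
  simp only
  split_ifs <;> rfl

theorem weights_add_two (t : ℕ) : weights P K ℓ x (t + 2) =
    expWeights K fun y => (stateAfter P K ℓ x t).S y +
      ENNReal.ofReal (stateAfter P K ℓ x t).η * lossEstimate P K (stateAfter P K ℓ x t).F
        (expWeights K (stateAfter P K ℓ x t).S) (x (t + 1)) (ℓ (t + 1) (x (t + 1))) y := by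
  change expWeights K (stateAfter P K ℓ x (t + 1)).S = _
  congr 1
  exact funext fun y => stateAfter_succ_S t y

theorem state_of_cut {t : ℕ} (h : Cut P K ℓ x (t + 2)) : focus P K ℓ x (t + 2) =
    focus P K ℓ x (t + 1) ∩ ellipsoid (weights P K ℓ x (t + 2)) P.α ∧
    rate P K ℓ x (t + 2) = (1 + P.γ) * rate P K ℓ x (t + 1) := by
  rw [weights_add_two]
  rw [Cut, weights_add_two] at h
  change (step _ _ _ _ _).F = _ ∧ (step _ _ _ _ _).η = _
  unfold step
  simp only
  rw [if_pos (by exact h)]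
  exact ⟨rfl, rfl⟩

theorem state_of_not_cut {t : ℕ} (h : ¬ Cut P K ℓ x (t + 2)) : focus P K ℓ x (t + 2) =
    focus P K ℓ x (t + 1) ∧ rate P K ℓ x (t + 2) = rate P K ℓ x (t + 1) := by
  rw [Cut, weights_add_two] at h
  change (step _ _ _ _ _).F = _ ∧ (step _ _ _ _ _).η = _
  unfold step
  simp only
  rw [if_neg (by exact h)]
  exact ⟨rfl, rfl⟩

theorem focus_of_cut {t : ℕ} (h : Cut P K ℓ x (t + 2)) : focus P K ℓ x (t + 2) =
    focus P K ℓ x (t + 1) ∩ ellipsoid (weights P K ℓ x (t + 2)) P.α := (state_of_cut h).1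

theorem rate_of_cut {t : ℕ} (h : Cut P K ℓ x (t + 2)) : rate P K ℓ x (t + 2) =
    (1 + P.γ) * rate P K ℓ x (t + 1) := (state_of_cut h).2

theorem focus_of_not_cut {t : ℕ} (h : ¬ Cut P K ℓ x (t + 2)) : focus P K ℓ x (t + 2) =
    focus P K ℓ x (t + 1) := (state_of_not_cut h).1

theorem rate_of_not_cut {t : ℕ} (h : ¬ Cut P K ℓ x (t + 2)) : rate P K ℓ x (t + 2) =
    rate P K ℓ x (t + 1) := (state_of_not_cut h).2

theorem focus_succ_subset (t : ℕ) : focus P K ℓ x (t + 1) ⊆ focus P K ℓ x t := by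
  rcases t with _ | t
  · rfl
  · by_cases h : Cut P K ℓ x (t + 2)
    · rw [focus_of_cut h]; exact inter_subset_left
    · rw [focus_of_not_cut h]

theorem focus_anti {s t : ℕ} (h : s ≤ t) : focus P K ℓ x t ⊆ focus P K ℓ x s :=
  antitone_nat_of_succ_le (f := fun t => focus P K ℓ x t) focus_succ_subset h

theorem focus_subset (t : ℕ) : focus P K ℓ x t ⊆ K := focus_anti (Nat.zero_le t)

theorem estimate_of_mem {t : ℕ} {y : Pt n} (hy : y ∈ focus P K ℓ x t) :
    estimate P K ℓ x t y = ENNReal.ofReal (psiAt P K ℓ x t y) := lossEstimate_of_mem hy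

theorem estimate_of_notMem {t : ℕ} {y : Pt n} (hy : y ∉ focus P K ℓ x t) :
    estimate P K ℓ x t y = ∞ := if_neg hy

/-- The numerical conditions under which the algorithm is well behaved on every path. -/
structure Tame (P : Params) (n : ℕ) : Prop extends Proper P n where
  one_le : 1 ≤ n
  α_ge : 80 * n * √n ≤ P.α
  γ_nonneg : 0 ≤ P.γ
  η_pos : 0 < P.η₁
  ratio : sharpness P n * (P.lam * (2 * (20 * n * P.α)) *
    (2 * (10 * n * P.α * P.lam + 20 * √P.lam * P.ε) + 2 * P.lam * (20 * n * P.α))) ≤ 1 / 10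
  ε_nonneg : 0 ≤ P.ε

/-- A convex body. -/
structure IsBody (K : Set (Pt n)) : Prop where
  convex : Convex ℝ K
  compact : IsCompact K
  nonempty_interior : (interior K).Nonempty

theorem Tame.one_le_cast (h : Tame P n) : (1 : ℝ) ≤ n := by exact_mod_cast h.one_le

theorem Tame.one_le_sqrt (h : Tame P n) : 1 ≤ √(n : ℝ) := Real.one_le_sqrt.2 h.one_le_cast

theorem Tame.eighty_mul_le (h : Tame P n) : 80 * (n : ℝ) ≤ P.α := by
  refine le_trans ?_ h.α_ge
  have := h.one_le_sqrt
  have := h.one_le_cast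
  nlinarith

theorem Tame.α_pos (h : Tame P n) : 0 < P.α :=
  lt_of_lt_of_le (by have := h.one_le_cast; positivity) h.eighty_mul_le

theorem Tame.radius_nonneg (h : Tame P n) : 0 ≤ 10 * n * P.α * P.lam + 20 * √P.lam * P.ε := by
  have := h.α_pos
  have := h.lam_pos
  have := h.ε_nonneg
  positivity

theorem IsBody.volume_ne_zero (hK : IsBody K) : volume K ≠ 0 := fun h =>
  (isOpen_interior.measure_pos volume hK.nonempty_interior).ne'
    (measure_mono_null interior_subset h)

theorem rate_pos (hP : Tame P n) (t : ℕ) : 0 < rate P K ℓ x t := by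
  have h : ∀ t, 0 < rate P K ℓ x (t + 1) := by
    intro t
    induction t with
    | zero => exact hP.η_pos
    | succ t ih =>
      by_cases h : Cut P K ℓ x (t + 2)
      · rw [rate_of_cut h]
        have := hP.γ_nonneg
        positivity
      · rw [rate_of_not_cut h]; exact ih
  rcases t with _ | t
  · exact hP.η_pos
  · exact h t

theorem energy_nonneg (hP : Tame P n) (t : ℕ) (y : Pt n) : 0 ≤ energy P K ℓ x t y :=
  Finset.sum_nonneg fun _ _ => mul_nonneg (rate_pos hP _).le (psi_nonneg _ _ _ _)

theorem continuous_energy (hP : Tame P n) (t : ℕ) : Continuous (energy P K ℓ x t) :=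
  continuous_finsetSum _ fun _ _ => (continuous_psi hP.toProper _ _ _).const_mul _

theorem energy_succ (t : ℕ) (y : Pt n) : energy P K ℓ x (t + 1) y = energy P K ℓ x t y +
    rate P K ℓ x (t + 1) * psiAt P K ℓ x (t + 1) y :=
  Finset.sum_Icc_succ_top (by omega) _

theorem stateAfter_S_of_mem (hP : Tame P n) (t : ℕ) {y : Pt n} (hy : y ∈ focus P K ℓ x t) :
    (stateAfter P K ℓ x t).S y = ENNReal.ofReal (energy P K ℓ x t y) := by
  induction t with
  | zero => simp [stateAfter, energy]
  | succ t ih =>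
    rw [stateAfter_succ_S, ih (focus_succ_subset t hy), energy_succ, estimate_of_mem hy,
      ENNReal.ofReal_add (energy_nonneg hP t y)
        (mul_nonneg (rate_pos hP _).le (psi_nonneg _ _ _ _)),
      ENNReal.ofReal_mul (rate_pos hP _).le]

theorem stateAfter_S_of_notMem (hP : Tame P n) (t : ℕ) {y : Pt n} (hyK : y ∈ K)
    (hy : y ∉ focus P K ℓ x t) : (stateAfter P K ℓ x t).S y = ∞ := by
  rcases t with _ | t
  · exact absurd hyK hy
  · rw [stateAfter_succ_S, estimate_of_notMem hy, ENNReal.mul_top, add_top]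
    simpa using rate_pos hP _

/-- The estimates become infinite off the region of their own round, so `p_{t+1}` is carried by
`F_t`, which may be larger than `F_{t+1}`. This index shift recurs throughout. -/
theorem weights_eq_gibbs (hP : Tame P n) (hK : IsBody K) (t : ℕ)
    (hm : MeasurableSet (focus P K ℓ x t)) :
    weights P K ℓ x (t + 1) = gibbs (focus P K ℓ x t) (energy P K ℓ x t) :=
  expWeights_eq_gibbs hK.compact.measurableSet hm (focus_subset t)
    (fun _ hy => stateAfter_S_of_mem hP t hy) (fun y _ => energy_nonneg hP t y)
    (fun _ hyK hy => stateAfter_S_of_notMem hP t hyK hy)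

/-- The focus regions are convex bodies. -/
theorem focus_body (hP : Tame P n) (hK : IsBody K) (t : ℕ) :
    (Convex ℝ (focus P K ℓ x t) ∧ IsClosed (focus P K ℓ x t) ∧ volume (focus P K ℓ x t) ≠ 0) := by
  have h : ∀ t, (Convex ℝ (focus P K ℓ x (t + 1)) ∧ IsClosed (focus P K ℓ x (t + 1)) ∧
      volume (focus P K ℓ x (t + 1)) ≠ 0) := by
    intro t
    induction t with
    | zero => exact ⟨hK.convex, hK.compact.isClosed, hK.volume_ne_zero⟩
    | succ t ih =>
      obtain ⟨h1, h2, h3⟩ := ih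
      by_cases h : Cut P K ℓ x (t + 2)
      · have hw := weights_eq_gibbs hP hK (t + 1) h2.measurableSet
        have hreg : Regular (weights P K ℓ x (t + 2)) := by
          rw [hw]
          exact regular_gibbs h2.measurableSet h3 (hK.compact.isBounded.subset (focus_subset _))
            (continuous_energy hP _) (fun y _ => energy_nonneg hP _ y)
        rw [focus_of_cut h]
        refine ⟨h1.inter (convex_ellipsoid hreg.posDef _), h2.inter (isClosed_ellipsoid _ _), ?_⟩
        -- If a cut left a null set, the new weights would give no mass to their own ellipsoid of
        -- radius `α`, against Chebyshev's inequality.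
        intro h0
        have := hreg.prob
        have h4 : weights P K ℓ x (t + 2) (ellipsoid (weights P K ℓ x (t + 2)) P.α) = 0 := by
          have h5 : weights P K ℓ x (t + 2) (focus P K ℓ x (t + 1))ᶜ = 0 := by
            have := gibbs_ae_mem (S := energy P K ℓ x (t + 1)) h2.measurableSet
            rw [← hw] at this
            exact this
          have h6 := hreg.ac h0
          refine measure_mono_null (fun z hz => ?_) (measure_union_null h5 h6)
          by_cases hzF : z ∈ focus P K ℓ x (t + 1)
          · exact Or.inr ⟨hzF, hz⟩
          · exact Or.inl hzF
        have h7 := hreg.measureReal_compl_ellipsoid_le hP.α_pos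
        rw [measureReal_compl (isClosed_ellipsoid _ _).measurableSet, measureReal_def _ (ellipsoid _ _),
          h4] at h7
        simp only [probReal_univ, ENNReal.toReal_zero, sub_zero] at h7
        rw [le_div_iff₀ (pow_pos hP.α_pos 2), one_mul] at h7
        have := hP.eighty_mul_le
        have := hP.one_le_cast
        nlinarith
      · rw [focus_of_not_cut h]; exact ⟨h1, h2, h3⟩
  rcases t with _ | t
  · exact h 0
  · exact h t

theorem convex_focus (hP : Tame P n) (hK : IsBody K) (t : ℕ) : Convex ℝ (focus P K ℓ x t) :=
  (focus_body hP hK t).1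

theorem isClosed_focus (hP : Tame P n) (hK : IsBody K) (t : ℕ) : IsClosed (focus P K ℓ x t) :=
  (focus_body hP hK t).2.1

theorem volume_focus_ne_zero (hP : Tame P n) (hK : IsBody K) (t : ℕ) :
    volume (focus P K ℓ x t) ≠ 0 := (focus_body hP hK t).2.2

theorem volume_focus_ne_top (hK : IsBody K) (t : ℕ) : volume (focus P K ℓ x t) ≠ ∞ :=
  (hK.compact.isBounded.subset (focus_subset t)).measure_lt_top.ne

theorem weights_succ (hP : Tame P n) (hK : IsBody K) (t : ℕ) :
    weights P K ℓ x (t + 1) = gibbs (focus P K ℓ x t) (energy P K ℓ x t) :=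
  weights_eq_gibbs hP hK t (isClosed_focus hP hK t).measurableSet

theorem regular_weights (hP : Tame P n) (hK : IsBody K) (t : ℕ) :
    Regular (weights P K ℓ x t) := by
  have h : ∀ t, Regular (weights P K ℓ x (t + 1)) := fun t => by
    rw [weights_succ hP hK]
    exact regular_gibbs (isClosed_focus hP hK t).measurableSet (volume_focus_ne_zero hP hK t)
      (hK.compact.isBounded.subset (focus_subset _)) (continuous_energy hP _)
      (fun y _ => energy_nonneg hP _ y)
  rcases t with _ | t
  · exact h 0
  · exact h t

theorem weights_succ_ae_mem (hP : Tame P n) (hK : IsBody K) (t : ℕ) :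
    ∀ᵐ y ∂(weights P K ℓ x (t + 1)), y ∈ focus P K ℓ x t := by
  rw [weights_succ hP hK]
  exact gibbs_ae_mem (isClosed_focus hP hK t).measurableSet

/-- The focus region of round `t` is in a moderate ellipsoid of the weights of that round. -/
theorem focus_subset_ellipsoid (hP : Tame P n) (hK : IsBody K) {t : ℕ} (ht : 1 ≤ t) :
    focus P K ℓ x t ⊆ ellipsoid (weights P K ℓ x t) (10 * n * P.α) := by
  have hn := hP.one_le_cast
  have hα := hP.α_pos
  obtain ⟨t, rfl⟩ := Nat.exists_eq_add_of_le' ht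
  have hreg := regular_weights (ℓ := ℓ) (x := x) hP hK (t + 1)
  have hprob := hreg.prob
  rcases t with _ | t
  -- No cut precedes round 1. The weights are then uniform on `K`, and Chebyshev with radius `2 √n`
  -- puts at least `3/4` of the volume in the ellipsoid.
  · set ρ : ℝ := 2 * √n
    have hρ : 0 < ρ := by have := hP.one_le_sqrt; positivity
    have hle : 10 * n * ρ ≤ 10 * n * P.α := by
      gcongr
      have := hP.α_ge
      have := hP.one_le_sqrt
      nlinarith
    refine (subset_ellipsoid_of_half_volume hP.one_le hreg.posDef hK.convex
      hK.compact.measurableSet hK.compact.measure_lt_top.ne hρ ?_).trans (ellipsoid_mono hle)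
    intro hcut
    have h1 : weights P K ℓ x 1 (ellipsoid (weights P K ℓ x 1) ρ) ≤ 2⁻¹ := by
      have e : weights P K ℓ x 1 (ellipsoid (weights P K ℓ x 1) ρ) =
          (volume K)⁻¹ * volume (K ∩ ellipsoid (weights P K ℓ x 1) ρ) := by
        have hw := weights_succ (ℓ := ℓ) (x := x) hP hK 0
        set E := ellipsoid (weights P K ℓ x 1) ρ with hE
        have hEm : MeasurableSet E := (isClosed_ellipsoid _ _).measurableSet
        rw [zero_add] at hw
        rw [hw, gibbs_apply hEm, inter_comm]
        simp [energy, focus_zero]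
      rw [e]
      calc _ ≤ (volume K)⁻¹ * (2⁻¹ * volume K) := by gcongr
        _ = 2⁻¹ := by
          rw [mul_left_comm, ENNReal.inv_mul_cancel hK.volume_ne_zero hK.compact.measure_lt_top.ne,
            mul_one]
    have h2 := hreg.measureReal_compl_ellipsoid_le hρ
    rw [measureReal_compl (isClosed_ellipsoid _ _).measurableSet] at h2
    have h3 : (weights P K ℓ x 1).real (ellipsoid (weights P K ℓ x 1) ρ) ≤ 1 / 2 := by
      have := ENNReal.toReal_mono (by simp) h1
      simpa [Measure.real] using this
    have h4 : (n : ℝ) / ρ ^ 2 = 1 / 4 := by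
      simp only [ρ]
      rw [mul_pow, Real.sq_sqrt (by positivity)]
      field_simp
      norm_num
    simp only [zero_add] at h2
    rw [h4, probReal_univ] at h2
    linarith
  -- After a cut the region lies in `𝓔(α)` by construction; without one, more than half of its
  -- volume does, and the half-volume lemma applies.
  · by_cases h : Cut P K ℓ x (t + 2)
    · rw [focus_of_cut h]
      refine inter_subset_right.trans (ellipsoid_mono ?_)
      nlinarith
    · rw [focus_of_not_cut h]
      exact subset_ellipsoid_of_half_volume hP.one_le hreg.posDef (convex_focus hP hK _)
        (isClosed_focus hP hK _).measurableSet (volume_focus_ne_top hK _) hα h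

theorem measureReal_ellipsoid_ge (hP : Tame P n) {p : Measure (Pt n)} (hp : Regular p) {R : ℝ}
    (hR : P.α ≤ R) : 9 / 10 ≤ p.real (ellipsoid p R) := by
  have := hp.prob
  have hn := hP.one_le_cast
  have hα := hP.eighty_mul_le
  have h := hp.measureReal_compl_ellipsoid_le (lt_of_lt_of_le hP.α_pos hR)
  rw [measureReal_compl (isClosed_ellipsoid _ _).measurableSet, probReal_univ] at h
  have : n / R ^ 2 ≤ 1 / 10 := by
    rw [div_le_div_iff₀ (by have := lt_of_lt_of_le hP.α_pos hR; positivity) (by norm_num)]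
    nlinarith
  linarith

theorem exp_tenth_le : Real.exp (1 / 10) ≤ 6 / 5 := by
  have := Real.exp_bound_div_one_sub_of_interval (x := 1 / 10) (by norm_num) (by norm_num)
  refine this.trans (by norm_num)

/-- The kernel varies by a factor at most `exp(1/10) ≤ 6/5` over an ellipsoid of mass at least
`9/10`, and `6/5 ≤ 2 · 9/10`. This is what bounds the loss estimates by 2. -/
theorem kernel_le_two_mul (hP : Tame P n) {p : Measure (Pt n)} (hp : Regular p) {z y : Pt n}
    (hz : z ∈ typical P K p) (hy : y ∈ ellipsoid p (20 * n * P.α)) :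
    kernel P p z y ≤ 2 * kernelDensity P p p z := by
  have hn := hP.one_le_cast
  have hα := hP.α_pos
  refine kernel_le_mul_kernelDensity hP.toProper hp hP.radius_nonneg (by positivity) hz.2 hy
    hP.ratio (exp_tenth_le.trans ?_)
  have := measureReal_ellipsoid_ge hP hp (R := 20 * n * P.α) (by nlinarith)
  linarith

theorem psi_le_two (hP : Tame P n) {p : Measure (Pt n)} (hp : Regular p) {z y : Pt n} {v : ℝ}
    (hv : v ∈ Icc (0 : ℝ) 1) (hy : y ∈ ellipsoid p (20 * n * P.α)) :
    psi P K p z v y ≤ 2 := by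
  refine max_le ?_ (by norm_num)
  by_cases hz : z ∈ typical P K p
  · rw [indicator_of_mem hz, mul_one]
    have h1 := kernelDensity_pos hP.toProper hp z
    rw [div_mul_eq_mul_div, div_le_iff₀ h1]
    refine le_trans ?_ (kernel_le_two_mul hP hp hz hy)
    exact mul_le_of_le_one_left (kernel_nonneg hP.toProper _ _) hv.2
  · rw [indicator_of_notMem hz]; simp

/-- The learning rate and the volume of the focus region after a number of cuts. -/
theorem exists_rate_eq (t : ℕ) :
    ∃ k : ℕ, rate P K ℓ x (t + 1) = (1 + P.γ) ^ k * P.η₁ ∧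
      2 ^ k * volume (focus P K ℓ x (t + 1)) ≤ volume K := by
  induction t with
  | zero => exact ⟨0, by simp [rate_one], by simp [focus_one]⟩
  | succ t ih =>
    obtain ⟨k, h1, h2⟩ := ih
    by_cases h : Cut P K ℓ x (t + 2)
    · refine ⟨k + 1, by rw [rate_of_cut h, h1]; ring, ?_⟩
      rw [focus_of_cut h, pow_succ, mul_assoc]
      refine le_trans ?_ h2
      gcongr
      calc _ ≤ 2 * (2⁻¹ * volume (focus P K ℓ x (t + 1))) := by gcongr; exact h
        _ = _ := by rw [← mul_assoc, ENNReal.mul_inv_cancel (by norm_num) (by norm_num), one_mul]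
    · exact ⟨k, by rw [rate_of_not_cut h, h1], by rw [focus_of_not_cut h]; exact h2⟩

end Path

end KernelBCO

namespace KernelBCO

/-! ### Consequences of concentration and of the absence of a restart -/

section Analysis

open scoped InnerProductSpace

variable {n : ℕ} {P : Params} {K : Set (Pt n)} {ℓ : ℕ → Pt n → ℝ} {x : ℕ → Pt n}

/-- The numerical conditions under which the algorithm is well behaved before a fault. -/
structure Tuned (P : Params) (n : ℕ) : Prop extends Tame P n where
  T_ge : (1000 : ℝ) ≤ P.T
  n_le : 100 * (n : ℝ) ≤ P.T
  sharp_ge : 1 ≤ sharpness P n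
  gauss : Real.exp (-(sharpness P n / 4)) * √(2 ^ n) ≤ 1
  gauss_tail : Real.exp (-(sharpness P n * (20 * √P.lam * P.ε) ^ 2 / 4)) * √(2 ^ n) ≤
    ((P.T : ℝ) ^ 10)⁻¹
  tail : Real.exp (4 - 3 * P.α / (40 * √n)) * (((P.T : ℝ)⁻¹) ^ n)⁻¹ ≤ ((P.T : ℝ) ^ 8)⁻¹
  energy_le : P.T * (Real.exp 1 * P.η₁ * 2) + 2 ≤ P.T
  η_le : 2 * (Real.exp 1 * P.η₁) ≤ 1 / (100 * n)
  α_le : 80 * n * P.α + 4 ≤ P.T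
  small_radius : 2 * (40 * n * P.α) * (10 * n * P.α * P.lam + 20 * √P.lam * P.ε) < 1
  growth : ∀ k : ℕ, (2 : ℝ) ^ k ≤ (P.T : ℝ) ^ (4 * n) → (1 + P.γ) ^ (k + 1) ≤ Real.exp 1
  β_eq : P.β = 4

/-- The losses and the played points on a path of the game. -/
structure IsPath (P : Params) (K : Set (Pt n)) (ℓ : ℕ → Pt n → ℝ) (x : ℕ → Pt n) : Prop
    extends IsBody K where
  ball : ∃ c, Metric.closedBall c 1 ⊆ K
  diam : ∀ y ∈ K, ∀ z ∈ K, ‖y - z‖ ≤ P.T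
  loss : ∀ t, 1 ≤ t → t ≤ P.T → IsLoss K P.T (ℓ t)
  mem : ∀ t, 1 ≤ t → t ≤ P.T → x t ∈ K

theorem IsPath.carriedBy (h : IsPath P K ℓ x) (hP : Tame P n) (t : ℕ) :
    CarriedBy K P.T (weights P K ℓ x t) where
  toRegular := regular_weights hP h.toIsBody t
  convexBody := h.convex
  closed := h.compact.isClosed
  nonempty_interior := h.nonempty_interior
  diam := h.diam
  nonneg := by positivity
  ae_mem := by
    rcases t with _ | t
    · exact weights_succ_ae_mem hP h.toIsBody 0
    · exact (weights_succ_ae_mem hP h.toIsBody t).mono fun y hy => focus_subset t hy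

theorem IsPath.loss_mem (h : IsPath P K ℓ x) {t : ℕ} (h1 : 1 ≤ t) (hT : t ≤ P.T) :
    ℓ t (x t) ∈ Icc (0 : ℝ) 1 := (h.loss t h1 hT).maps (h.mem t h1 hT)

theorem IsPath.psiAt_le_two (h : IsPath P K ℓ x) (hP : Tame P n) {t : ℕ} (h1 : 1 ≤ t)
    (hT : t ≤ P.T) {y : Pt n} (hy : y ∈ focus P K ℓ x t) : psiAt P K ℓ x t y ≤ 2 := by
  refine psi_le_two hP (regular_weights hP h.toIsBody t) (h.loss_mem h1 hT)
    (ellipsoid_mono ?_ (focus_subset_ellipsoid hP h.toIsBody h1 hy))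
  have := hP.α_pos
  have := hP.one_le_cast
  nlinarith

theorem cumEstimate_of_mem {t : ℕ} {y : Pt n} (hy : y ∈ focus P K ℓ x t) :
    cumEstimate P K ℓ x t y =
      ENNReal.ofReal (∑ s ∈ Finset.Icc 1 t, psiAt P K ℓ x s y) := by
  rw [cumEstimate, ENNReal.ofReal_sum_of_nonneg fun s _ => psi_nonneg _ _ _ _]
  refine Finset.sum_congr rfl fun s hs => ?_
  exact estimate_of_mem (focus_anti (Finset.mem_Icc.1 hs).2 hy)

theorem toReal_cumEstimate_of_mem {t : ℕ} {y : Pt n} (hy : y ∈ focus P K ℓ x t) :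
    (cumEstimate P K ℓ x t y).toReal = ∑ s ∈ Finset.Icc 1 t, psiAt P K ℓ x s y := by
  rw [cumEstimate_of_mem hy,
    ENNReal.toReal_ofReal (Finset.sum_nonneg fun s _ => psi_nonneg _ _ _ _)]

theorem toReal_estimate_of_mem {t : ℕ} {y : Pt n} (hy : y ∈ focus P K ℓ x t) :
    (estimate P K ℓ x t y).toReal = psiAt P K ℓ x t y := by
  rw [estimate_of_mem hy, ENNReal.toReal_ofReal (psi_nonneg _ _ _ _)]

theorem Concentrated.dev₂_le {t : ℕ} (h : Concentrated P K ℓ x t) {y : Pt n}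
    (hy : y ∈ focus P K ℓ x t) : P.η₁ * |∑ s ∈ Finset.Icc 1 t, psiAt P K ℓ x s y -
      ∑ s ∈ Finset.Icc 1 t, adjExt P K ℓ x s y| ≤ 1 := by
  have h1 : dev₂ P K ℓ x t ≤ 1 := ((le_max_right _ _).trans (le_max_left _ _)).trans h
  have h2 := (le_iSup₂_of_le (f := fun (y : Pt n) (_ : y ∈ focus P K ℓ x t) => ENNReal.ofReal (P.η₁ *
    |(cumEstimate P K ℓ x t y).toReal - ∑ s ∈ Finset.Icc 1 t, adjExt P K ℓ x s y|)) y hy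
    le_rfl).trans h1
  rwa [ENNReal.ofReal_le_one, toReal_cumEstimate_of_mem hy] at h2

theorem Concentrated.dev₃_le {t : ℕ} (h : Concentrated P K ℓ x t) {y : Pt n}
    (hy : y ∈ focus P K ℓ x t) : |energy P K ℓ x t y -
      ∑ s ∈ Finset.Icc 1 t, rate P K ℓ x s * adjExt P K ℓ x s y| ≤ 1 := by
  have h1 : dev₃ P K ℓ x t ≤ 1 := ((le_max_left _ _).trans (le_max_right _ _)).trans h
  have h2 := (le_iSup₂_of_le (f := fun (y : Pt n) (_ : y ∈ focus P K ℓ x t) => ENNReal.ofReal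
    |∑ s ∈ Finset.Icc 1 t,
      rate P K ℓ x s * ((estimate P K ℓ x s y).toReal - adjExt P K ℓ x s y)|) y hy
    le_rfl).trans h1
  rw [ENNReal.ofReal_le_one] at h2
  rw [energy, ← Finset.sum_sub_distrib]
  refine le_trans (le_of_eq ?_) h2
  congr 1
  refine Finset.sum_congr rfl fun s hs => ?_
  rw [toReal_estimate_of_mem (focus_anti (Finset.mem_Icc.1 hs).2 hy), mul_sub]

theorem convexOn_sum_adjExt (h : IsPath P K ℓ x) (hP : Tame P n) {t : ℕ} (hT : t ≤ P.T)
    {w : ℕ → ℝ} (hw : ∀ s, 0 ≤ w s) :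
    ConvexOn ℝ K fun y => ∑ s ∈ Finset.Icc 1 t, w s * adjExt P K ℓ x s y := by
  refine ⟨h.convex, fun y hy z hz a b ha hb hab => ?_⟩
  simp only [smul_eq_mul, Finset.mul_sum]
  rw [← Finset.sum_add_distrib]
  refine Finset.sum_le_sum fun s hs => ?_
  obtain ⟨h1, h2⟩ := Finset.mem_Icc.1 hs
  have := ((h.carriedBy hP s).convexOn_kernelAdjoint hP.toProper
    (h.loss s h1 (h2.trans hT))).2 hy hz ha hb hab
  simp only [smul_eq_mul] at this
  calc _ ≤ w s * (a * adjExt P K ℓ x s y + b * adjExt P K ℓ x s z) :=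
        mul_le_mul_of_nonneg_left this (hw s)
    _ = _ := by ring

theorem exists_mem_segment_frontier {F : Set (Pt n)} {y z : Pt n} (hy : y ∈ F) (hz : z ∉ F) :
    ∃ w ∈ segment ℝ y z, w ∈ frontier F := by
  by_contra! hcon
  have hpre : IsPreconnected (segment ℝ y z) := (convex_segment y z).isPreconnected
  have hcov : segment ℝ y z ⊆ interior F ∪ (closure F)ᶜ := by
    intro w hw
    by_contra h
    simp only [mem_union, not_or, mem_compl_iff, not_not] at h
    exact hcon w hw ⟨h.2, h.1⟩
  obtain ⟨w, -, h1, h2⟩ := hpre _ _ isOpen_interior isClosed_closure.isOpen_compl hcov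
    ⟨y, left_mem_segment ℝ y z, (hcov (left_mem_segment ℝ y z)).resolve_right
      fun h => h (subset_closure hy)⟩
    ⟨z, right_mem_segment ℝ y z, (hcov (right_mem_segment ℝ y z)).resolve_left
      fun h => hz (interior_subset h)⟩
  exact h2 (subset_closure (interior_subset h1))

theorem interior_nonempty_of_volume_ne_zero {F : Set (Pt n)} (hF : Convex ℝ F)
    (h0 : volume F ≠ 0) : (interior F).Nonempty := by
  by_contra h
  rw [not_nonempty_iff_eq_empty] at h
  refine h0 (measure_mono_null (fun y hy => ?_) (hF.addHaar_frontier volume))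
  exact ⟨subset_closure hy, by simp [h]⟩

/-- A set contains a copy of the interior of `K` scaled by the factor `T ^ (-4)`. -/
def HasCopy (P : Params) (K F : Set (Pt n)) : Prop :=
  ∃ y₀, ∀ z ∈ interior K, y₀ + ((P.T : ℝ) ^ 4)⁻¹ • (z - y₀) ∈ F

theorem Tuned.T_pos (hP : Tuned P n) : (0 : ℝ) < P.T := by linarith [hP.T_ge]

theorem Tuned.η_lt_one (hP : Tuned P n) : P.η₁ < 1 := by
  have h1 := hP.η_le
  have h2 : (1 : ℝ) ≤ Real.exp 1 := Real.one_le_exp zero_le_one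
  have h3 : 1 / (100 * (n : ℝ)) ≤ 1 := by
    rw [div_le_one (by have := hP.one_le_cast; positivity)]; linarith [hP.one_le_cast]
  nlinarith [hP.η_pos]

theorem adjExt_bounds (h : IsPath P K ℓ x) (hP : Tuned P n) {s : ℕ} (h1 : 1 ≤ s) (hT : s ≤ P.T)
    {y : Pt n} (hy : y ∈ K) :
    0 ≤ adjExt P K ℓ x s y ∧ adjExt P K ℓ x s y ≤ 2 + 2 * (P.T : ℝ) ^ 2 := by
  refine ⟨(h.loss s h1 hT).kernelAdjoint_nonneg hP.toProper y, ?_⟩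
  have := (h.carriedBy hP.toTame s).kernelAdjoint_le hP.toProper (h.loss s h1 hT) hy hP.sharp_ge
    hP.gauss
  refine this.trans (le_of_eq ?_)
  simp [sq]

/-- If the focus region does not change and the algorithm does not restart, then the focus region
is not too small. -/
theorem hasCopy_of_not_restarts (h : IsPath P K ℓ x) (hP : Tuned P n) {s : ℕ} (h1 : 1 ≤ s)
    (hT : s ≤ P.T) (hfocus : focus P K ℓ x (s + 1) = focus P K ℓ x s)
    (hres : ¬ Restarts P K ℓ x s) (hconc : Concentrated P K ℓ x s) :
    HasCopy P K (focus P K ℓ x s) := by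
  set F := focus P K ℓ x s
  have hFc : Convex ℝ F := convex_focus hP.toTame h.toIsBody s
  have hFcl : IsClosed F := isClosed_focus hP.toTame h.toIsBody s
  have hFK : F ⊆ K := focus_subset s
  have hFi : (interior F).Nonempty :=
    interior_nonempty_of_volume_ne_zero hFc (volume_focus_ne_zero hP.toTame h.toIsBody s)
  have hη := hP.η_pos
  set Lt : Pt n → ℝ := fun y => ∑ s ∈ Finset.Icc 1 s, psiAt P K ℓ x s y
  have hLtc : Continuous Lt := continuous_finsetSum _ fun _ _ => continuous_psi hP.toProper _ _ _
  have hLt0 : ∀ y, 0 ≤ Lt y := fun y => Finset.sum_nonneg fun s _ => psi_nonneg _ _ _ _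
  set I : ℝ≥0∞ := ⨅ y ∈ K, cumEstimate P K ℓ x s y
  -- The infimum over `K` is finite while the estimate is infinite off `F`, so near minimizers lie
  -- in `F`.
  obtain ⟨y₁, hy₁F, hy₁⟩ : ∃ y₁ ∈ F, Lt y₁ < I.toReal + 1 / (2 * P.η₁) := by
    have hI : I ≠ ∞ := by
      obtain ⟨z, hz⟩ := hFi
      have hzF := interior_subset hz
      refine ne_top_of_le_ne_top ?_ (iInf₂_le z (hFK hzF))
      rw [cumEstimate_of_mem hzF]; simp
    have hlt : I < I + ENNReal.ofReal (1 / (2 * P.η₁)) :=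
      ENNReal.lt_add_right hI (by simpa using hη)
    obtain ⟨y₁, hy⟩ := iInf_lt_iff.1 hlt
    obtain ⟨hyK, hy⟩ := iInf_lt_iff.1 hy
    have hyF : y₁ ∈ F := by
      by_contra hn
      have : cumEstimate P K ℓ x s y₁ = ∞ := by
        refine ENNReal.sum_eq_top.2 ⟨s, Finset.mem_Icc.2 ⟨h1, le_rfl⟩, estimate_of_notMem hn⟩
      rw [this] at hy
      exact absurd hy not_top_lt
    refine ⟨y₁, hyF, ?_⟩
    rw [cumEstimate_of_mem hyF, ← ENNReal.ofReal_toReal hI,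
      ← ENNReal.ofReal_add ENNReal.toReal_nonneg (by positivity)] at hy
    exact (ENNReal.ofReal_lt_ofReal_iff (by positivity)).1 hy
  -- An interior near minimizer is needed so that the boundary point found on the segment is in `int
  -- K`, where the restart condition is tested.
  obtain ⟨y₀, hy₀F, hy₀⟩ : ∃ y₀ ∈ interior F, Lt y₀ < I.toReal + 1 / (2 * P.η₁) := by
    have hcl : y₁ ∈ closure (interior F) := by
      rw [hFc.closure_interior_eq_closure_of_nonempty_interior hFi]; exact subset_closure hy₁F
    obtain ⟨y₀, hy, hy'⟩ := mem_closure_iff.1 hcl {y | Lt y < I.toReal + 1 / (2 * P.η₁)}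
      (isOpen_lt hLtc continuous_const) hy₁
    exact ⟨y₀, hy', hy⟩
  set g : Pt n → ℝ := fun y => ∑ s ∈ Finset.Icc 1 s, P.η₁ * adjExt P K ℓ x s y
  have hg : ConvexOn ℝ K g := convexOn_sum_adjExt h hP.toTame hT fun _ => hη.le
  have hLg : ∀ y ∈ F, |P.η₁ * Lt y - g y| ≤ 1 := by
    intro y hy
    have e : P.η₁ * Lt y - g y =
        P.η₁ * (Lt y - ∑ s ∈ Finset.Icc 1 s, adjExt P K ℓ x s y) := by
      rw [mul_sub, Finset.mul_sum (Finset.Icc 1 s) (fun s => adjExt P K ℓ x s y)]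
    rw [e, abs_mul, abs_of_pos hη]
    exact hconc.dev₂_le hy
  have hT0 := hP.T_pos
  have hT1 := hP.T_ge
  have hg0 : ∀ y ∈ K, 0 ≤ g y := fun y hy => Finset.sum_nonneg fun r hr => by
    obtain ⟨a, b⟩ := Finset.mem_Icc.1 hr
    exact mul_nonneg hη.le (adjExt_bounds h hP a (b.trans hT) hy).1
  -- The exponent 4 of the copy comes from here: `g` is at most `T (2 + 2 T²)`, which is at most
  -- `T⁴`.
  have hgT : ∀ y ∈ K, ((P.T : ℝ) ^ 4)⁻¹ * g y ≤ 1 := by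
    intro y hy
    have h2 : g y ≤ P.T * (2 + 2 * (P.T : ℝ) ^ 2) := by
      calc g y ≤ ∑ _ ∈ Finset.Icc 1 s, (2 + 2 * (P.T : ℝ) ^ 2) := by
            refine Finset.sum_le_sum fun r hr => ?_
            obtain ⟨a, b⟩ := Finset.mem_Icc.1 hr
            have := adjExt_bounds h hP a (b.trans hT) hy
            have h3 := hP.η_lt_one
            nlinarith
        _ = s * (2 + 2 * (P.T : ℝ) ^ 2) := by simp; ring
        _ ≤ _ := by gcongr
    rw [inv_mul_le_iff₀ (by positivity), mul_one]
    refine h2.trans ?_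
    nlinarith [pow_pos hT0 3, pow_pos hT0 2]
  refine ⟨y₀, fun z hz => ?_⟩
  by_contra hnot
  set θ := ((P.T : ℝ) ^ 4)⁻¹
  have hθ0 : 0 < θ := by positivity
  have hθ1 : θ ≤ 1 := inv_le_one_of_one_le₀ (one_le_pow₀ (by linarith))
  have hy₀K : y₀ ∈ interior K := interior_mono hFK hy₀F
  obtain ⟨w, hw, hwf⟩ := exists_mem_segment_frontier (interior_subset hy₀F) hnot
  rw [segment_eq_image_lineMap] at hw
  obtain ⟨a, ⟨ha0, ha1⟩, rfl⟩ := hw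
  have e : AffineMap.lineMap y₀ (y₀ + θ • (z - y₀)) a = (1 - a * θ) • y₀ + (a * θ) • z := by
    rw [AffineMap.lineMap_apply]; simp only [vsub_eq_sub, vadd_eq_add]; module
  rw [e] at hwf
  have haθ0 : 0 ≤ a * θ := by positivity
  have haθ : a * θ ≤ θ := mul_le_of_le_one_left hθ0.le ha1
  set w := (1 - a * θ) • y₀ + (a * θ) • z
  have hwK : w ∈ interior K :=
    h.convex.interior hy₀K hz (by linarith) haθ0 (by ring)
  have hwF : w ∈ F := hFcl.frontier_subset hwf
  -- Without a restart the scaled estimate at `w` exceeds the minimum by more than 4, so `g w`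
  -- exceeds it by more than 3. But `g w` exceeds the minimum by at most `1/2 + 1 + 1`: near
  -- minimality of `y₀`, the passage from the estimate to `g`, and the growth of `g` along the
  -- segment.
  have hnr : P.β < P.η₁ * (Lt w - I.toReal) := by
    by_contra hle
    refine hres ⟨w, ⟨by rw [hfocus]; exact hwf, hwK⟩, ?_⟩
    rw [toReal_cumEstimate_of_mem hwF]
    exact not_lt.1 hle
  rw [hP.β_eq] at hnr
  have h2 := abs_le.1 (hLg w hwF)
  have h3 := abs_le.1 (hLg y₀ (interior_subset hy₀F))
  have h4 := hg.2 (interior_subset hy₀K) (interior_subset hz) (by linarith : 0 ≤ 1 - a * θ) haθ0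
    (by ring)
  simp only [smul_eq_mul] at h4
  change g w ≤ _ at h4
  have h5 : a * θ * g z ≤ 1 := by
    refine le_trans ?_ (hgT z (interior_subset hz))
    gcongr
    exact hg0 z (interior_subset hz)
  have h6 : (1 - a * θ) * g y₀ ≤ g y₀ :=
    mul_le_of_le_one_left (hg0 y₀ (interior_subset hy₀K)) (by linarith)
  have h7 : P.η₁ * Lt y₀ ≤ P.η₁ * I.toReal + 1 / 2 := by
    have := mul_le_mul_of_nonneg_left hy₀.le hη.le
    have e : P.η₁ * (1 / (2 * P.η₁)) = 1 / 2 := by field_simp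
    linarith
  linarith

theorem HasCopy.volume_le (hP : Tuned P n) {F : Set (Pt n)} (hK : Convex ℝ K)
    (hF : HasCopy P K F) :
    ENNReal.ofReal ((((P.T : ℝ) ^ 4)⁻¹) ^ n) * volume K ≤ volume F := by
  obtain ⟨y₀, hy⟩ := hF
  have hT := hP.T_pos
  have h1 : volume K ≤ volume (interior K) := by
    calc volume K ≤ volume (interior K ∪ frontier K) := by
          refine measure_mono fun z hz => ?_
          by_cases hzi : z ∈ interior K
          · exact Or.inl hzi
          · exact Or.inr ⟨subset_closure hz, hzi⟩
      _ ≤ volume (interior K) + volume (frontier K) := measure_union_le _ _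
      _ = _ := by rw [hK.addHaar_frontier volume, add_zero]
  set θ := ((P.T : ℝ) ^ 4)⁻¹
  calc _ ≤ ENNReal.ofReal (θ ^ n) * volume (interior K) := by gcongr
    _ = volume ((fun z => θ • z + (1 - θ) • y₀) '' interior K) :=
        (volume_image_smul_add (by positivity) _ isOpen_interior.measurableSet).symm
    _ ≤ volume F := by
        refine measure_mono ?_
        rintro _ ⟨z, hz, rfl⟩
        convert hy z hz using 1
        module

theorem HasCopy.exists_ball (h : IsPath P K ℓ x) (hP : Tuned P n) {F : Set (Pt n)}
    (hF : HasCopy P K F) : ∃ c, ∀ v : Pt n, ‖v‖ < ((P.T : ℝ) ^ 4)⁻¹ → c + v ∈ F := by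
  obtain ⟨y₀, hy⟩ := hF
  obtain ⟨c, hc⟩ := h.ball
  have hT := hP.T_pos
  set θ := ((P.T : ℝ) ^ 4)⁻¹
  have hθ : 0 < θ := by positivity
  refine ⟨y₀ + θ • (c - y₀), fun v hv => ?_⟩
  have hz : c + θ⁻¹ • v ∈ interior K := by
    refine interior_mono hc (Metric.ball_subset_interior_closedBall ?_)
    rw [Metric.mem_ball, dist_eq_norm, add_sub_cancel_left, norm_smul, Real.norm_of_nonneg
      (by positivity), inv_mul_lt_iff₀ hθ, mul_one]
    exact hv
  convert hy _ hz using 1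
  have : v = θ • (θ⁻¹ • v) := by rw [smul_smul, mul_inv_cancel₀ hθ.ne', one_smul]
  nth_rewrite 1 [this]
  module

/-- The state of the algorithm in round `t` before a fault. -/
structure Healthy (P : Params) (K : Set (Pt n)) (ℓ : ℕ → Pt n → ℝ) (x : ℕ → Pt n) (t : ℕ) :
    Prop where
  rate_le : rate P K ℓ x t ≤ Real.exp 1 * P.η₁
  copy : HasCopy P K (focus P K ℓ x (t - 1))
  supp : focus P K ℓ x (t - 1) ⊆ ellipsoid (weights P K ℓ x t) (40 * n * P.α)
  tail : (weights P K ℓ x t).real (ellipsoid (weights P K ℓ x t) P.α)ᶜ ≤ ((P.T : ℝ) ^ 8)⁻¹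

theorem exp_neg_ge (hP : Tuned P n) : 1 - 1 / (100 * n) ≤ Real.exp (-(2 * (Real.exp 1 * P.η₁))) := by
  have := Real.add_one_le_exp (-(2 * (Real.exp 1 * P.η₁)))
  linarith [hP.η_le]

theorem one_div_hundred_le (hP : Tuned P n) : 1 / (100 * (n : ℝ)) ≤ 1 / 100 := by
  have := hP.one_le_cast
  rw [div_le_div_iff₀ (by positivity) (by norm_num)]; linarith

/-- A cut removes from `F_t` only points outside `𝓔(α)`, so the mass lost is bounded by the tail. -/
theorem measureReal_compl_focus_le (hP : Tuned P n) (hK : IsBody K) {t : ℕ}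
    (htail : (weights P K ℓ x (t + 1)).real (ellipsoid (weights P K ℓ x (t + 1)) P.α)ᶜ ≤
      ((P.T : ℝ) ^ 8)⁻¹) :
    (weights P K ℓ x (t + 1)).real (focus P K ℓ x (t + 1))ᶜ ≤ ((P.T : ℝ) ^ 8)⁻¹ := by
  have hreg := regular_weights (ℓ := ℓ) (x := x) hP.toTame hK (t + 1)
  have := hreg.prob
  refine le_trans ?_ htail
  have hae := weights_succ_ae_mem (ℓ := ℓ) (x := x) hP.toTame hK t
  refine ENNReal.toReal_mono (measure_ne_top _ _) (measure_mono_ae ?_)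
  filter_upwards [hae] with y hy hyc hyE
  refine hyc ?_
  rcases t with _ | t
  · exact hy
  · by_cases hc : Cut P K ℓ x (t + 2)
    · rw [focus_of_cut hc]; exact ⟨hy, hyE⟩
    · rw [focus_of_not_cut hc]; exact hy

/-- The weights change little in one round, up to the restriction to the focus region. -/
theorem weights_comparable (h : IsPath P K ℓ x) (hP : Tuned P n) {t : ℕ} (hT : t + 1 ≤ P.T)
    (hrate : rate P K ℓ x (t + 1) ≤ Real.exp 1 * P.η₁)
    (htail : (weights P K ℓ x (t + 1)).real (ellipsoid (weights P K ℓ x (t + 1)) P.α)ᶜ ≤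
      ((P.T : ℝ) ^ 8)⁻¹) :
    ENNReal.ofReal (Real.exp (-(2 * (Real.exp 1 * P.η₁)))) •
        (weights P K ℓ x (t + 1)).restrict (focus P K ℓ x (t + 1)) ≤ weights P K ℓ x (t + 2) ∧
      weights P K ℓ x (t + 2) ≤ (2 : ℝ≥0∞) • weights P K ℓ x (t + 1) := by
  have hK := h.toIsBody
  have hPt := hP.toTame
  set F := focus P K ℓ x (t + 1)
  set G := focus P K ℓ x t
  have hFG : F ⊆ G := focus_succ_subset t
  have hFm : MeasurableSet F := (isClosed_focus hPt hK _).measurableSet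
  have hGm : MeasurableSet G := (isClosed_focus hPt hK _).measurableSet
  set δ := 2 * (Real.exp 1 * P.η₁)
  set w : Pt n → ℝ≥0∞ := fun y => ENNReal.ofReal (Real.exp (-energy P K ℓ x t y))
  set w' : Pt n → ℝ≥0∞ := fun y => ENNReal.ofReal (Real.exp (-energy P K ℓ x (t + 1) y))
  set Z := ∫⁻ y in G, w y
  set Z' := ∫⁻ y in F, w' y
  have hZ0 : Z ≠ 0 := lintegral_exp_neg_ne_zero (volume_focus_ne_zero hPt hK _)
    (continuous_energy hPt _)
  have hZt : Z ≠ ∞ := lintegral_exp_neg_ne_top hGm (volume_focus_ne_top hK _)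
    fun y _ => energy_nonneg hPt _ y
  have hZ0' : Z' ≠ 0 := lintegral_exp_neg_ne_zero (volume_focus_ne_zero hPt hK _)
    (continuous_energy hPt _)
  have hZt' : Z' ≠ ∞ := lintegral_exp_neg_ne_top hFm (volume_focus_ne_top hK _)
    fun y _ => energy_nonneg hPt _ y
  have hp : ∀ B, MeasurableSet B → weights P K ℓ x (t + 1) B = Z⁻¹ * ∫⁻ y in B ∩ G, w y := by
    intro B hB; rw [weights_succ hPt hK, gibbs_apply hB]
  have hq : ∀ B, MeasurableSet B → weights P K ℓ x (t + 2) B = Z'⁻¹ * ∫⁻ y in B ∩ F, w' y := by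
    intro B hB; rw [weights_succ hPt hK (t + 1), gibbs_apply hB]
  have hw1 : ∀ y, w' y ≤ w y := by
    intro y
    refine ENNReal.ofReal_le_ofReal (Real.exp_le_exp.2 ?_)
    rw [energy_succ]
    have := mul_nonneg (rate_pos (K := K) (ℓ := ℓ) (x := x) hPt (t + 1)).le
      (psi_nonneg (P := P) (K := K) (weights P K ℓ x (t + 1)) (x (t + 1)) (ℓ (t + 1) (x (t + 1))) y)
    linarith
  have hw2 : ∀ y ∈ F, ENNReal.ofReal (Real.exp (-δ)) * w y ≤ w' y := by
    intro y hy
    simp only [w, w']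
    rw [← ENNReal.ofReal_mul (Real.exp_nonneg _), ← Real.exp_add]
    refine ENNReal.ofReal_le_ofReal (Real.exp_le_exp.2 ?_)
    rw [energy_succ]
    have h1 := h.psiAt_le_two hPt (by omega) hT hy
    have h2 : rate P K ℓ x (t + 1) * psiAt P K ℓ x (t + 1) y ≤ Real.exp 1 * P.η₁ * 2 := by
      have := psi_nonneg (P := P) (K := K) (weights P K ℓ x (t + 1)) (x (t + 1))
        (ℓ (t + 1) (x (t + 1))) y
      have := hPt.η_pos
      gcongr
    simp only [δ]
    linarith
  have hw3 : ∀ B, MeasurableSet B →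
      ENNReal.ofReal (Real.exp (-δ)) * ∫⁻ y in B ∩ F, w y ≤ ∫⁻ y in B ∩ F, w' y := by
    intro B hB
    rw [← lintegral_const_mul' _ _ ENNReal.ofReal_ne_top]
    exact setLIntegral_mono_ae' (hB.inter hFm) (Filter.Eventually.of_forall fun y hy => hw2 y hy.2)
  constructor
  · refine Measure.le_iff.2 fun B hB => ?_
    rw [Measure.smul_apply, Measure.restrict_apply hB, hp _ (hB.inter hFm), hq _ hB, smul_eq_mul,
      inter_assoc, inter_eq_left.2 hFG, mul_left_comm]
    refine mul_le_mul' (ENNReal.inv_le_inv.2 ?_) (hw3 B hB)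
    exact (lintegral_mono hw1).trans (lintegral_mono_set hFG)
  -- The ratio `Z' / Z` is at least `exp(-δ) p(F)`; both factors are at least `99/100`. The upper
  -- bound on the new weights uses only this, since the unnormalized density decreases.
  · have hZZ : Z ≤ 2 * Z' := by
      have hreg := regular_weights (ℓ := ℓ) (x := x) hPt hK (t + 1)
      have := hreg.prob
      have h1 := measureReal_compl_focus_le hP hK htail
      rw [measureReal_compl hFm, probReal_univ] at h1
      have hT8 : ((P.T : ℝ) ^ 8)⁻¹ ≤ 1 / 100 := by
        rw [one_div]
        refine inv_anti₀ (by norm_num) ?_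
        calc (100 : ℝ) ≤ P.T := by linarith [hP.T_ge]
          _ = (P.T : ℝ) ^ 1 := (pow_one _).symm
          _ ≤ _ := pow_le_pow_right₀ (by linarith [hP.T_ge]) (by norm_num)
      have h2 : 1 / 2 ≤ Real.exp (-δ) * (weights P K ℓ x (t + 1)).real F := by
        have h3 := exp_neg_ge hP
        have h4 := one_div_hundred_le hP
        change 1 - 1 / (100 * (n : ℝ)) ≤ Real.exp (-δ) at h3
        have h5 : (99 / 100 : ℝ) ≤ Real.exp (-δ) := by linarith
        have h6 : (99 / 100 : ℝ) ≤ (weights P K ℓ x (t + 1)).real F := by linarith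
        calc (1 / 2 : ℝ) ≤ (99 / 100) * (99 / 100) := by norm_num
          _ ≤ _ := by gcongr
      have h3 : (2 : ℝ≥0∞)⁻¹ ≤ ENNReal.ofReal (Real.exp (-δ)) * weights P K ℓ x (t + 1) F := by
        rw [← ENNReal.ofReal_toReal (measure_ne_top (weights P K ℓ x (t + 1)) F),
          ← ENNReal.ofReal_mul (Real.exp_nonneg _)]
        refine le_trans (le_of_eq ?_) (ENNReal.ofReal_le_ofReal h2)
        rw [one_div, ENNReal.ofReal_inv_of_pos (by norm_num)]; simp
      rw [hp F hFm, inter_eq_left.2 hFG, mul_left_comm] at h3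
      have h4 : Z * 2⁻¹ ≤ Z' := by
        calc Z * 2⁻¹ ≤ Z * (Z⁻¹ * (ENNReal.ofReal (Real.exp (-δ)) * ∫⁻ y in F, w y)) := by gcongr
          _ = ENNReal.ofReal (Real.exp (-δ)) * ∫⁻ y in F, w y := by
            rw [← mul_assoc, ENNReal.mul_inv_cancel hZ0 hZt, one_mul]
          _ ≤ Z' := by
            have := hw3 univ .univ
            simpa using this
      calc Z = 2 * (Z * 2⁻¹) := by
            rw [mul_comm Z, ← mul_assoc, ENNReal.mul_inv_cancel (by norm_num) (by norm_num), one_mul]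
        _ ≤ _ := by gcongr
    refine Measure.le_iff.2 fun B hB => ?_
    rw [Measure.smul_apply, hp _ hB, hq _ hB, smul_eq_mul, ← mul_assoc]
    refine mul_le_mul' ?_ ?_
    · rw [ENNReal.inv_le_iff_inv_le, ENNReal.mul_inv (by simp) (by simp), inv_inv]
      calc 2⁻¹ * Z ≤ 2⁻¹ * (2 * Z') := by gcongr
        _ = Z' := by rw [← mul_assoc, ENNReal.inv_mul_cancel (by norm_num) (by norm_num), one_mul]
    · exact (lintegral_mono hw1).trans (lintegral_mono_set (by gcongr))

end Analysis

end KernelBCO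

namespace KernelBCO

/-! ### The good state persists until a fault or a restart -/

section Induction

variable {n : ℕ} {P : Params} {K : Set (Pt n)} {ℓ : ℕ → Pt n → ℝ} {x : ℕ → Pt n}

theorem inv_pow_eight_mul_le (hP : Tuned P n) {R : ℝ} (hR0 : 0 ≤ R) (hR : R ≤ P.T) :
    R ^ 2 * ((P.T : ℝ) ^ 8)⁻¹ ≤ 1 / (100 * n) := by
  have hT := hP.T_pos
  have hT1 := hP.T_ge
  have hn := hP.one_le_cast
  calc R ^ 2 * ((P.T : ℝ) ^ 8)⁻¹ ≤ (P.T : ℝ) ^ 2 * ((P.T : ℝ) ^ 8)⁻¹ := by gcongr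
    _ = ((P.T : ℝ) ^ 6)⁻¹ := by field_simp
    _ ≤ ((P.T : ℝ))⁻¹ := by
        refine inv_anti₀ hT ?_
        calc (P.T : ℝ) = (P.T : ℝ) ^ 1 := (pow_one _).symm
          _ ≤ _ := pow_le_pow_right₀ (by linarith) (by norm_num)
    _ ≤ 1 / (100 * n) := by
        rw [one_div]; exact inv_anti₀ (by positivity) hP.n_le

/-- In one round the mean moves little and the covariance decreases little. -/
theorem Healthy.comparable (h : IsPath P K ℓ x) (hP : Tuned P n) {t : ℕ} (hT : t + 1 ≤ P.T)
    (hh : Healthy P K ℓ x (t + 1)) :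
    matNorm (covMat (weights P K ℓ x (t + 1)))⁻¹
        (meanOf (weights P K ℓ x (t + 2)) - meanOf (weights P K ℓ x (t + 1))) ≤ 2 ∧
      ∀ v, matNorm (covMat (weights P K ℓ x (t + 2)))⁻¹ v ≤
        (1 + 1 / (8 * n)) * matNorm (covMat (weights P K ℓ x (t + 1)))⁻¹ v := by
  have hPt := hP.toTame
  have hK := h.toIsBody
  have hn := hP.one_le_cast
  obtain ⟨h1, h2⟩ := weights_comparable h hP hT hh.rate_le hh.tail
  refine matNorm_le_mul_of_comparable (R := 40 * n * P.α) (regular_weights hPt hK _)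
    (regular_weights hPt hK _) (isClosed_focus hPt hK _).measurableSet h1 h2 ?_ (by positivity) ?_
  · exact (weights_succ_ae_mem hPt hK t).mono fun y hy => hh.supp hy
  · have h3 := exp_neg_ge hP
    have h4 := measureReal_compl_focus_le hP hK hh.tail
    have h5 : (40 * n * P.α + 2) ^ 2 * (weights P K ℓ x (t + 1)).real (focus P K ℓ x (t + 1))ᶜ ≤
        1 / (100 * n) := by
      have := hP.α_pos
      refine le_trans (mul_le_mul_of_nonneg_left h4 (by positivity))
        (inv_pow_eight_mul_le hP (by positivity) ?_)
      nlinarith [hP.α_le]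
    set u : ℝ := 1 / n
    have hu : 1 / (100 * (n : ℝ)) = u / 100 := by simp only [u]; field_simp
    have hu8 : 1 / (8 * (n : ℝ)) = u / 8 := by simp only [u]; field_simp
    have hu0 : 0 < u := by simp only [u]; positivity
    have hu1 : u ≤ 1 := by simp only [u]; rw [div_le_one (by linarith)]; exact hn
    rw [hu] at h3 h5
    rw [hu8]
    -- The decrease of the density and the mass off the region each cost `u / 100`; the squared
    -- factor `1 + u / 8` gains `u / 4`.
    calc (1 : ℝ) ≤ (1 + u / 4) * (1 - u / 50) := by nlinarith
      _ ≤ (1 + u / 8) ^ 2 * ((1 - u / 100) * (1 - u / 100)) := by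
        have a1 : 1 + u / 4 ≤ (1 + u / 8) ^ 2 := by nlinarith
        have a2 : 1 - u / 50 ≤ (1 - u / 100) * (1 - u / 100) := by nlinarith
        have a3 : 0 ≤ 1 - u / 50 := by linarith
        gcongr
      _ ≤ _ := by
        gcongr
        linarith

/-- The universal bound for the region of a round is radius `10 n α`. One round moves the mean by at
most 2 and increases the norm at most by a factor 2, which stays below `40 n α`. Starting afresh
from the universal bound prevents the radius from growing with the rounds. -/
theorem Healthy.supp_succ (h : IsPath P K ℓ x) (hP : Tuned P n) {t : ℕ} (hT : t + 1 ≤ P.T)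
    (hh : Healthy P K ℓ x (t + 1)) :
    focus P K ℓ x (t + 1) ⊆ ellipsoid (weights P K ℓ x (t + 2)) (40 * n * P.α) := by
  intro y hy
  have hn := hP.one_le_cast
  obtain ⟨h1, h2⟩ := hh.comparable h hP hT
  have h3 := focus_subset_ellipsoid hP.toTame h.toIsBody (by omega) hy
  have hC := (regular_weights (ℓ := ℓ) (x := x) hP.toTame h.toIsBody (t + 1)).posDef
  have h4 := matNorm_sub_le hC (y - meanOf (weights P K ℓ x (t + 1)))
    (meanOf (weights P K ℓ x (t + 2)) - meanOf (weights P K ℓ x (t + 1)))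
  rw [sub_sub_sub_cancel_right] at h4
  change matNorm _ _ ≤ _ at h3
  change matNorm _ _ ≤ _
  have h5 : 1 / (8 * (n : ℝ)) ≤ 1 := by
    rw [div_le_one (by positivity)]; linarith
  have hα := hP.eighty_mul_le
  calc _ ≤ _ := h2 _
    _ ≤ (1 + 1) * (10 * n * P.α + 2) := by
        have := matNorm_nonneg (covMat (weights P K ℓ x (t + 1)))⁻¹
          (y - meanOf (weights P K ℓ x (t + 2)))
        gcongr
        linarith
    _ ≤ _ := by nlinarith

/-- Right after a cut the whole region lies in `𝓔(α)`. The next mean and covariance are nearly the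
same, so the next ellipsoid holds more than half of the region. -/
theorem Healthy.not_cut_succ (h : IsPath P K ℓ x) (hP : Tuned P n) {t : ℕ} (hT : t + 2 ≤ P.T)
    (hh : Healthy P K ℓ x (t + 2)) (hcut : Cut P K ℓ x (t + 2)) : ¬ Cut P K ℓ x (t + 3) := by
  have hPt := hP.toTame
  have hK := h.toIsBody
  have hn := hP.one_le_cast
  have hα := hP.eighty_mul_le
  obtain ⟨h1, h2⟩ := hh.comparable h hP hT
  have hreg := regular_weights (ℓ := ℓ) (x := x) hPt hK (t + 2)
  have hsub : focus P K ℓ x (t + 2) ⊆ ellipsoid (weights P K ℓ x (t + 2)) P.α := by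
    rw [focus_of_cut hcut]; exact inter_subset_right
  have hmean : meanOf (weights P K ℓ x (t + 2)) ∈ focus P K ℓ x (t + 2) := by
    rw [focus_of_cut hcut]
    refine ⟨hreg.meanOf_mem (convex_focus hPt hK _) (isClosed_focus hPt hK _)
      (weights_succ_ae_mem hPt hK (t + 1)), ?_⟩
    change matNorm _ _ ≤ _
    rw [sub_self, matNorm_zero]
    exact hP.α_pos.le
  refine half_volume_lt_of_comparable hP.one_le hreg.posDef (convex_focus hPt hK _)
    (isClosed_focus hPt hK _).measurableSet (volume_focus_ne_zero hPt hK _)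
    (volume_focus_ne_top hK _) hmean hsub (by positivity) h1 h2 ?_
  set u : ℝ := 1 / n
  have hu4 : 1 / (4 * (n : ℝ)) = u / 4 := by simp only [u]; field_simp
  have hu8 : 1 / (8 * (n : ℝ)) = u / 8 := by simp only [u]; field_simp
  have hu0 : 0 < u := by simp only [u]; positivity
  have hun : u * n = 1 := by simp only [u]; field_simp
  have hu1 : u ≤ 1 := by simp only [u]; rw [div_le_one (by linarith)]; exact hn
  have hαu : 80 ≤ P.α * u := by nlinarith
  rw [hu4, hu8]
  -- `(1 + u/8)(1 - u/4) ≤ 1 - u/8`, and `α u / 8 ≥ 10` exceeds the term `2 (1 + u/8)` from the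
  -- shift of the mean.
  nlinarith

theorem hasCopy_self (hK : IsBody K) (hP : Tuned P n) : HasCopy P K K := by
  obtain ⟨y₀, hy⟩ := hK.nonempty_interior
  refine ⟨y₀, fun z hz => ?_⟩
  have hT := hP.T_pos
  have hθ1 : ((P.T : ℝ) ^ 4)⁻¹ ≤ 1 :=
    inv_le_one_of_one_le₀ (one_le_pow₀ (by linarith [hP.T_ge]))
  exact hK.convex.add_smul_sub_mem (interior_subset hy) (interior_subset hz)
    ⟨by positivity, hθ1⟩

/-- Every cut halves the volume, while a copy scaled by `T⁻⁴` keeps the fraction `T ^ (-4n)`, so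
there were at most `log₂ (T ^ (4n))` cuts up to `F_t`. The exponent `k + 1` allows for one more cut,
because the rate is that of round `t + 1`. -/
theorem rate_le_of_hasCopy (h : IsPath P K ℓ x) (hP : Tuned P n) {t : ℕ}
    (hc : HasCopy P K (focus P K ℓ x t)) : rate P K ℓ x (t + 1) ≤ Real.exp 1 * P.η₁ := by
  have hη := hP.η_pos
  have hT := hP.T_pos
  have key : ∀ k : ℕ, (2 : ℝ≥0∞) ^ k * volume (focus P K ℓ x t) ≤ volume K →
      (1 + P.γ) ^ (k + 1) ≤ Real.exp 1 := by
    intro k hk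
    refine hP.growth k ?_
    have h1 := hc.volume_le hP h.convex
    have hK0 := h.toIsBody.volume_ne_zero
    have hKt : volume K ≠ ∞ := h.compact.measure_lt_top.ne
    set θ := (((P.T : ℝ) ^ 4)⁻¹) ^ n
    have hθ : 0 < θ := by positivity
    have h2 : (2 : ℝ≥0∞) ^ k * ENNReal.ofReal θ * volume K ≤ 1 * volume K := by
      rw [one_mul, mul_assoc]; exact (mul_le_mul_right h1 _).trans hk
    have h3 := (ENNReal.mul_le_mul_iff_left hK0 hKt).1 h2
    have e : (2 : ℝ≥0∞) ^ k = ENNReal.ofReal (2 ^ k) := by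
      rw [ENNReal.ofReal_pow (by norm_num)]; simp
    rw [e, ← ENNReal.ofReal_mul (by positivity), ENNReal.ofReal_le_one] at h3
    simp only [θ, inv_pow, ← pow_mul] at h3
    rwa [← div_eq_mul_inv, div_le_one (by positivity)] at h3
  rcases t with _ | t
  · have := key 0 (by simpa using measure_mono (focus_subset 0))
    rw [rate_one]
    have h1 : (1 : ℝ) ≤ Real.exp 1 := Real.one_le_exp zero_le_one
    nlinarith
  · obtain ⟨k, h1, h2⟩ := exists_rate_eq (P := P) (K := K) (ℓ := ℓ) (x := x) t
    have h3 := key k h2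
    have hγ := hP.γ_nonneg
    have h4 : rate P K ℓ x (t + 2) ≤ (1 + P.γ) * rate P K ℓ x (t + 1) := by
      by_cases hcut : Cut P K ℓ x (t + 2)
      · exact (rate_of_cut hcut).le
      · rw [rate_of_not_cut hcut]
        nlinarith [rate_pos (K := K) (ℓ := ℓ) (x := x) hP.toTame (t + 1)]
    refine h4.trans ?_
    rw [h1, ← mul_assoc, ← pow_succ']
    gcongr

/-- Concentration makes the exponent of the weights within 1 of a nonnegative combination of the
convex functions `K[p_s]^* ℓ_s^ext`. The contraction factor in the tail bound is `1 / T`, since the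
exponent is at most of order `T`. Before round 1 the sums are empty. -/
theorem tail_le (h : IsPath P K ℓ x) (hP : Tuned P n) {t : ℕ} (hT : t ≤ P.T)
    (hrate : ∀ s, 1 ≤ s → s ≤ t → rate P K ℓ x s ≤ Real.exp 1 * P.η₁)
    (hconc : 1 ≤ t → Concentrated P K ℓ x t) :
    (weights P K ℓ x (t + 1)).real (ellipsoid (weights P K ℓ x (t + 1)) P.α)ᶜ ≤
      ((P.T : ℝ) ^ 8)⁻¹ := by
  have hPt := hP.toTame
  have hK := h.toIsBody
  have hη := hP.η_pos
  have hT0 := hP.T_pos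
  have hT1 := hP.T_ge
  refine le_trans ?_ hP.tail
  have hE : 0 ≤ Real.exp 1 * P.η₁ * 2 := by positivity
  refine measure_compl_ellipsoid_le_of_approx_convex (F := focus P K ℓ x t)
    (S := energy P K ℓ x t)
    (g := fun y => ∑ s ∈ Finset.Icc 1 t, rate P K ℓ x s * adjExt P K ℓ x s y)
    (V := P.T * (Real.exp 1 * P.η₁ * 2))
    hP.one_le (regular_weights hPt hK _)
    (convex_focus hPt hK _) (isClosed_focus hPt hK _).measurableSet (volume_focus_ne_zero hPt hK _)
    (volume_focus_ne_top hK _) (weights_succ hPt hK t) ?_ ?_ ?_ (by positivity)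
    (inv_lt_one_of_one_lt₀ (by linarith)) ?_ hP.α_ge
  · exact (convexOn_sum_adjExt h hPt hT fun s => (rate_pos hPt s).le).subset (focus_subset t)
      (convex_focus hPt hK _)
  · intro y hy
    rcases t with _ | t
    · simp [energy]
    · exact (hconc (by omega)).dev₃_le hy
  · intro y hy
    refine ⟨energy_nonneg hPt _ _, ?_⟩
    calc energy P K ℓ x t y ≤ ∑ _ ∈ Finset.Icc 1 t, Real.exp 1 * P.η₁ * 2 := by
          refine Finset.sum_le_sum fun s hs => ?_
          obtain ⟨a, b⟩ := Finset.mem_Icc.1 hs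
          have h1 := h.psiAt_le_two hPt a (b.trans hT) (focus_anti b hy)
          have h2 : 0 ≤ psiAt P K ℓ x s y := psi_nonneg _ _ _ _
          have h3 := hrate s a b
          gcongr
      _ = t * (Real.exp 1 * P.η₁ * 2) := by simp
      _ ≤ _ := by gcongr
  · rw [inv_mul_le_iff₀ hT0, mul_one]
    exact hP.energy_le

theorem healthy_one (h : IsPath P K ℓ x) (hP : Tuned P n) : Healthy P K ℓ x 1 where
  rate_le := rate_le_of_hasCopy h hP (t := 0) (hasCopy_self h.toIsBody hP)
  copy := hasCopy_self h.toIsBody hP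
  supp := by
    have hn := hP.one_le_cast
    have hα := hP.α_pos
    refine (focus_subset_ellipsoid (ℓ := ℓ) (x := x) hP.toTame h.toIsBody le_rfl).trans
      (ellipsoid_mono ?_)
    nlinarith
  tail := tail_le h hP (t := 0) (by omega) (by intro s a b; omega) (by omega)

/-- Before a fault and before a restart the algorithm is healthy. -/
theorem healthy_of_forall_lt (h : IsPath P K ℓ x) (hP : Tuned P n) {t : ℕ} (h1 : 1 ≤ t)
    (hT : t ≤ P.T) (hgood : ∀ s, 1 ≤ s → s < t → Concentrated P K ℓ x s ∧ ¬ Restarts P K ℓ x s) :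
    Healthy P K ℓ x t := by
  induction t using Nat.strong_induction_on with
  | _ t ih =>
    have ih' : ∀ s, 1 ≤ s → s < t → Healthy P K ℓ x s := fun s hs hst =>
      ih s hst hs (by omega) fun r hr hrs => hgood r hr (by omega)
    obtain rfl | ⟨t, rfl⟩ : t = 1 ∨ ∃ u, t = u + 2 := by
      rcases eq_or_ne t 1 with h | h
      · exact Or.inl h
      · exact Or.inr ⟨t - 2, by omega⟩
    · exact healthy_one h hP
    have hh := ih' (t + 1) (by omega) (by omega)
    have hcopy : HasCopy P K (focus P K ℓ x (t + 1)) := by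
      rcases t with _ | t
      · exact hasCopy_self h.toIsBody hP
      -- The restart condition of round `s` concerns `∂F_{s+1}`, but concentration concerns `F_s`,
      -- so a round with `F_{s+1} = F_s` is required. If the candidate round cuts, the previous one
      -- did not, and `F_{t+2} = F_{t+1}` already has the copy.
      by_cases hcut : Cut P K ℓ x (t + 3)
      · have hnc : ¬ Cut P K ℓ x (t + 2) := fun hc =>
          hh.not_cut_succ h hP (by omega) hc hcut
        obtain ⟨a, b⟩ := hgood (t + 1) (by omega) (by omega)
        have := hasCopy_of_not_restarts h hP (s := t + 1) (by omega) (by omega)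
          (focus_of_not_cut hnc) b a
        rwa [focus_of_not_cut hnc]
      · obtain ⟨a, b⟩ := hgood (t + 2) (by omega) (by omega)
        exact hasCopy_of_not_restarts h hP (s := t + 2) (by omega) (by omega)
          (focus_of_not_cut hcut) b a
    exact ⟨rate_le_of_hasCopy h hP hcopy, hcopy, hh.supp_succ h hP (by omega),
      tail_le h hP (by omega) (fun s a b => (ih' s a (by omega)).rate_le)
        fun _ => (hgood (t + 1) (by omega) (by omega)).1⟩

end Induction

end KernelBCO

namespace KernelBCO

/-! ### Bias, regularity and means of the estimates in the good state -/

section Estimates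

variable {n : ℕ} {P : Params} {K : Set (Pt n)} {ℓ : ℕ → Pt n → ℝ} {x : ℕ → Pt n} {t : ℕ}

theorem Healthy.ae_mem_ellipsoid (h : IsPath P K ℓ x) (hP : Tame P n) (h1 : 1 ≤ t)
    (hh : Healthy P K ℓ x t) :
    ∀ᵐ y ∂(weights P K ℓ x t), y ∈ ellipsoid (weights P K ℓ x t) (40 * n * P.α) := by
  obtain ⟨t, rfl⟩ := Nat.exists_eq_add_of_le' h1
  exact (weights_succ_ae_mem hP h.toIsBody t).mono fun y hy => hh.supp hy

theorem Healthy.ellipsoid_subset_interior (h : IsPath P K ℓ x) (hP : Tuned P n) (h1 : 1 ≤ t)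
    (hh : Healthy P K ℓ x t) :
    ellipsoid (weights P K ℓ x t) (10 * n * P.α * P.lam + 20 * √P.lam * P.ε) ⊆ interior K := by
  have hα := hP.α_pos
  exact KernelBCO.ellipsoid_subset_interior (regular_weights hP.toTame h.toIsBody t) h.convex
    h.nonempty_interior (h.carriedBy hP.toTame t).ae_mem (by positivity)
    (hh.ae_mem_ellipsoid h hP.toTame h1) hP.small_radius

theorem Tuned.lam_mul_le (hP : Tuned P n) :
    P.lam * (10 * n * P.α) ≤ 10 * n * P.α * P.lam + 20 * √P.lam * P.ε := by
  have := hP.ε_nonneg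
  have : 0 ≤ 20 * √P.lam * P.ε := by positivity
  linarith

theorem Tuned.radius_sub (P : Params) (n : ℕ) : 10 * n * P.α * P.lam + 20 * √P.lam * P.ε -
    P.lam * (10 * n * P.α) = 20 * √P.lam * P.ε := by ring

/-- Before a fault a point drawn from the kernel law is typical with high probability. -/
theorem Healthy.kernelLaw_compl_typicalAt_le (h : IsPath P K ℓ x) (hP : Tuned P n) (h1 : 1 ≤ t)
    (hh : Healthy P K ℓ x t) :
    (kernelLaw P (weights P K ℓ x t) (weights P K ℓ x t)).real (typicalAt P K ℓ x t)ᶜ ≤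
      ((P.T : ℝ) ^ 4)⁻¹ := by
  have hprob := (regular_weights (ℓ := ℓ) (x := x) hP.toTame h.toIsBody t).prob
  have hα := hP.α_pos
  have hn := hP.one_le_cast
  have hT := hP.T_pos
  have hT1 := hP.T_ge
  have h2 := (h.carriedBy hP.toTame t).kernelLaw_real_compl_le hP.toProper hP.lam_mul_le
    (hh.ellipsoid_subset_interior h hP h1)
  rw [Tuned.radius_sub] at h2
  have h3 : (weights P K ℓ x t).real (ellipsoid (weights P K ℓ x t) (10 * n * P.α))ᶜ ≤
      ((P.T : ℝ) ^ 8)⁻¹ := by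
    refine le_trans (measureReal_mono (compl_subset_compl.2 (ellipsoid_mono ?_))) hh.tail
    nlinarith
  have h4 := hP.gauss_tail
  have e8 : ((P.T : ℝ) ^ 8)⁻¹ ≤ ((P.T : ℝ) ^ 5)⁻¹ :=
    inv_anti₀ (by positivity) (pow_le_pow_right₀ (by linarith) (by norm_num))
  have e10 : ((P.T : ℝ) ^ 10)⁻¹ ≤ ((P.T : ℝ) ^ 5)⁻¹ :=
    inv_anti₀ (by positivity) (pow_le_pow_right₀ (by linarith) (by norm_num))
  have e5 : 2 * ((P.T : ℝ) ^ 5)⁻¹ ≤ ((P.T : ℝ) ^ 4)⁻¹ := by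
    rw [← div_eq_mul_inv, div_le_iff₀ (by positivity)]
    have : ((P.T : ℝ) ^ 4)⁻¹ * (P.T : ℝ) ^ 5 = P.T := by field_simp
    linarith
  exact h2.trans (by linarith)

/-- Before a fault the truncation of the loss to the typical points has a small bias. -/
theorem Healthy.abs_adjTypical_sub_adjExt_le (h : IsPath P K ℓ x) (hP : Tuned P n) (h1 : 1 ≤ t)
    (hT : t ≤ P.T) (hh : Healthy P K ℓ x t) {y : Pt n} (hy : y ∈ focus P K ℓ x t) :
    |adjTypical P K ℓ x t y - adjExt P K ℓ x t y| ≤ 1 / P.T := by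
  have hT0 := hP.T_pos
  have hT1 := hP.T_ge
  have h2 := (h.carriedBy hP.toTame t).abs_kernelAdjoint_sub_le hP.toProper (h.loss t h1 hT)
    hP.lam_mul_le (hh.ellipsoid_subset_interior h hP h1) (focus_subset t hy)
    (focus_subset_ellipsoid hP.toTame h.toIsBody h1 hy)
  rw [Tuned.radius_sub, mul_assoc (1 + ((P.T : ℝ≥0) : ℝ) * (P.T : ℝ) / √(sharpness P n))] at h2
  have h3 : 1 + ((P.T : ℝ≥0) : ℝ) * (P.T : ℝ) / √(sharpness P n) ≤ 2 * (P.T : ℝ) ^ 2 := by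
    have h4 : ((P.T : ℝ≥0) : ℝ) * (P.T : ℝ) / √(sharpness P n) ≤ (P.T : ℝ) ^ 2 := by
      rw [NNReal.coe_natCast, ← sq]
      exact div_le_self (by positivity) (Real.one_le_sqrt.2 hP.sharp_ge)
    nlinarith
  refine h2.trans ?_
  calc _ ≤ 2 * (P.T : ℝ) ^ 2 * ((P.T : ℝ) ^ 10)⁻¹ := by
        gcongr
        exact hP.gauss_tail
    _ = 2 / (P.T : ℝ) ^ 8 := by field_simp
    _ ≤ 1 / P.T := by
        rw [div_le_div_iff₀ (by positivity) hT0]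
        have : (P.T : ℝ) ^ 2 ≤ (P.T : ℝ) ^ 8 := pow_le_pow_right₀ (by linarith) (by norm_num)
        nlinarith

/-- The region contains a ball of radius `T⁻⁴` and lies in an ellipsoid of radius `40 n α`. Since
`80 n α ≤ T`, a vector of length below `T⁻⁴` has norm at most `T`; scaling gives the bound. -/
theorem Healthy.matNorm_le (h : IsPath P K ℓ x) (hP : Tuned P n) (hh : Healthy P K ℓ x t)
    {v : Pt n} (hv : ‖v‖ ≤ ((P.T : ℝ) ^ 7)⁻¹) :
    matNorm (covMat (weights P K ℓ x t))⁻¹ v ≤ 2 / (P.T : ℝ) ^ 2 := by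
  have hT := hP.T_pos
  have hC := (regular_weights (ℓ := ℓ) (x := x) hP.toTame h.toIsBody t).posDef
  obtain ⟨c, hc⟩ := hh.copy.exists_ball h hP
  have hs : (0 : ℝ) < P.T ^ 3 / 2 := by positivity
  have h1 := hh.supp (hc ((P.T ^ 3 / 2 : ℝ) • v) (by
    rw [norm_smul, Real.norm_of_nonneg hs.le]
    calc (P.T : ℝ) ^ 3 / 2 * ‖v‖ ≤ (P.T : ℝ) ^ 3 / 2 * ((P.T : ℝ) ^ 7)⁻¹ := by gcongr
      _ = ((P.T : ℝ) ^ 4)⁻¹ / 2 := by field_simp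
      _ < _ := half_lt_self (by positivity)))
  have h2 := hh.supp (hc 0 (by rw [norm_zero]; positivity))
  change matNorm _ _ ≤ _ at h1 h2
  have h3 := matNorm_sub_le hC (c + (P.T ^ 3 / 2 : ℝ) • v - meanOf (weights P K ℓ x t))
    (c + 0 - meanOf (weights P K ℓ x t))
  rw [sub_sub_sub_cancel_right, add_sub_add_left_eq_sub, sub_zero, matNorm_smul,
    abs_of_pos hs] at h3
  have h4 : (P.T : ℝ) ^ 3 / 2 * matNorm (covMat (weights P K ℓ x t))⁻¹ v ≤ P.T := by
    linarith [hP.α_le]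
  rw [le_div_iff₀ (by positivity)]
  have e : (P.T : ℝ) ^ 3 / 2 * matNorm (covMat (weights P K ℓ x t))⁻¹ v =
    P.T * (matNorm (covMat (weights P K ℓ x t))⁻¹ v * P.T ^ 2) / 2 := by ring
  rw [e] at h4
  nlinarith

theorem psi_of_mem_typical (hP : Tame P n) {p : Measure (Pt n)} (hp : Regular p) {z y : Pt n} {v : ℝ}
    (hv : 0 ≤ v) (hz : z ∈ typical P K p) :
    psi P K p z v y = v * kernel P p z y / kernelDensity P p p z := by
  rw [psi, indicator_of_mem hz, mul_one, max_eq_left, div_mul_eq_mul_div]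
  have := kernelDensity_pos hP.toProper hp z
  have := kernel_nonneg (p := p) hP.toProper z y
  positivity

theorem psi_of_notMem_typical {p : Measure (Pt n)} {z y : Pt n} {v : ℝ}
    (hz : z ∉ typical P K p) : psi P K p z v y = 0 := by
  rw [psi, indicator_of_notMem hz]; simp

/-- The left side bounds the Lipschitz constant of the logarithm of the kernel in its second
argument, for typical first argument. -/
theorem sharpness_mul_le (hP : Tame P n) : sharpness P n * (P.lam *
    (2 * (10 * n * P.α * P.lam + 20 * √P.lam * P.ε) + 2 * P.lam * (20 * n * P.α))) ≤ 1 := by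
  have h1 := hP.ratio
  have hα := hP.eighty_mul_le
  have hn := hP.one_le_cast
  have hb := hP.sharpness_pos
  have hl := hP.lam_pos
  have hr := hP.radius_nonneg
  have hα0 := hP.α_pos
  set r := 10 * n * P.α * P.lam + 20 * √P.lam * P.ε
  have h2 : sharpness P n * (P.lam * (2 * r + 2 * P.lam * (20 * n * P.α))) * 1 ≤
    sharpness P n * (P.lam * (2 * r + 2 * P.lam * (20 * n * P.α))) * (2 * (20 * n * P.α)) := by
    gcongr
    nlinarith
  refine le_trans (by linarith) (h2.trans ((le_of_eq ?_).trans (h1.trans (by norm_num))))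
  ring

/-- The loss estimates of a round before a fault vary little at a small scale. -/
theorem Healthy.psi_close (h : IsPath P K ℓ x) (hP : Tuned P n) (h1 : 1 ≤ t)
    (hh : Healthy P K ℓ x t) {y y' z : Pt n} (hy : y ∈ focus P K ℓ x t)
    (hyy' : ‖y - y'‖ ≤ ((P.T : ℝ) ^ 7)⁻¹) {v : ℝ} (hv : v ∈ Icc (0 : ℝ) 1) :
    psi P K (weights P K ℓ x t) z v y' ≤ 2 ∧
    |psi P K (weights P K ℓ x t) z v y - psi P K (weights P K ℓ x t) z v y'| ≤ 1 / P.T := by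
  have hPt := hP.toTame
  have hT := hP.T_pos
  have hT1 := hP.T_ge
  have hn := hP.one_le_cast
  have hα := hP.α_pos
  have hα1 := hP.eighty_mul_le
  set p := weights P K ℓ x t
  have hreg : Regular p := regular_weights hPt h.toIsBody t
  have hC := hreg.posDef
  have hN := hh.matNorm_le h hP hyy'
  set δ : ℝ := 2 / (P.T : ℝ) ^ 2
  have hδ0 : 0 < δ := by positivity
  have hδ1 : δ ≤ 1 / (250 * P.T) := by
    simp only [δ]; rw [div_le_div_iff₀ (by positivity) (by positivity)]; nlinarith
  have hδ2 : δ ≤ 1 := hδ1.trans (by rw [div_le_one (by positivity)]; linarith)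
  have hyE : matNorm (covMat p)⁻¹ (y - meanOf p) ≤ 10 * n * P.α :=
    focus_subset_ellipsoid hPt h.toIsBody h1 hy
  have hyE' : matNorm (covMat p)⁻¹ (y' - meanOf p) ≤ 20 * n * P.α := by
    have := matNorm_sub_le hC (y - meanOf p) (y - y')
    rw [show y - meanOf p - (y - y') = y' - meanOf p by abel] at this
    nlinarith
  have hyE2 : matNorm (covMat p)⁻¹ (y - meanOf p) ≤ 20 * n * P.α := hyE.trans (by nlinarith)
  refine ⟨psi_le_two hPt hreg hv hyE', ?_⟩
  by_cases hz : z ∈ typical P K p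
  swap
  · rw [psi_of_notMem_typical hz, psi_of_notMem_typical hz]; simp
  have hb := hP.sharpness_pos
  have hl := hP.lam_pos
  have hr := hP.radius_nonneg
  have hs := sharpness_mul_le hPt
  set r := 10 * n * P.α * P.lam + 20 * √P.lam * P.ε
  have hs0 : 0 ≤ sharpness P n * (P.lam * (2 * r + 2 * P.lam * (20 * n * P.α))) := by positivity
  have hkey : ∀ w : Pt n, matNorm (covMat p)⁻¹ w ≤ δ → sharpness P n *
      (P.lam * matNorm (covMat p)⁻¹ w * (2 * r + 2 * P.lam * (20 * n * P.α))) ≤ δ := by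
    intro w hw
    have e : sharpness P n * (P.lam * matNorm (covMat p)⁻¹ w * (2 * r + 2 * P.lam * (20 * n * P.α)))
        = sharpness P n * (P.lam * (2 * r + 2 * P.lam * (20 * n * P.α))) *
          matNorm (covMat p)⁻¹ w := by ring
    rw [e]
    have := matNorm_nonneg (covMat p)⁻¹ w
    nlinarith
  have k1 := kernel_le_exp_mul hP.toProper hC hz.2 hyE2 hyE' (hkey _ hN)
  have k2 := kernel_le_exp_mul hP.toProper hC hz.2 hyE' hyE2
    (hkey _ (by rw [matNorm_sub_comm]; exact hN))
  have hexp : Real.exp δ ≤ 1 + 2 * δ := by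
    have := Real.abs_exp_sub_one_sub_id_le (x := δ) (by rw [abs_of_pos hδ0]; exact hδ2)
    have := (abs_le.1 this).2
    nlinarith
  have b1 := psi_le_two (K := K) hPt hreg (z := z) hv hyE'
  have b2 := psi_le_two (K := K) hPt hreg (z := z) hv hyE2
  have hd := kernelDensity_pos hP.toProper hreg z
  have step : ∀ a b : Pt n, kernel P p z b ≤ Real.exp δ * kernel P p z a →
      psi P K p z v a ≤ 2 → psi P K p z v b - psi P K p z v a ≤ 1 / P.T := by
    intro a b hab ha
    have h2 : psi P K p z v b ≤ Real.exp δ * psi P K p z v a := by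
      rw [psi_of_mem_typical hPt hreg hv.1 hz, psi_of_mem_typical hPt hreg hv.1 hz,
        ← mul_div_assoc, ← mul_left_comm]
      have := hv.1
      gcongr
    have h3 := psi_nonneg (P := P) (K := K) p z v a
    have h4 : Real.exp δ * psi P K p z v a ≤ (1 + 2 * δ) * psi P K p z v a := by gcongr
    have h5 : 4 * δ ≤ 1 / P.T := by
      calc 4 * δ ≤ 4 * (1 / (250 * P.T)) := by gcongr
        _ ≤ 1 / P.T := by
          rw [mul_one_div, div_le_div_iff₀ (by positivity) hT]; nlinarith
    nlinarith
  exact abs_le.2 ⟨by linarith [step y y' k1 b2], step y' y k2 b1⟩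

theorem measurableSet_typical (hK : IsClosed K) (p : Measure (Pt n)) :
    MeasurableSet (typical P K p) :=
  hK.measurableSet.inter (isClosed_ellipsoid _ _).measurableSet

theorem measurable_indicator_loss {L : ℝ≥0} {f : Pt n → ℝ} (hf : IsLoss K L f) (hK : IsClosed K)
    (p : Measure (Pt n)) : Measurable ((typical P K p).indicator f) := by
  refine measurable_of_restrict_of_restrict_compl (measurableSet_typical (P := P) hK p) ?_ ?_
  · have : ContinuousOn f (typical P K p) := hf.lip.continuousOn.mono inter_subset_left
    convert this.domRestrict.measurable using 1
    ext z
    simp [z.2]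
  · convert measurable_const (a := (0 : ℝ)) using 1
    ext z
    exact indicator_of_notMem z.2 _

theorem indicator_loss_mem {L : ℝ≥0} {f : Pt n → ℝ} (hf : IsLoss K L f) (p : Measure (Pt n))
    (z : Pt n) : (typical P K p).indicator f z ∈ Icc (0 : ℝ) 1 := by
  by_cases hz : z ∈ typical P K p
  · rw [indicator_of_mem hz]; exact hf.maps hz.1
  · rw [indicator_of_notMem hz]; simp

theorem psi_eq (hP : Tame P n) {p : Measure (Pt n)} (hp : Regular p) {L : ℝ≥0} {f : Pt n → ℝ}
    (hf : IsLoss K L f) (z y : Pt n) : psi P K p z (f z) y =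
      (typical P K p).indicator f z * kernel P p z y / kernelDensity P p p z := by
  by_cases hz : z ∈ typical P K p
  · rw [psi_of_mem_typical hP hp (hf.maps hz.1).1 hz, indicator_of_mem hz]
  · rw [psi_of_notMem_typical hz, indicator_of_notMem hz]; simp

/-- Importance weighting: the sampling density cancels the denominator of the estimate. This makes
the estimate unbiased for the loss truncated to typical points, at every `y`. -/
theorem integral_psi (hP : Tame P n) {p : Measure (Pt n)} (hp : Regular p) {L : ℝ≥0} {f : Pt n → ℝ}
    (hf : IsLoss K L f) (y : Pt n) :
    ∫ z, psi P K p z (f z) y ∂(kernelLaw P p p) =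
      kernelAdjoint P p ((typical P K p).indicator f) y := by
  rw [integral_kernelLaw hP.toProper hp, kernelAdjoint]
  refine integral_congr_ae (Filter.Eventually.of_forall fun z => ?_)
  have := kernelDensity_pos hP.toProper hp z
  simp only [psi_eq hP hp hf]
  field_simp

theorem measurable_psi (hP : Tame P n) (hK : IsClosed K) {p : Measure (Pt n)} (hp : Regular p)
    {L : ℝ≥0} {f : Pt n → ℝ} (hf : IsLoss K L f) :
    Measurable fun q : Pt n × Pt n => psi P K p q.1 (f q.1) q.2 := by
  simp only [psi_eq hP hp hf]
  have h1 := (measurable_indicator_loss (P := P) hf hK p).comp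
    (measurable_fst : Measurable (Prod.fst : Pt n × Pt n → Pt n))
  have h2 := (measurable_kernelDensity hP.toProper hp).comp
    (measurable_fst : Measurable (Prod.fst : Pt n × Pt n → Pt n))
  have h3 := (continuous_kernel (p := p) hP.toProper).measurable
  exact (h1.mul h3).div h2

theorem setIntegral_kernelAdjoint (hP : Tame P n) (hK : IsClosed K) {p : Measure (Pt n)}
    (hp : Regular p) {L : ℝ≥0} {f : Pt n → ℝ} (hf : IsLoss K L f)
    {F : Set (Pt n)} (hF : MeasurableSet F) (hFE : F ⊆ ellipsoid p (20 * n * P.α)) :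
    ∫ y in F, kernelAdjoint P p ((typical P K p).indicator f) y ∂p =
      ∫ z, (∫ y in F, psi P K p z (f z) y ∂p) ∂(kernelLaw P p p) := by
  have := hp.prob
  have := isProbabilityMeasure_kernelLaw hP.toProper hp
  simp only [← integral_psi hP hp hf]
  refine integral_integral_swap (f := fun y z => psi P K p z (f z) y) ?_
  refine Integrable.of_bound (C := 2)
    ((measurable_psi hP hK hp hf).comp measurable_swap).aestronglyMeasurable ?_
  have h1 : ∀ᵐ y ∂(p.restrict F), y ∈ F := ae_restrict_mem hF
  filter_upwards [Measure.quasiMeasurePreserving_fst.ae h1] with q hq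
  have h2 := psi_nonneg (P := P) (K := K) p q.2 (f q.2) q.1
  simp only [Function.uncurry]
  rw [Real.norm_of_nonneg h2]
  by_cases hz : q.2 ∈ typical P K p
  · exact psi_le_two hP hp (hf.maps hz.1) (hFE hq)
  · rw [psi_of_notMem_typical hz]; norm_num

theorem integral_kernelAdjoint_indicator (hP : Tame P n) (hK : IsClosed K) {p : Measure (Pt n)}
    (hp : Regular p) {L : ℝ≥0} {f : Pt n → ℝ} (hf : IsLoss K L f) :
    ∫ y, kernelAdjoint P p ((typical P K p).indicator f) y ∂p =
      ∫ z, (typical P K p).indicator f z ∂(kernelLaw P p p) := by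
  have hprob := hp.prob
  have := isProbabilityMeasure_kernelLaw hP.toProper hp
  set g := (typical P K p).indicator f
  have hg : Measurable g := measurable_indicator_loss hf hK p
  have hg0 : ∀ z, 0 ≤ g z := fun z => (indicator_loss_mem hf p z).1
  have hm : Measurable fun q : Pt n × Pt n => g q.1 * kernel P p q.1 q.2 :=
    (hg.comp measurable_fst).mul (continuous_kernel (p := p) hP.toProper).measurable
  have hk : ∀ y, Integrable fun z => g z * kernel P p z y := fun y =>
    (integrable_kernel hP.toProper hp.posDef y).bdd_mul (c := 1) hg.aestronglyMeasurable
      (Filter.Eventually.of_forall fun z => by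
        rw [Real.norm_of_nonneg (hg0 z)]; exact (indicator_loss_mem hf p z).2)
  have hn0 : ∀ y, 0 ≤ kernelAdjoint P p g y := fun y =>
    integral_nonneg fun z => mul_nonneg (hg0 z) (kernel_nonneg hP.toProper _ _)
  have hmA : Measurable fun y => kernelAdjoint P p g y :=
    (hm.stronglyMeasurable.integral_prod_left (μ := volume)).measurable
  rw [integral_eq_lintegral_of_nonneg_ae (Filter.Eventually.of_forall hn0) hmA.aestronglyMeasurable,
    integral_eq_lintegral_of_nonneg_ae (Filter.Eventually.of_forall hg0) hg.aestronglyMeasurable,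
    lintegral_kernelLaw hP.toProper hp hg.ennreal_ofReal]
  congr 1
  refine lintegral_congr fun y => ?_
  rw [kernelAdjoint, ofReal_integral_eq_lintegral_ofReal (hk y)
    (Filter.Eventually.of_forall fun z => mul_nonneg (hg0 z) (kernel_nonneg hP.toProper _ _))]
  refine lintegral_congr fun z => ?_
  rw [ENNReal.ofReal_mul (hg0 z)]

end Estimates

end KernelBCO

namespace KernelBCO

/-! ### Measurable dependence of the state on the outcome -/

section Measurability

variable {n : ℕ} {P : Params} {K : Set (Pt n)} {Ω : Type*} [MeasurableSpace Ω]

theorem measurable_det {A : Ω → Matrix (Fin n) (Fin n) ℝ} (hA : ∀ i j, Measurable fun ω => A ω i j) :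
    Measurable fun ω => (A ω).det := by
  simp only [Matrix.det_apply']
  exact Finset.measurable_fun_sum _ fun σ _ =>
    (Finset.measurable_fun_prod _ fun i _ => hA _ _).const_mul _

/-- By Cramer's rule the entries of the inverse are quotients of determinants; the convention for
singular matrices agrees with that for real inversion at zero. -/
theorem measurable_matNorm_inv {A : Ω → Matrix (Fin n) (Fin n) ℝ}
    (hA : ∀ i j, Measurable fun ω => A ω i j) {v : Ω → Pt n} (hv : Measurable v) :
    Measurable fun ω => matNorm (A ω)⁻¹ (v ω) := by
  have hvi : ∀ i, Measurable fun ω => v ω i := fun i =>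
    (EuclideanSpace.proj (𝕜 := ℝ) i).continuous.measurable.comp hv
  have hinv : ∀ i j, Measurable fun ω => (A ω)⁻¹ i j := by
    intro i j
    simp only [Matrix.inv_def, Ring.inverse_eq_inv', Matrix.smul_apply, smul_eq_mul,
      Matrix.adjugate_apply]
    refine (measurable_det hA).inv.mul (measurable_det fun k l => ?_)
    simp only [Matrix.updateRow_apply]
    split_ifs
    · exact measurable_const
    · exact hA _ _
  simp only [matNorm, dotProduct, Matrix.mulVec]
  exact (Finset.measurable_fun_sum _ fun i _ => (hvi i).mul
    (Finset.measurable_fun_sum _ fun j _ => (hinv i j).mul (hvi j))).sqrt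

theorem measurable_integral_of_measurable {E : Type*} [NormedAddCommGroup E] [NormedSpace ℝ E]
    [MeasurableSpace E] [BorelSpace E] [SecondCountableTopology E]
    {p : Ω → Measure (Pt n)} (hp : Measurable p)
    (hprob : ∀ ω, IsProbabilityMeasure (p ω)) {f : Ω → Pt n → E}
    (hf : Measurable (Function.uncurry f)) : Measurable fun ω => ∫ y, f ω y ∂(p ω) := by
  let κ : Kernel Ω (Pt n) := ⟨p, hp⟩
  have : IsMarkovKernel κ := ⟨hprob⟩
  exact (hf.stronglyMeasurable.integral_kernel_prod_right (κ := κ)).measurable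

theorem measurable_meanOf {p : Ω → Measure (Pt n)} (hp : Measurable p)
    (hprob : ∀ ω, IsProbabilityMeasure (p ω)) : Measurable fun ω => meanOf (p ω) :=
  measurable_integral_of_measurable hp hprob measurable_snd

theorem measurable_covMat {p : Ω → Measure (Pt n)} (hp : Measurable p)
    (hprob : ∀ ω, IsProbabilityMeasure (p ω)) (i j : Fin n) :
    Measurable fun ω => covMat (p ω) i j := by
  simp only [covMat, Matrix.of_apply, covariance]
  have hc : ∀ i : Fin n, Measurable fun y : Pt n => y i := fun i =>
    (EuclideanSpace.proj (𝕜 := ℝ) i).continuous.measurable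
  have hm : ∀ i : Fin n, Measurable fun ω => ∫ y : Pt n, y i ∂(p ω) := fun i =>
    measurable_integral_of_measurable hp hprob ((hc i).comp measurable_snd)
  exact measurable_integral_of_measurable hp hprob
    ((((hc i).comp measurable_snd).sub ((hm i).comp measurable_fst)).mul
      (((hc j).comp measurable_snd).sub ((hm j).comp measurable_fst)))

theorem measurableSet_ellipsoid {p : Ω → Measure (Pt n)} (hp : Measurable p)
    (hprob : ∀ ω, IsProbabilityMeasure (p ω)) {x : Ω → Pt n} (hx : Measurable x) (r : ℝ) :
    MeasurableSet {ω | x ω ∈ ellipsoid (p ω) r} :=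
  measurableSet_le (measurable_matNorm_inv (measurable_covMat hp hprob)
    (hx.sub (measurable_meanOf hp hprob))) measurable_const

theorem measurableSet_mem_typical (hK : MeasurableSet K) {p : Ω → Measure (Pt n)} (hp : Measurable p)
    (hprob : ∀ ω, IsProbabilityMeasure (p ω)) {x : Ω → Pt n} (hx : Measurable x) :
    MeasurableSet {ω | x ω ∈ typical P K (p ω)} :=
  (hx hK).inter (measurableSet_ellipsoid hp hprob hx _)

theorem measurable_kernel {p : Ω → Measure (Pt n)} (hp : Measurable p)
    (hprob : ∀ ω, IsProbabilityMeasure (p ω)) {x y : Ω → Pt n} (hx : Measurable x)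
    (hy : Measurable y) : Measurable fun ω => kernel P (p ω) (x ω) (y ω) := by
  have hC : ∀ (c : ℝ) i j, Measurable fun ω => (c • covMat (p ω)) i j := fun c i j =>
    (measurable_covMat hp hprob i j).const_mul c
  have hm := measurable_meanOf hp hprob
  unfold kernel coreDensity gaussianDensity
  refine Measurable.mul_const (Measurable.mul ?_ ?_) _
  · exact ((measurable_det (hC _)).const_mul _).sqrt.inv
  · refine (Measurable.neg ?_ |>.div_const _).exp
    refine (measurable_matNorm_inv (hC _) ?_).pow_const 2
    exact ((hx.sub (hy.const_smul P.lam)).const_smul (1 - P.lam)⁻¹).sub hm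

theorem measurable_kernelDensity_comp {p : Ω → Measure (Pt n)} (hp : Measurable p)
    (hprob : ∀ ω, IsProbabilityMeasure (p ω)) {x : Ω → Pt n} (hx : Measurable x) :
    Measurable fun ω => kernelDensity P (p ω) (p ω) (x ω) :=
  measurable_integral_of_measurable hp hprob
    (measurable_kernel (hp.comp measurable_fst) (fun q => hprob q.1) (hx.comp measurable_fst)
      measurable_snd)

theorem measurable_kernelLaw {p : Ω → Measure (Pt n)} (hp : Measurable p)
    (hprob : ∀ ω, IsProbabilityMeasure (p ω)) :
    Measurable fun ω => kernelLaw P (p ω) (p ω) := by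
  have hm : Measurable fun q : Ω × Pt n => kernelDensity P (p q.1) (p q.1) q.2 :=
    measurable_kernelDensity_comp (hp.comp measurable_fst) (fun q => hprob q.1) measurable_snd
  refine Measure.measurable_of_measurable_coe _ fun B hB => ?_
  simp only [kernelLaw, withDensity_apply _ hB]
  exact hm.ennreal_ofReal.lintegral_prod_right'

theorem measurable_indicator_typical (hK : MeasurableSet K) {p : Ω → Measure (Pt n)}
    (hp : Measurable p) (hprob : ∀ ω, IsProbabilityMeasure (p ω)) {x : Ω → Pt n} {v : Ω → ℝ}
    (hx : Measurable x) (hv : Measurable v) :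
    Measurable fun ω => (typical P K (p ω)).indicator (fun _ => v ω) (x ω) := by
  classical
  simp only [indicator_apply]
  exact Measurable.ite (measurableSet_mem_typical hK hp hprob hx) hv measurable_const

theorem measurable_psi_comp (hK : MeasurableSet K) {p : Ω → Measure (Pt n)} (hp : Measurable p)
    (hprob : ∀ ω, IsProbabilityMeasure (p ω)) {x y : Ω → Pt n} {v : Ω → ℝ} (hx : Measurable x)
    (hy : Measurable y) (hv : Measurable v) :
    Measurable fun ω => psi P K (p ω) (x ω) (v ω) (y ω) :=
  ((((hv.mul (measurable_indicator_typical hK hp hprob hx measurable_const)).div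
    (measurable_kernelDensity_comp hp hprob hx)).mul (measurable_kernel hp hprob hx hy))).max
    measurable_const

theorem measurable_expWeights {S : Ω → Pt n → ℝ≥0∞}
    (hS : Measurable (Function.uncurry S)) : Measurable fun ω => expWeights K (S ω) := by
  have hm : Measurable fun q : Ω × Pt n => EReal.exp (-(S q.1 q.2 : EReal)) := by
    have : Measurable fun a : ℝ≥0∞ => EReal.exp (-(a : EReal)) :=
      EReal.measurable_exp.comp measurable_coe_ennreal_ereal.neg
    exact this.comp hS
  have hw : ∀ B, MeasurableSet B → Measurable fun ω =>
      ((volume.restrict K).withDensity fun y => EReal.exp (-(S ω y : EReal))) B := fun B hB => by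
    simp only [withDensity_apply _ hB]
    exact hm.lintegral_prod_right'
  refine Measure.measurable_of_measurable_coe _ fun B hB => ?_
  simp only [expWeights, Measure.smul_apply, smul_eq_mul]
  exact (hw univ .univ).inv.mul (hw B hB)

/-- A family of states that depends measurably on a parameter. -/
structure MeasurableState (σ : Ω → State n) : Prop where
  F : MeasurableSet {q : Ω × Pt n | q.2 ∈ (σ q.1).F}
  η : Measurable fun ω => (σ ω).η
  S : Measurable fun q : Ω × Pt n => (σ q.1).S q.2

theorem MeasurableState.step (hK : MeasurableSet K) {σ : Ω → State n} (hσ : MeasurableState σ)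
    {x : Ω → Pt n} {v : Ω → ℝ} (hx : Measurable x) (hv : Measurable v)
    (hprob : ∀ ω, IsProbabilityMeasure (expWeights K (σ ω).S))
    (hprob' : ∀ ω, IsProbabilityMeasure (expWeights K (step P K (σ ω) (x ω) (v ω)).S)) :
    MeasurableState fun ω => step P K (σ ω) (x ω) (v ω) := by
  classical
  have hp := measurable_expWeights (K := K) (S := fun ω => (σ ω).S) hσ.S
  have hS' : Measurable fun q : Ω × Pt n => (σ q.1).S q.2 + ENNReal.ofReal (σ q.1).η *
      lossEstimate P K (σ q.1).F (expWeights K (σ q.1).S) (x q.1) (v q.1) q.2 := by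
    refine hσ.S.add ((hσ.η.comp measurable_fst).ennreal_ofReal.mul ?_)
    unfold lossEstimate
    refine Measurable.ite hσ.F (Measurable.ennreal_ofReal ?_) measurable_const
    have hp' := hp.comp (measurable_fst : Measurable (Prod.fst : Ω × Pt n → Ω))
    have hx' := hx.comp (measurable_fst : Measurable (Prod.fst : Ω × Pt n → Ω))
    have hv' := hv.comp (measurable_fst : Measurable (Prod.fst : Ω × Pt n → Ω))
    exact ((hv'.mul (measurable_indicator_typical hK hp' (fun q => hprob q.1) hx'
      measurable_const)).div (measurable_kernelDensity_comp hp' (fun q => hprob q.1) hx')).mul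
      (measurable_kernel hp' (fun q => hprob q.1) hx' measurable_snd)
  have hSeq : ∀ ω, (KernelBCO.step P K (σ ω) (x ω) (v ω)).S = fun y => (σ ω).S y +
      ENNReal.ofReal (σ ω).η *
        lossEstimate P K (σ ω).F (expWeights K (σ ω).S) (x ω) (v ω) y := by
    intro ω
    unfold KernelBCO.step
    simp only
    split_ifs <;> rfl
  set S' : Ω → Pt n → ℝ≥0∞ := fun ω y => (σ ω).S y + ENNReal.ofReal (σ ω).η *
      lossEstimate P K (σ ω).F (expWeights K (σ ω).S) (x ω) (v ω) y
  simp only [hSeq] at hprob'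
  have hp2 : Measurable fun ω => expWeights K (S' ω) := measurable_expWeights hS'
  set E : Ω → Set (Pt n) := fun ω => ellipsoid (expWeights K (S' ω)) P.α
  have hE : MeasurableSet {q : Ω × Pt n | q.2 ∈ E q.1} :=
    measurableSet_ellipsoid (hp2.comp measurable_fst) (fun q => hprob' q.1) measurable_snd _
  -- Both volumes are those of sections of jointly measurable sets; this is why the region is
  -- tracked as a subset of the product.
  have hc : MeasurableSet {ω | volume ((σ ω).F ∩ E ω) ≤ 2⁻¹ * volume (σ ω).F} :=
    measurableSet_le (measurable_measure_prodMk_left (hσ.F.inter hE))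
      ((measurable_measure_prodMk_left hσ.F).const_mul _)
  have hstep : ∀ ω, KernelBCO.step P K (σ ω) (x ω) (v ω) =
      if volume ((σ ω).F ∩ E ω) ≤ 2⁻¹ * volume (σ ω).F then
        { F := (σ ω).F ∩ E ω, η := (1 + P.γ) * (σ ω).η, S := S' ω }
      else { F := (σ ω).F, η := (σ ω).η, S := S' ω } := by
    intro ω
    unfold KernelBCO.step
    simp only [E, S']
  refine ⟨?_, ?_, ?_⟩
  · have : {q : Ω × Pt n | q.2 ∈ (KernelBCO.step P K (σ q.1) (x q.1) (v q.1)).F} =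
        ({q : Ω × Pt n | q.2 ∈ (σ q.1).F} ∩ {q : Ω × Pt n | q.2 ∈ E q.1}) ∪
          ({q : Ω × Pt n | q.2 ∈ (σ q.1).F} ∩
            (Prod.fst ⁻¹' {ω | volume ((σ ω).F ∩ E ω) ≤ 2⁻¹ * volume (σ ω).F})ᶜ) := by
      ext q
      simp only [hstep, mem_ofPred_eq, mem_union, mem_inter_iff, mem_compl_iff, mem_preimage]
      split_ifs with h <;> simp [h]
      tauto
    rw [this]
    exact (hσ.F.inter hE).union (hσ.F.inter (measurable_fst hc).compl)
  · simp only [hstep, apply_ite State.η]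
    exact Measurable.ite hc (hσ.η.const_mul _) hσ.η
  · simp only [hSeq]
    exact hS'

theorem measurable_stateAfter (hK : MeasurableSet K) {ℓ : ℕ → Ω → Pt n → ℝ} {x : ℕ → Ω → Pt n}
    (hprob : ∀ t ω, IsProbabilityMeasure (weights P K (ℓ · ω) (x · ω) t)) {t : ℕ}
    (hx : ∀ s, 1 ≤ s → s ≤ t → Measurable (x s))
    (hv : ∀ s, 1 ≤ s → s ≤ t → Measurable fun ω => ℓ s ω (x s ω)) :
    MeasurableState fun ω => stateAfter P K (ℓ · ω) (x · ω) t := by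
  induction t with
  | zero => exact ⟨measurable_snd hK, measurable_const, measurable_const⟩
  | succ t ih =>
    exact (ih (fun s a b => hx s a (by omega)) fun s a b => hv s a (by omega)).step hK
      (hx _ (by omega) le_rfl) (hv _ (by omega) le_rfl) (fun ω => hprob (t + 1) ω)
      fun ω => hprob (t + 2) ω

end Measurability

end KernelBCO

namespace KernelBCO

/-! ### Conditional laws on an event -/

section Disintegration

variable {Ω Ω' E : Type*} {mΩ : MeasurableSpace Ω} {mΩ' : MeasurableSpace Ω'}
  [MeasurableSpace E] {μ : Measure Ω} [IsProbabilityMeasure μ]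

/-- On the event `Y ∈ A` the conditional law of `X` given `Y` is `κ Y`. -/
def HasLawGiven (μ : Measure Ω) (X : Ω → E) (Y : Ω → Ω') (κ : Kernel Ω' E) (A : Set Ω') : Prop :=
  ∀ C, MeasurableSet C → C ⊆ A → ∀ B, MeasurableSet B →
    μ (Y ⁻¹' C ∩ X ⁻¹' B) = ∫⁻ ω in Y ⁻¹' C, κ (Y ω) B ∂μ

variable {X : Ω → E} {Y : Ω → Ω'} {κ : Kernel Ω' E} [IsMarkovKernel κ] {A : Set Ω'}

/-- For fixed `C` both sides are finite measures in `B` of the same total mass. Only countably many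
sets then have to be tested, which makes the event that the prescribed law holds measurable. -/
theorem hasLawGiven_of_isPiSystem (hX : Measurable X) (hY : Measurable Y) {𝒞 : Set (Set E)}
    (hgen : ‹MeasurableSpace E› = MeasurableSpace.generateFrom 𝒞) (hpi : IsPiSystem 𝒞)
    (h : ∀ C, MeasurableSet C → C ⊆ A → ∀ B ∈ 𝒞,
      μ (Y ⁻¹' C ∩ X ⁻¹' B) = ∫⁻ ω in Y ⁻¹' C, κ (Y ω) B ∂μ) : HasLawGiven μ X Y κ A := by
  intro C hC hCA B hB
  have hκ : Measurable fun ω => κ (Y ω) := κ.measurable.comp hY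
  have e1 : ∀ B, MeasurableSet B →
      ((μ.restrict (Y ⁻¹' C)).map X) B = μ (Y ⁻¹' C ∩ X ⁻¹' B) := fun B hB => by
    rw [Measure.map_apply hX hB, Measure.restrict_apply (hX hB), inter_comm]
  have e2 : ∀ B, MeasurableSet B →
      ((μ.restrict (Y ⁻¹' C)).bind fun ω => κ (Y ω)) B = ∫⁻ ω in Y ⁻¹' C, κ (Y ω) B ∂μ :=
    fun B hB => Measure.bind_apply hB hκ.aemeasurable
  rw [← e1 B hB, ← e2 B hB]
  congr 1
  refine ext_of_generate_finite 𝒞 hgen hpi (fun B hB => ?_) ?_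
  · have hBm : MeasurableSet B := by
      rw [hgen]; exact MeasurableSpace.measurableSet_generateFrom hB
    rw [e1 B hBm, e2 B hBm, h C hC hCA B hB]
  · rw [e1 _ .univ, e2 _ .univ]; simp

/-- Restricted to `Y ∈ A`, the joint law of `(Y, X)` is the composition product of the law of `Y`
with `κ`; the two agree on rectangles. -/
theorem HasLawGiven.lintegral_eq (h : HasLawGiven μ X Y κ A) (hX : Measurable X)
    (hY : Measurable Y) (hA : MeasurableSet A) {f : Ω' × E → ℝ≥0∞} (hf : Measurable f) :
    ∫⁻ ω in Y ⁻¹' A, f (Y ω, X ω) ∂μ = ∫⁻ ω in Y ⁻¹' A, ∫⁻ e, f (Y ω, e) ∂(κ (Y ω)) ∂μ := by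
  have key : (μ.restrict (Y ⁻¹' A)).map (fun ω => (Y ω, X ω)) =
      ((μ.restrict (Y ⁻¹' A)).map Y) ⊗ₘ κ := by
    refine Measure.ext_prod fun {s t} hs ht => ?_
    have hst := h (s ∩ A) (hs.inter hA) inter_subset_right t ht
    rw [Measure.map_apply (hY.prodMk hX) (hs.prod ht), Measure.restrict_apply
      ((hY.prodMk hX) (hs.prod ht)), Measure.compProd_apply_prod hs ht,
      setLIntegral_map hs (κ.measurable_coe ht) hY,
      Measure.restrict_restrict (hY hs), ← preimage_inter, ← hst]
    congr 1
    ext ω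
    simp only [mem_inter_iff, mem_preimage, mem_prod]
    tauto
  rw [← lintegral_map hf (hY.prodMk hX), key, Measure.lintegral_compProd hf,
    lintegral_map hf.lintegral_kernel_prod_right' hY]

theorem HasLawGiven.measure_notMem_le (h : HasLawGiven μ X Y κ A) (hX : Measurable X)
    (hY : Measurable Y) (hA : MeasurableSet A) {S : Set (Ω' × E)} (hS : MeasurableSet S) {q : ℝ≥0∞}
    (hq : ∀ ω' ∈ A, κ ω' {e | (ω', e) ∉ S} ≤ q) : μ {ω | Y ω ∈ A ∧ (Y ω, X ω) ∉ S} ≤ q := by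
  have hm : MeasurableSet {ω | (Y ω, X ω) ∉ S} := (hY.prodMk hX) hS.compl
  calc μ {ω | Y ω ∈ A ∧ (Y ω, X ω) ∉ S} = ∫⁻ ω in Y ⁻¹' A, Sᶜ.indicator 1 (Y ω, X ω) ∂μ := by
        have e : ∀ ω, Sᶜ.indicator (1 : Ω' × E → ℝ≥0∞) (Y ω, X ω) =
            {ω | (Y ω, X ω) ∉ S}.indicator 1 ω := fun ω => rfl
        simp only [e]
        rw [lintegral_indicator_one hm, Measure.restrict_apply hm]
        congr 1
        ext ω
        exact and_comm
    _ = ∫⁻ ω in Y ⁻¹' A, ∫⁻ e, Sᶜ.indicator 1 (Y ω, e) ∂(κ (Y ω)) ∂μ :=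
        h.lintegral_eq hX hY hA (measurable_one.indicator hS.compl)
    _ ≤ ∫⁻ _ in Y ⁻¹' A, q ∂μ := by
        refine setLIntegral_mono' (hY hA) fun ω hω => ?_
        have hm' : MeasurableSet {e | (Y ω, e) ∉ S} := measurable_prodMk_left hS.compl
        exact (lintegral_indicator_one hm').le.trans (hq _ hω)
    _ ≤ _ := by
        rw [setLIntegral_const]
        exact mul_le_of_le_one_right zero_le prob_le_one

end Disintegration

/-! ### Exponential moments and a tail bound for centred sums -/

section Azuma

theorem exp_le_quadratic {u : ℝ} (h : |u| ≤ 1) : Real.exp u ≤ 1 + u + u ^ 2 := by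
  have := (abs_le.1 (Real.abs_exp_sub_one_sub_id_le h)).2
  linarith

/-- A centered bounded variable has a small exponential moment. -/
theorem lintegral_exp_le {E : Type*} [MeasurableSpace E] {ν : Measure E} [IsProbabilityMeasure ν]
    {f : E → ℝ} (hf : Measurable f) (hf0 : ∀ e, f e ∈ Icc (0 : ℝ) 2) {a b : ℝ} (hab : |a| ≤ b)
    (hb : 2 * b ≤ 1) :
    ∫⁻ e, ENNReal.ofReal (Real.exp (a * (f e - ∫ e, f e ∂ν))) ∂ν ≤
      ENNReal.ofReal (1 + (2 * b) ^ 2) := by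
  set m := ∫ e, f e ∂ν
  have hfi : Integrable f ν := .of_bound hf.aestronglyMeasurable (C := 2)
    (Filter.Eventually.of_forall fun e => by
      rw [Real.norm_of_nonneg (hf0 e).1]; exact (hf0 e).2)
  have hm : m ∈ Icc (0 : ℝ) 2 := ⟨integral_nonneg fun e => (hf0 e).1, by
    calc m ≤ ∫ _, 2 ∂ν := integral_mono hfi (integrable_const _) fun e => (hf0 e).2
      _ = 2 := by simp⟩
  have hd : ∀ e, |f e - m| ≤ 2 := fun e =>
    abs_le.2 ⟨by linarith [(hf0 e).1, hm.2], by linarith [(hf0 e).2, hm.1]⟩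
  have hu : ∀ e, |a * (f e - m)| ≤ 2 * b := fun e => by
    rw [abs_mul, mul_comm 2]
    exact mul_le_mul hab (hd e) (abs_nonneg _) ((abs_nonneg a).trans hab)
  have hle : ∀ e, Real.exp (a * (f e - m)) ≤ (1 + (2 * b) ^ 2) + a * (f e - m) := fun e => by
    have h1 := exp_le_quadratic ((hu e).trans hb)
    have h2 : (a * (f e - m)) ^ 2 ≤ (2 * b) ^ 2 := sq_le_sq' (by
      linarith [(abs_le.1 (hu e)).1]) (abs_le.1 (hu e)).2
    linarith
  have hi : Integrable (fun e => (1 + (2 * b) ^ 2) + a * (f e - m)) ν :=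
    (integrable_const _).add ((hfi.sub (integrable_const _)).const_mul _)
  calc _ ≤ ∫⁻ e, ENNReal.ofReal ((1 + (2 * b) ^ 2) + a * (f e - m)) ∂ν :=
        lintegral_mono fun e => ENNReal.ofReal_le_ofReal (hle e)
    _ = ENNReal.ofReal (∫ e, (1 + (2 * b) ^ 2) + a * (f e - m) ∂ν) :=
        (ofReal_integral_eq_lintegral_ofReal hi (Filter.Eventually.of_forall fun e =>
          (Real.exp_nonneg _).trans (hle e))).symm
    _ = _ := by
        congr 1
        have hi2 : Integrable (fun e => a * (f e - m)) ν :=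
          (hfi.sub (integrable_const m)).const_mul a
        rw [integral_add (integrable_const _) hi2, integral_const_mul,
          integral_sub hfi (integrable_const _)]
        simp [m]

variable {Ω Ω' E : Type*} {mΩ : MeasurableSpace Ω} {mΩ' : MeasurableSpace Ω'}
  [MeasurableSpace E] {μ : Measure Ω} [IsProbabilityMeasure μ]
  {X : Ω → E} {Y : Ω → Ω'} {κ : Kernel Ω' E} [IsMarkovKernel κ] {A : Set Ω'}

/-- The exponential moment of a weighted and centered bounded function of `x`, where `x` agrees
with a variable `X` of conditional law `κ` unless `X` is outside a set. -/
theorem HasLawGiven.lintegral_mul_exp_le (h : HasLawGiven μ X Y κ A) (hX : Measurable X)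
    (hY : Measurable Y) (hA : MeasurableSet A) {K : Set E} (hK : MeasurableSet K) {x : Ω → E}
    (hx : ∀ ω, X ω ∈ K → x ω = X ω) {q : ℝ} (hq0 : 0 ≤ q) (hq : ∀ ω' ∈ A, (κ ω').real Kᶜ ≤ q)
    {f : Ω' × E → ℝ} (hf : Measurable f) (hf0 : ∀ z, f z ∈ Icc (0 : ℝ) 2)
    {a : Ω' → ℝ} (ha : Measurable a) {b : ℝ} (hab : ∀ ω', |a ω'| ≤ b) (hb : 2 * b ≤ 1)
    {g : Ω' → ℝ≥0∞} (hg : Measurable g) :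
    ∫⁻ ω, g (Y ω) * ENNReal.ofReal (Real.exp (A.indicator (fun ω' => a ω' *
      (f (ω', x ω) - ∫ e, f (ω', e) ∂(κ ω'))) (Y ω))) ∂μ ≤
    ENNReal.ofReal (1 + (2 * b) ^ 2 + 3 * q) * ∫⁻ ω, g (Y ω) ∂μ := by
  classical
  set m : Ω' → ℝ := fun ω' => ∫ e, f (ω', e) ∂(κ ω')
  have hm : Measurable m := (hf.stronglyMeasurable.integral_kernel_prod_right' (κ := κ)).measurable
  have hm2 : ∀ ω', m ω' ∈ Icc (0 : ℝ) 2 := fun ω' => by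
    refine ⟨integral_nonneg fun e => (hf0 _).1, ?_⟩
    calc m ω' ≤ ∫ _, 2 ∂(κ ω') := integral_mono
          (.of_bound (hf.comp measurable_prodMk_left).aestronglyMeasurable (C := 2)
            (Filter.Eventually.of_forall fun e => by
              rw [Real.norm_of_nonneg (hf0 _).1]; exact (hf0 _).2)) (integrable_const _)
          fun e => (hf0 _).2
      _ = 2 := by simp
  set φ : Ω' × E → ℝ≥0∞ := fun z => ENNReal.ofReal (Real.exp (a z.1 * (f z - m z.1)))
  have hφ : Measurable φ := ((ha.comp measurable_fst).mul
    (hf.sub (hm.comp measurable_fst))).exp.ennreal_ofReal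
  have hφ3 : ∀ z, φ z ≤ 3 := fun z => by
    have h1 : a z.1 * (f z - m z.1) ≤ 1 := by
      have h2 : |f z - m z.1| ≤ 2 := abs_le.2
        ⟨by linarith [(hf0 z).1, (hm2 z.1).2], by linarith [(hf0 z).2, (hm2 z.1).1]⟩
      have h3 := abs_mul (a z.1) (f z - m z.1) ▸ mul_le_mul (hab z.1) h2 (abs_nonneg _)
        ((abs_nonneg _).trans (hab z.1))
      linarith [le_abs_self (a z.1 * (f z - m z.1))]
    have h4 : Real.exp (a z.1 * (f z - m z.1)) ≤ 3 :=
      (Real.exp_le_exp.2 h1).trans (Real.exp_one_lt_d9.le.trans (by norm_num))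
    calc φ z ≤ ENNReal.ofReal 3 := ENNReal.ofReal_le_ofReal h4
      _ = 3 := by simp
  -- When `X` leaves `K` the point `x` may be anything, even dependent on more than the past. There
  -- `φ` is at most `e ≤ 3`, so the error is dominated by `3 · 1{X ∉ K}`, of conditional mean at
  -- most `3 q`.
  set F : Ω' × E → ℝ≥0∞ := fun z => g z.1 * (φ z + 3 * Kᶜ.indicator 1 z.2)
  have hF : Measurable F := (hg.comp measurable_fst).mul (hφ.add
    (((measurable_one.indicator hK.compl).comp measurable_snd).const_mul _))
  rw [← lintegral_add_compl _ (hY hA), ← lintegral_add_compl (fun ω => g (Y ω)) (hY hA), mul_add]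
  have hAc : ∫⁻ ω in (Y ⁻¹' A)ᶜ, g (Y ω) * ENNReal.ofReal (Real.exp (A.indicator (fun ω' => a ω' *
      (f (ω', x ω) - m ω')) (Y ω))) ∂μ = ∫⁻ ω in (Y ⁻¹' A)ᶜ, g (Y ω) ∂μ := by
    refine setLIntegral_congr_fun (hY hA).compl fun ω hω => ?_
    have : Y ω ∉ A := hω
    simp [indicator_of_notMem this]
  rw [hAc]
  have hρ1 : 1 ≤ ENNReal.ofReal (1 + (2 * b) ^ 2 + 3 * q) := by
    rw [ENNReal.one_le_ofReal]
    nlinarith [sq_nonneg (2 * b)]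
  refine add_le_add ?_ (le_mul_of_one_le_left zero_le hρ1)
  calc _ ≤ ∫⁻ ω in Y ⁻¹' A, F (Y ω, X ω) ∂μ := by
        refine setLIntegral_mono' (hY hA) fun ω hω => ?_
        have hωA : Y ω ∈ A := hω
        rw [indicator_of_mem hωA]
        change g (Y ω) * φ (Y ω, x ω) ≤ g (Y ω) * (φ (Y ω, X ω) + 3 * Kᶜ.indicator 1 (X ω))
        gcongr
        by_cases hXK : X ω ∈ K
        · rw [hx ω hXK]; exact le_self_add
        · have : X ω ∈ Kᶜ := hXK
          rw [indicator_of_mem this]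
          exact (hφ3 _).trans (by simp)
    _ = ∫⁻ ω in Y ⁻¹' A, ∫⁻ e, F (Y ω, e) ∂(κ (Y ω)) ∂μ := h.lintegral_eq hX hY hA hF
    _ ≤ ∫⁻ ω in Y ⁻¹' A, ENNReal.ofReal (1 + (2 * b) ^ 2 + 3 * q) * g (Y ω) ∂μ := by
        refine setLIntegral_mono' (hY hA) fun ω hω => ?_
        have hφ' : Measurable fun e => φ (Y ω, e) := hφ.comp measurable_prodMk_left
        simp only [F]
        have hs : Measurable fun e => φ (Y ω, e) + 3 * Kᶜ.indicator 1 e :=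
          hφ'.add ((measurable_one.indicator hK.compl).const_mul _)
        rw [lintegral_const_mul _ hs,
          lintegral_add_left hφ', lintegral_const_mul _ (measurable_one.indicator hK.compl),
          lintegral_indicator_one hK.compl, mul_comm]
        gcongr
        have h1 : ∫⁻ e, φ (Y ω, e) ∂(κ (Y ω)) ≤ ENNReal.ofReal (1 + (2 * b) ^ 2) :=
          lintegral_exp_le (hf.comp measurable_prodMk_left) (fun e => hf0 _) (hab _) hb
        have h2 : κ (Y ω) Kᶜ ≤ ENNReal.ofReal q := by
          rw [← ENNReal.ofReal_toReal (measure_ne_top (κ (Y ω)) Kᶜ)]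
          exact ENNReal.ofReal_le_ofReal (hq _ hω)
        rw [ENNReal.ofReal_add (by positivity) (by positivity), ENNReal.ofReal_mul (by norm_num)]
        refine add_le_add h1 ?_
        simp only [ENNReal.ofReal_ofNat]
        gcongr
    _ = _ := lintegral_const_mul _ (hg.comp hY)

/-- A tail bound for sums with controlled conditional exponential moments. -/
theorem measure_sum_ge_le {D : ℕ → Ω → ℝ} {m : ℕ → MeasurableSpace Ω} {T : ℕ} {ρ : ℝ≥0∞}
    (hD : ∀ s t, 1 ≤ s → s < t → t ≤ T → Measurable[m t] (D s))
    (hDT : ∀ s, 1 ≤ s → s ≤ T → Measurable (D s))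
    (hstep : ∀ t, 1 ≤ t → t ≤ T → ∀ g : Ω → ℝ≥0∞, Measurable[m t] g →
      ∫⁻ ω, g ω * ENNReal.ofReal (Real.exp (D t ω)) ∂μ ≤ ρ * ∫⁻ ω, g ω ∂μ)
    {t : ℕ} (ht : t ≤ T) (a : ℝ) :
    μ {ω | a ≤ ∑ s ∈ Finset.Icc 1 t, D s ω} ≤ ENNReal.ofReal (Real.exp (-a)) * ρ ^ t := by
  -- The exponential of the previous partial sum is known before the new term, so it serves as the
  -- weight `g` and each round contributes one factor `ρ`.
  have hint : ∀ t ≤ T, ∫⁻ ω, ENNReal.ofReal (Real.exp (∑ s ∈ Finset.Icc 1 t, D s ω)) ∂μ ≤ ρ ^ t := by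
    intro t ht
    induction t with
    | zero => simp
    | succ t ih =>
      have hg : Measurable[m (t + 1)] fun ω =>
          ENNReal.ofReal (Real.exp (∑ s ∈ Finset.Icc 1 t, D s ω)) := by
        refine Measurable.ennreal_ofReal (Real.measurable_exp.comp
          (Finset.measurable_fun_sum _ fun s hs => ?_))
        obtain ⟨a, b⟩ := Finset.mem_Icc.1 hs
        exact hD s (t + 1) a (by omega) ht
      have := hstep (t + 1) (by omega) ht _ hg
      simp only [Finset.sum_Icc_succ_top (show 1 ≤ t + 1 by omega), Real.exp_add,
        ENNReal.ofReal_mul (Real.exp_nonneg _)]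
      refine this.trans ?_
      rw [pow_succ']
      gcongr
      exact ih (by omega)
  have hmeas : Measurable fun ω => ENNReal.ofReal (Real.exp (∑ s ∈ Finset.Icc 1 t, D s ω)) := by
    refine (Finset.measurable_fun_sum _ fun s hs => ?_).exp.ennreal_ofReal
    obtain ⟨a, b⟩ := Finset.mem_Icc.1 hs
    exact hDT s a (b.trans ht)
  have h1 := mul_meas_ge_le_lintegral (μ := μ) hmeas (ENNReal.ofReal (Real.exp a))
  have h2 : {ω | a ≤ ∑ s ∈ Finset.Icc 1 t, D s ω} ⊆ {ω | ENNReal.ofReal (Real.exp a) ≤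
      ENNReal.ofReal (Real.exp (∑ s ∈ Finset.Icc 1 t, D s ω))} := fun ω hω =>
    ENNReal.ofReal_le_ofReal (Real.exp_le_exp.2 hω)
  calc _ ≤ ENNReal.ofReal (Real.exp (-a)) * (ENNReal.ofReal (Real.exp a) * μ {ω | ENNReal.ofReal
        (Real.exp a) ≤ ENNReal.ofReal (Real.exp (∑ s ∈ Finset.Icc 1 t, D s ω))}) := by
        rw [← mul_assoc, ← ENNReal.ofReal_mul (Real.exp_nonneg _), ← Real.exp_add]
        simpa using measure_mono h2
    _ ≤ _ := by gcongr; exact h1.trans (hint t ht)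

end Azuma

end KernelBCO

namespace KernelBCO

/-! ### Quantities determined before the draw -/

section Observed

variable {n : ℕ} {P : Params} {K : Set (Pt n)} {Ω : Type*} [MeasurableSpace Ω]
  {ℓ : ℕ → Ω → Pt n → ℝ} {x : ℕ → Ω → Pt n} {t : ℕ}

/-- `f` is a Carathéodory function on `K`: continuous in the point, measurable in the outcome. Such
functions are jointly measurable. -/
theorem measurable_of_continuousOn {f : Ω → Pt n → ℝ}
    (hfc : ∀ ω, ContinuousOn (f ω) K) (hfm : ∀ y ∈ K, Measurable fun ω => f ω y) {z : Ω → Pt n}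
    (hz : Measurable z) (hzK : ∀ ω, z ω ∈ K) : Measurable fun ω => f ω (z ω) := by
  have h : Measurable (Function.uncurry fun (y : K) ω => f ω y) :=
    measurable_uncurry_of_continuous_of_measurable (fun ω => (hfc ω).domRestrict)
      fun y => hfm y y.2
  exact h.comp ((hz.subtype_mk (h := hzK)).prodMk measurable_id)

open Classical in
/-- The map that fixes the points of `K` and sends all others to `c`. -/
def collapse (K : Set (Pt n)) (c z : Pt n) : Pt n := if z ∈ K then z else c

theorem collapse_of_mem {c z : Pt n} (hz : z ∈ K) : collapse K c z = z := if_pos hz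

theorem collapse_mem {c : Pt n} (hc : c ∈ K) (z : Pt n) : collapse K c z ∈ K := by
  unfold collapse; split_ifs with h
  exacts [h, hc]

theorem measurable_collapse (hK : MeasurableSet K) (c : Pt n) : Measurable (collapse K c) :=
  Measurable.ite hK measurable_id measurable_const

/-- What is known about the game in round `t` before the point of the round is drawn. -/
structure Observed (P : Params) (K : Set (Pt n)) (ℓ : ℕ → Ω → Pt n → ℝ) (x : ℕ → Ω → Pt n)
    (t : ℕ) : Prop where
  path : ∀ ω, IsPath P K (ℓ · ω) (x · ω)
  body : IsBody K
  tame : Tame P n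
  one_le : 1 ≤ t
  le : t ≤ P.T
  loss : ∀ s, 1 ≤ s → s ≤ t → ∀ y ∈ K, Measurable fun ω => ℓ s ω y
  point : ∀ s, 1 ≤ s → s < t → Measurable (x s)

theorem IsPath.continuousOn {ℓ : ℕ → Pt n → ℝ} {x : ℕ → Pt n} (h : IsPath P K ℓ x)
    {t : ℕ} (h1 : 1 ≤ t) (hT : t ≤ P.T) : ContinuousOn (ℓ t) K :=
  (h.loss t h1 hT).lip.continuousOn

theorem Observed.measurableSet (o : Observed P K ℓ x t) : MeasurableSet K :=
  o.body.compact.measurableSet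

theorem Observed.isProbabilityMeasure (o : Observed P K ℓ x t) (s : ℕ) (ω : Ω) :
    IsProbabilityMeasure (weights P K (ℓ · ω) (x · ω) s) :=
  (regular_weights o.tame o.body s).prob

theorem Observed.measurableState (o : Observed P K ℓ x t) :
    MeasurableState fun ω => stateAfter P K (ℓ · ω) (x · ω) (t - 1) := by
  have h1 := o.one_le
  have hT := o.le
  refine measurable_stateAfter o.measurableSet o.isProbabilityMeasure
    (fun s a b => o.point s a (by omega)) fun s a b => ?_
  exact measurable_of_continuousOn (fun ω => (o.path ω).continuousOn a (by omega))
    (o.loss s a (by omega)) (o.point s a (by omega)) fun ω => (o.path ω).mem s a (by omega)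

theorem Observed.measurable_rate (o : Observed P K ℓ x t) :
    Measurable fun ω => rate P K (ℓ · ω) (x · ω) t := o.measurableState.η

theorem Observed.measurable_weights (o : Observed P K ℓ x t) :
    Measurable fun ω => weights P K (ℓ · ω) (x · ω) t :=
  measurable_expWeights o.measurableState.S

theorem Observed.measurableSet_focus (o : Observed P K ℓ x t) :
    MeasurableSet {q : Ω × Pt n | q.2 ∈ focus P K (ℓ · q.1) (x · q.1) t} := o.measurableState.F

theorem Observed.measurableSet_typicalAt (o : Observed P K ℓ x t) :
    MeasurableSet {q : Ω × Pt n | q.2 ∈ typicalAt P K (ℓ · q.1) (x · q.1) t} :=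
  measurableSet_mem_typical o.measurableSet (o.measurable_weights.comp measurable_fst)
    (fun q => o.isProbabilityMeasure t q.1) measurable_snd

/-- Values of a loss off `K` are arbitrary, perhaps not measurable. Sending the complement of `K` to
one point of `K` gives a measurable version, which suffices because estimates vanish unless the
point is typical, in particular in `K`. -/
theorem Observed.exists_measurable_loss (o : Observed P K ℓ x t) :
    ∃ v : Ω → Pt n → ℝ, (Measurable fun q : Ω × Pt n => v q.1 q.2) ∧
      ∀ ω, ∀ z ∈ K, v ω z = ℓ t ω z := by
  obtain ⟨c, hc⟩ := o.body.nonempty_interior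
  refine ⟨fun ω z => ℓ t ω (collapse K c z), ?_, fun ω z hz => by
    simp only [collapse_of_mem hz]⟩
  exact measurable_of_continuousOn (f := fun q : Ω × Pt n => ℓ t q.1)
    (fun q => (o.path q.1).continuousOn o.one_le o.le)
    (fun y hy => (o.loss t o.one_le le_rfl y hy).comp measurable_fst)
    ((measurable_collapse o.measurableSet c).comp measurable_snd)
    fun q => collapse_mem (interior_subset hc) _

theorem Observed.measurable_indicator (o : Observed P K ℓ x t) : Measurable fun q : Ω × Pt n =>
    (typicalAt P K (ℓ · q.1) (x · q.1) t).indicator (ℓ t q.1) q.2 := by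
  obtain ⟨v, hv, hvℓ⟩ := o.exists_measurable_loss
  convert measurable_indicator_typical (P := P) o.measurableSet
    (o.measurable_weights.comp (measurable_fst : Measurable (Prod.fst : Ω × Pt n → Ω)))
    (fun q => o.isProbabilityMeasure t q.1) measurable_snd hv using 2 with q
  by_cases h : q.2 ∈ typicalAt P K (ℓ · q.1) (x · q.1) t
  · rw [indicator_of_mem h, indicator_of_mem (by exact h), hvℓ _ _ h.1]
  · rw [indicator_of_notMem h, indicator_of_notMem (by exact h)]

theorem Observed.measurable_psi (o : Observed P K ℓ x t) {Ω' : Type*} [MeasurableSpace Ω']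
    {φ : Ω' → Ω} {z y : Ω' → Pt n} (hφ : Measurable φ) (hz : Measurable z) (hy : Measurable y) :
    Measurable fun q => psi P K (weights P K (ℓ · (φ q)) (x · (φ q)) t) (z q) (ℓ t (φ q) (z q))
      (y q) := by
  obtain ⟨v, hv, hvℓ⟩ := o.exists_measurable_loss
  convert measurable_psi_comp (P := P) o.measurableSet (o.measurable_weights.comp hφ)
    (fun q => o.isProbabilityMeasure t (φ q)) hz hy (hv.comp (hφ.prodMk hz)) using 2 with q
  by_cases h : z q ∈ typicalAt P K (ℓ · (φ q)) (x · (φ q)) t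
  · simp only [Function.comp]; rw [hvℓ _ _ h.1]
  · rw [psi_of_notMem_typical h]; exact (psi_of_notMem_typical h).symm

theorem Observed.measurable_setIntegral_psi (o : Observed P K ℓ x t) :
    Measurable fun q : Ω × Pt n => ∫ y in focus P K (ℓ · q.1) (x · q.1) t,
      psi P K (weights P K (ℓ · q.1) (x · q.1) t) q.2 (ℓ t q.1 q.2) y
        ∂(weights P K (ℓ · q.1) (x · q.1) t) := by
  classical
  have h : ∀ q : Ω × Pt n, ∫ y in focus P K (ℓ · q.1) (x · q.1) t,
      psi P K (weights P K (ℓ · q.1) (x · q.1) t) q.2 (ℓ t q.1 q.2) y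
        ∂(weights P K (ℓ · q.1) (x · q.1) t) =
      ∫ y, (focus P K (ℓ · q.1) (x · q.1) t).indicator
      (psi P K (weights P K (ℓ · q.1) (x · q.1) t) q.2 (ℓ t q.1 q.2)) y
        ∂(weights P K (ℓ · q.1) (x · q.1) t) := fun q =>
    (integral_indicator (isClosed_focus o.tame o.body t).measurableSet).symm
  simp only [h]
  refine measurable_integral_of_measurable (o.measurable_weights.comp measurable_fst)
    (fun q => o.isProbabilityMeasure t q.1) ?_
  simp only [Function.uncurry_def, indicator_apply]
  refine Measurable.ite ?_ (o.measurable_psi (measurable_fst.comp measurable_fst)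
    (measurable_snd.comp measurable_fst) measurable_snd) measurable_const
  exact o.measurableSet_focus.preimage ((measurable_fst.comp measurable_fst).prodMk measurable_snd)

/-- The law of the point of round `t` as a kernel. -/
def Observed.law (o : Observed P K ℓ x t) : Kernel Ω (Pt n) where
  toFun ω := kernelLaw P (weights P K (ℓ · ω) (x · ω) t) (weights P K (ℓ · ω) (x · ω) t)
  measurable' := measurable_kernelLaw o.measurable_weights (o.isProbabilityMeasure t)

instance (o : Observed P K ℓ x t) : IsMarkovKernel o.law :=
  ⟨fun _ => isProbabilityMeasure_kernelLaw o.tame.toProper (regular_weights o.tame o.body t)⟩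

theorem Observed.measurable_kernelLaw_real (o : Observed P K ℓ x t) {S : Ω → Set (Pt n)}
    (hS : MeasurableSet {q : Ω × Pt n | q.2 ∈ S q.1}) : Measurable fun ω =>
      (kernelLaw P (weights P K (ℓ · ω) (x · ω) t) (weights P K (ℓ · ω) (x · ω) t)).real (S ω) :=
  (Kernel.measurable_kernel_prodMk_left (κ := o.law) hS).ennreal_toReal

end Observed

/-! ### The game, its history and the prescribed law -/

section Game

variable {n : ℕ} {P : Params} {K : Set (Pt n)} {Ω : Type*} {mΩ : MeasurableSpace Ω}
  {μ : Measure Ω} {ℓ : ℕ → Ω → Pt n → ℝ} {X x : ℕ → Ω → Pt n} {s t : ℕ}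

/-- The game: losses, drawn points and played points. -/
structure Game (P : Params) (K : Set (Pt n)) (mΩ : MeasurableSpace Ω) (ℓ : ℕ → Ω → Pt n → ℝ)
    (X x : ℕ → Ω → Pt n) : Prop where
  path : ∀ ω, IsPath P K (ℓ · ω) (x · ω)
  body : IsBody K
  loss : ∀ t, 1 ≤ t → t ≤ P.T → ∀ y ∈ K, Measurable[mΩ] fun ω => ℓ t ω y
  draw : ∀ t, 1 ≤ t → t ≤ P.T → Measurable[mΩ] (X t)
  point : ∀ t, 1 ≤ t → t ≤ P.T → Measurable[mΩ] (x t)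
  point_eq : ∀ t, 1 ≤ t → t ≤ P.T → ∀ ω, X t ω ∈ K → x t ω = X t ω

theorem history_mono (h : s ≤ t) : history K ℓ x s ≤ history K ℓ x t := by
  refine sup_le_sup (biSup_mono fun r hr => ?_) (biSup_mono fun r hr => ?_)
  · simp only [Finset.mem_Icc] at hr ⊢; omega
  · simp only [Finset.mem_Ico] at hr ⊢; omega

theorem history_le (hG : Game P K mΩ ℓ X x) (hT : t ≤ P.T) : history K ℓ x t ≤ mΩ := by
  refine sup_le (iSup₂_le fun s hs => iSup₂_le fun y hy => ?_) (iSup₂_le fun s hs => ?_)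
  · obtain ⟨a, b⟩ := Finset.mem_Icc.1 hs
    exact (hG.loss s a (b.trans hT) y hy).comap_le
  · obtain ⟨a, b⟩ := Finset.mem_Ico.1 hs
    exact (hG.point s a (by omega)).comap_le

theorem measurable_history_loss (h1 : 1 ≤ s) (hst : s ≤ t) {y : Pt n} (hy : y ∈ K) :
    Measurable[history K ℓ x t] fun ω => ℓ s ω y :=
  measurable_iff_comap_le.2 (le_sup_of_le_left (le_iSup₂_of_le s (Finset.mem_Icc.2 ⟨h1, hst⟩)
    (le_iSup₂_of_le y hy le_rfl)))

theorem measurable_history_point (h1 : 1 ≤ s) (hst : s < t) :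
    Measurable[history K ℓ x t] (x s) :=
  measurable_iff_comap_le.2 (le_sup_of_le_right (le_iSup₂_of_le s (Finset.mem_Ico.2 ⟨h1, hst⟩)
    le_rfl))

/-- The preceding facts hold for any σ-algebra; here it is the history, so that weights, rate and
sampling law are known before the draw of the round. -/
theorem Game.observed (hG : Game P K mΩ ℓ X x) (hP : Tame P n) (h1 : 1 ≤ t) (hT : t ≤ P.T) :
    @Observed n Ω (history K ℓ x t) P K ℓ x t :=
  @Observed.mk n Ω (history K ℓ x t) P K ℓ x t hG.path hG.body hP h1 hT
    (fun _ a b _ hy => measurable_history_loss a b hy) fun _ a b => measurable_history_point a b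

/-- The algebra of sets generated by a countable family that generates the Borel sets. -/
def basicSets (n : ℕ) : Set (Set (Pt n)) :=
  generateSetAlgebra (MeasurableSpace.countableGeneratingSet (Pt n))

theorem countable_basicSets (n : ℕ) : (basicSets n).Countable :=
  countable_generateSetAlgebra MeasurableSpace.countable_countableGeneratingSet

theorem generateFrom_basicSets (n : ℕ) :
    (inferInstance : MeasurableSpace (Pt n)) = MeasurableSpace.generateFrom (basicSets n) := by
  rw [basicSets, generateFrom_generateSetAlgebra_eq,
    MeasurableSpace.generateFrom_countableGeneratingSet]

theorem isPiSystem_basicSets (n : ℕ) : IsPiSystem (basicSets n) := fun _ hA _ hB _ =>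
  isSetAlgebra_generateSetAlgebra.inter_mem hA hB

theorem measurableSet_of_mem_basicSets {B : Set (Pt n)} (hB : B ∈ basicSets n) :
    MeasurableSet B := by
  have := MeasurableSpace.measurableSet_generateFrom hB
  rwa [← generateFrom_basicSets n] at this

/-- The law from which the point of round `t` is drawn. -/
def drawLaw (P : Params) (K : Set (Pt n)) (ℓ : ℕ → Ω → Pt n → ℝ) (x : ℕ → Ω → Pt n) (t : ℕ)
    (ω : Ω) : Measure (Pt n) :=
  kernelLaw P (weights P K (ℓ · ω) (x · ω) t) (weights P K (ℓ · ω) (x · ω) t)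

/-- The event that the point of round `t` is drawn as prescribed and likely to be typical. -/
def goodSet (P : Params) (K : Set (Pt n)) (μ : Measure Ω) (ℓ : ℕ → Ω → Pt n → ℝ)
    (X x : ℕ → Ω → Pt n) (t : ℕ) : Set Ω :=
  {ω | ∀ B ∈ basicSets n, (μ[(X t ⁻¹' B).indicator fun _ => (1 : ℝ) | history K ℓ x t]) ω =
    (drawLaw P K ℓ x t ω).real B} ∩
  {ω | (drawLaw P K ℓ x t ω).real (typicalAt P K (ℓ · ω) (x · ω) t)ᶜ ≤ ((P.T : ℝ) ^ 4)⁻¹}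

/-- The prescribed law is assumed only until the restart. Instead of the event of being before the
restart, the identity of conditional probabilities itself is used, tested on a countable algebra:
this is an event of the history, and so is the bound on atypical draws. -/
theorem Game.measurableSet_goodSet (hG : Game P K mΩ ℓ X x) (hP : Tame P n) (h1 : 1 ≤ t)
    (hT : t ≤ P.T) : MeasurableSet[history K ℓ x t] (goodSet P K μ ℓ X x t) := by
  have o := hG.observed hP h1 hT
  refine MeasurableSet.inter ?_ ?_
  · simp only [ofPred_forall]
    refine MeasurableSet.biInter (countable_basicSets n) fun B hB => ?_
    exact measurableSet_eq_fun stronglyMeasurable_condExp.measurable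
      (@Observed.measurable_kernelLaw_real n P K Ω (history K ℓ x t) ℓ x t o (fun _ => B)
        (measurable_snd (measurableSet_of_mem_basicSets hB)))
  · exact measurableSet_le (@Observed.measurable_kernelLaw_real n P K Ω (history K ℓ x t) ℓ x t o
      (fun ω => (typicalAt P K (ℓ · ω) (x · ω) t)ᶜ)
        (@Observed.measurableSet_typicalAt n P K Ω (history K ℓ x t) ℓ x t o).compl)
      measurable_const

/-- The variable `Y` is the identity from the ambient σ-algebra to the history, so conditioning on
`Y` means conditioning on the past. On subsets of the good event the claim is the defining property
of conditional expectation. -/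
theorem Game.hasLawGiven [IsProbabilityMeasure μ] (hG : Game P K mΩ ℓ X x) (hP : Tame P n) (h1 : 1 ≤ t)
    (hT : t ≤ P.T) : @HasLawGiven Ω Ω (Pt n) mΩ (history K ℓ x t) _ μ (X t) id
      (@Observed.law n P K Ω (history K ℓ x t) ℓ x t (hG.observed hP h1 hT))
      (goodSet P K μ ℓ X x t) := by
  have hle := history_le hG hT
  have o := hG.observed hP h1 hT
  refine @hasLawGiven_of_isPiSystem Ω Ω (Pt n) mΩ (history K ℓ x t) _ μ _ (X t) id _
    (@instIsMarkovKernelPtLaw n P K Ω (history K ℓ x t) ℓ x t o) _ (hG.draw t h1 hT)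
    (measurable_id'' hle) (basicSets n) (generateFrom_basicSets n) (isPiSystem_basicSets n)
    fun C hC hCG B hB => ?_
  have hBm := measurableSet_of_mem_basicSets hB
  have hXB : MeasurableSet (X t ⁻¹' B) := hG.draw t h1 hT hBm
  have hi : Integrable ((X t ⁻¹' B).indicator fun _ => (1 : ℝ)) μ :=
    (integrable_const _).indicator hXB
  have h2 := setIntegral_condExp hle hi hC
  rw [setIntegral_congr_fun (hle _ hC) fun ω hω => (hCG hω).1 B hB,
    integral_indicator_const _ hXB] at h2
  have hm : Measurable[mΩ] fun ω => (drawLaw P K ℓ x t ω).real B :=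
    (@Observed.measurable_kernelLaw_real n P K Ω (history K ℓ x t) ℓ x t o (fun _ => B)
        (measurable_snd hBm)).mono hle le_rfl
  have hpr : ∀ ω, IsProbabilityMeasure (drawLaw P K ℓ x t ω) := fun ω =>
    isProbabilityMeasure_kernelLaw hP.toProper (regular_weights hP hG.body t)
  have hi2 : Integrable (fun ω => (drawLaw P K ℓ x t ω).real B) (μ.restrict C) :=
    .of_bound hm.aestronglyMeasurable (C := 1) (Filter.Eventually.of_forall fun ω => by
      rw [Real.norm_of_nonneg measureReal_nonneg]; exact measureReal_le_one)
  have h3 := ofReal_integral_eq_lintegral_ofReal hi2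
    (Filter.Eventually.of_forall fun ω => measureReal_nonneg)
  rw [h2, smul_eq_mul, mul_one, measureReal_def, ENNReal.ofReal_toReal (measure_ne_top _ _),
    Measure.restrict_apply hXB] at h3
  rw [inter_comm]
  refine h3.trans (lintegral_congr fun ω => ?_)
  exact ENNReal.ofReal_toReal (measure_ne_top _ _)

end Game

end KernelBCO

namespace KernelBCO

/-! ### Deviation of the centred statistics -/

section Concentration

variable {n : ℕ} {P : Params} {K : Set (Pt n)} {Ω : Type*} {mΩ : MeasurableSpace Ω}
  {μ : Measure Ω} {ℓ : ℕ → Ω → Pt n → ℝ} {X x : ℕ → Ω → Pt n} {s t : ℕ}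

/-- The conditions under which the deviations of the game are unlikely to be large. -/
structure Calibrated (P : Params) (n : ℕ) : Prop extends Tuned P n where
  exists_exponent : ∃ θ : ℝ, 0 ≤ θ ∧ 2 * (θ * (Real.exp 1 * P.η₁)) ≤ 1 ∧
    2 * (Real.exp (-(θ / 2)) * (1 + (2 * (θ * (Real.exp 1 * P.η₁))) ^ 2 +
      3 * ((P.T : ℝ) ^ 4)⁻¹) ^ P.T) ≤ ((P.T : ℝ) ^ (20 * n))⁻¹

/-- A centered statistic of the point played in round `t`, set to zero off the good event. -/
def increment (P : Params) (K : Set (Pt n)) (μ : Measure Ω) (ℓ : ℕ → Ω → Pt n → ℝ)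
    (X x : ℕ → Ω → Pt n) (w : ℕ → Ω → ℝ) (f : ℕ → Ω → Pt n → ℝ) (t : ℕ) : Ω → ℝ :=
  (goodSet P K μ ℓ X x t).indicator fun ω =>
    w t ω * (f t ω (x t ω) - ∫ e, f t ω e ∂(drawLaw P K ℓ x t ω))

/-- A statistic with values in `[0, 2]` that is known, as a function of the point, before the
point is drawn. -/
structure Statistic (P : Params) (K : Set (Pt n)) (ℓ : ℕ → Ω → Pt n → ℝ) (x : ℕ → Ω → Pt n)
    (f : ℕ → Ω → Pt n → ℝ) : Prop where
  measurable : ∀ t, 1 ≤ t → t ≤ P.T → Measurable[(history K ℓ x t).prod inferInstance]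
    fun q : Ω × Pt n => f t q.1 q.2
  mem : ∀ t, 1 ≤ t → t ≤ P.T → ∀ ω e, f t ω e ∈ Icc (0 : ℝ) 2

/-- A learning rate that is known before the point is drawn. -/
structure Weighting (P : Params) (K : Set (Pt n)) (ℓ : ℕ → Ω → Pt n → ℝ) (x : ℕ → Ω → Pt n)
    (w : ℕ → Ω → ℝ) : Prop where
  measurable : ∀ t, 1 ≤ t → t ≤ P.T → Measurable[history K ℓ x t] (w t)
  abs_le : ∀ t ω, |w t ω| ≤ Real.exp 1 * P.η₁

variable {w : ℕ → Ω → ℝ} {f : ℕ → Ω → Pt n → ℝ}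

theorem Game.measurable_increment (hG : Game P K mΩ ℓ X x) (hP : Tame P n)
    (hf : Statistic P K ℓ x f) (hw : Weighting P K ℓ x w) (h1 : 1 ≤ t) (hT : t ≤ P.T)
    {m : MeasurableSpace Ω} (hm : history K ℓ x t ≤ m) (hx : Measurable[m] (x t)) :
    Measurable[m] (increment P K μ ℓ X x w f t) := by
  have hle : (history K ℓ x t).prod (inferInstance : MeasurableSpace (Pt n)) ≤
      m.prod inferInstance := sup_le_sup (MeasurableSpace.comap_mono hm) le_rfl
  have h2 : Measurable[m] fun ω => f t ω (x t ω) :=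
    ((hf.measurable t h1 hT).mono hle le_rfl).comp (measurable_id.prodMk hx)
  have h3 : Measurable[history K ℓ x t] fun ω => ∫ e, f t ω e ∂(drawLaw P K ℓ x t ω) := by
    have o := hG.observed hP h1 hT
    refine @measurable_integral_of_measurable n Ω (history K ℓ x t) ℝ _ _ _ _ _ _
      (@measurable_kernelLaw n P Ω (history K ℓ x t) _
        (@Observed.measurable_weights n P K Ω (history K ℓ x t) ℓ x t o)
        (@Observed.isProbabilityMeasure n P K Ω (history K ℓ x t) ℓ x t o t))
      (fun ω => isProbabilityMeasure_kernelLaw hP.toProper (regular_weights hP hG.body t))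
      (f t) (hf.measurable t h1 hT)
  exact (((hw.measurable t h1 hT).mono hm le_rfl).mul (h2.sub (h3.mono hm le_rfl))).indicator
    (hm _ (hG.measurableSet_goodSet hP h1 hT))

/-- On the good event the draw leaves `K` with probability at most `T⁻⁴`, since typical points are
in `K`. This is the `q` of the exponential moment bound. -/
theorem Game.lintegral_mul_exp_increment_le [IsProbabilityMeasure μ] (hG : Game P K mΩ ℓ X x)
    (hP : Tame P n) (hf : Statistic P K ℓ x f) (hw : Weighting P K ℓ x w) (h1 : 1 ≤ t)
    (hT : t ≤ P.T) {θ : ℝ} (hθ : 2 * (|θ| * (Real.exp 1 * P.η₁)) ≤ 1) {g : Ω → ℝ≥0∞}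
    (hg : Measurable[history K ℓ x t] g) :
    ∫⁻ ω, g ω * ENNReal.ofReal (Real.exp (θ * increment P K μ ℓ X x w f t ω)) ∂μ ≤
      ENNReal.ofReal (1 + (2 * (|θ| * (Real.exp 1 * P.η₁))) ^ 2 + 3 * ((P.T : ℝ) ^ 4)⁻¹) *
        ∫⁻ ω, g ω ∂μ := by
  have o := hG.observed hP h1 hT
  have hle := history_le hG hT
  have key := @HasLawGiven.lintegral_mul_exp_le Ω Ω (Pt n) mΩ (history K ℓ x t) _ μ _ (X t) id
    (@Observed.law n P K Ω (history K ℓ x t) ℓ x t o)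
    (@instIsMarkovKernelPtLaw n P K Ω (history K ℓ x t) ℓ x t o) (goodSet P K μ ℓ X x t)
    (hG.hasLawGiven hP h1 hT) (hG.draw t h1 hT) (measurable_id'' hle)
    (hG.measurableSet_goodSet hP h1 hT) K hG.body.compact.measurableSet (x t)
    (hG.point_eq t h1 hT) ((P.T : ℝ) ^ 4)⁻¹ (by positivity) ?_ (fun q => f t q.1 q.2)
    (hf.measurable t h1 hT) (fun q => hf.mem t h1 hT q.1 q.2) (fun ω => θ * w t ω)
    ((hw.measurable t h1 hT).const_mul θ) (|θ| * (Real.exp 1 * P.η₁)) ?_ hθ g hg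
  · refine le_trans (le_of_eq (lintegral_congr fun ω => ?_)) key
    congr 3
    by_cases hω : ω ∈ goodSet P K μ ℓ X x t
    · rw [increment, indicator_of_mem hω, id, indicator_of_mem hω]
      exact (mul_assoc _ _ _).symm
    · rw [increment, indicator_of_notMem hω, mul_zero, id, indicator_of_notMem hω]
  · intro ω hω
    refine le_trans ?_ hω.2
    have := isProbabilityMeasure_kernelLaw hP.toProper (regular_weights (K := K)
      (ℓ := (ℓ · ω)) (x := (x · ω)) hP hG.body t)
    exact measureReal_mono (compl_subset_compl.2 inter_subset_left)
  · intro ω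
    rw [abs_mul]
    exact mul_le_mul_of_nonneg_left (hw.abs_le t ω) (abs_nonneg _)

/-- Chernoff's method with the exponents `θ` and `-θ`; the factor 2 in the calibration pays for the
two signs. -/
theorem Game.measure_sum_increment_le [IsProbabilityMeasure μ] (hG : Game P K mΩ ℓ X x)
    (hP : Calibrated P n) (hf : Statistic P K ℓ x f) (hw : Weighting P K ℓ x w) (hT : t ≤ P.T) :
    μ {ω | 1 / 2 ≤ |∑ s ∈ Finset.Icc 1 t, increment P K μ ℓ X x w f s ω|} ≤
      ENNReal.ofReal ((P.T : ℝ) ^ (20 * n))⁻¹ := by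
  obtain ⟨θ, hθ0, hθ1, hθ⟩ := hP.exists_exponent
  have hPt := hP.toTame
  set ρ := 1 + (2 * (θ * (Real.exp 1 * P.η₁))) ^ 2 + 3 * ((P.T : ℝ) ^ 4)⁻¹
  have hρ1 : 1 ≤ ρ := by
    have : 0 ≤ 3 * ((P.T : ℝ) ^ 4)⁻¹ := by positivity
    have := sq_nonneg (2 * (θ * (Real.exp 1 * P.η₁)))
    simp only [ρ]; linarith
  have one_sided : ∀ ϑ : ℝ, |ϑ| = θ →
      μ {ω | θ / 2 ≤ ∑ s ∈ Finset.Icc 1 t, ϑ * increment P K μ ℓ X x w f s ω} ≤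
        ENNReal.ofReal (Real.exp (-(θ / 2)) * ρ ^ P.T) := by
    intro ϑ hϑ
    have h := measure_sum_ge_le (μ := μ) (D := fun s ω => ϑ * increment P K μ ℓ X x w f s ω)
      (m := fun s => history K ℓ x s) (T := P.T) (ρ := ENNReal.ofReal ρ)
      (fun s t h1 hst htT => (hG.measurable_increment hPt hf hw h1 (by omega)
        (history_mono hst.le) (measurable_history_point h1 hst)).const_mul ϑ)
      (fun s h1 hs => (hG.measurable_increment hPt hf hw h1 hs (history_le hG hs)
        (hG.point s h1 hs)).const_mul ϑ)
      (fun s h1 hs g hg => by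
        have := hG.lintegral_mul_exp_increment_le (μ := μ) hPt hf hw h1 hs (θ := ϑ)
          (by rw [hϑ]; exact hθ1) hg
        rwa [hϑ] at this) hT (θ / 2)
    refine h.trans ?_
    rw [ENNReal.ofReal_mul (Real.exp_nonneg _), ← ENNReal.ofReal_pow (by linarith)]
    gcongr
  have hsub : {ω | 1 / 2 ≤ |∑ s ∈ Finset.Icc 1 t, increment P K μ ℓ X x w f s ω|} ⊆
      {ω | θ / 2 ≤ ∑ s ∈ Finset.Icc 1 t, θ * increment P K μ ℓ X x w f s ω} ∪
      {ω | θ / 2 ≤ ∑ s ∈ Finset.Icc 1 t, -θ * increment P K μ ℓ X x w f s ω} := by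
    intro ω hω
    simp only [mem_ofPred_eq, mem_union, ← Finset.mul_sum] at hω ⊢
    rcases le_abs.1 hω with h | h
    · left; nlinarith
    · right; nlinarith
  refine (measure_mono hsub).trans ((measure_union_le _ _).trans ?_)
  refine (add_le_add (one_sided θ (abs_of_nonneg hθ0))
    (one_sided (-θ) (by rw [abs_neg, abs_of_nonneg hθ0]))).trans ?_
  rw [← ENNReal.ofReal_add (by positivity) (by positivity), ← two_mul]
  exact ENNReal.ofReal_le_ofReal hθ

theorem Game.measure_not_typical_le [IsProbabilityMeasure μ] (hG : Game P K mΩ ℓ X x)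
    (hP : Tame P n) (h1 : 1 ≤ t) (hT : t ≤ P.T) :
    μ {ω | ω ∈ goodSet P K μ ℓ X x t ∧ X t ω ∉ typicalAt P K (ℓ · ω) (x · ω) t} ≤
      ENNReal.ofReal ((P.T : ℝ) ^ 4)⁻¹ := by
  have o := hG.observed hP h1 hT
  have hle := history_le hG hT
  refine @HasLawGiven.measure_notMem_le Ω Ω (Pt n) mΩ (history K ℓ x t) _ μ _ (X t) id
    (@Observed.law n P K Ω (history K ℓ x t) ℓ x t o)
    (@instIsMarkovKernelPtLaw n P K Ω (history K ℓ x t) ℓ x t o) (goodSet P K μ ℓ X x t)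
    (hG.hasLawGiven hP h1 hT) (hG.draw t h1 hT) (measurable_id'' hle)
    (hG.measurableSet_goodSet hP h1 hT) _
    (@Observed.measurableSet_typicalAt n P K Ω (history K ℓ x t) ℓ x t o) _ fun ω hω => ?_
  have hpr : IsProbabilityMeasure (drawLaw P K ℓ x t ω) :=
    isProbabilityMeasure_kernelLaw hP.toProper (regular_weights hP hG.body t)
  change drawLaw P K ℓ x t ω (typicalAt P K (ℓ · ω) (x · ω) t)ᶜ ≤ _
  rw [← ENNReal.ofReal_toReal (measure_ne_top (drawLaw P K ℓ x t ω) _)]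
  exact ENNReal.ofReal_le_ofReal hω.2

end Concentration

end KernelBCO

namespace KernelBCO

/-! ### From finitely many small deviations to the concentration event -/

section Deterministic

variable {n : ℕ} {P : Params} {K : Set (Pt n)} {ℓ : ℕ → Pt n → ℝ} {x : ℕ → Pt n} {s t : ℕ}

theorem measurable_kernelAdjoint (hP : Proper P n) {p : Measure (Pt n)} {f : Pt n → ℝ}
    (hf : Measurable f) : Measurable (kernelAdjoint P p f) := by
  have hm : Measurable fun q : Pt n × Pt n => f q.1 * kernel P p q.1 q.2 :=
    (hf.comp measurable_fst).mul (continuous_kernel (p := p) hP).measurable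
  exact (hm.stronglyMeasurable.integral_prod_left (μ := volume)).measurable

/-- The law from which the point of round `t` is drawn on a path of the game. -/
def pathLaw (P : Params) (K : Set (Pt n)) (ℓ : ℕ → Pt n → ℝ) (x : ℕ → Pt n) (t : ℕ) :
    Measure (Pt n) := kernelLaw P (weights P K ℓ x t) (weights P K ℓ x t)

/-- The loss estimate at `y` as a function of the played point `z`. -/
def psiOf (P : Params) (K : Set (Pt n)) (ℓ : ℕ → Pt n → ℝ) (x : ℕ → Pt n) (t : ℕ) (z y : Pt n) : ℝ :=
  psi P K (weights P K ℓ x t) z (ℓ t z) y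

theorem psiOf_nonneg (z y : Pt n) : 0 ≤ psiOf P K ℓ x t z y := psi_nonneg _ _ _ _

theorem isProbabilityMeasure_pathLaw (h : IsPath P K ℓ x) (hP : Tame P n) (t : ℕ) :
    IsProbabilityMeasure (pathLaw P K ℓ x t) :=
  isProbabilityMeasure_kernelLaw hP.toProper (regular_weights hP h.toIsBody t)

theorem Healthy.psiOf_close (h : IsPath P K ℓ x) (hP : Tuned P n) (h1 : 1 ≤ t) (hT : t ≤ P.T)
    (hh : Healthy P K ℓ x t) {y y' : Pt n} (hy : y ∈ focus P K ℓ x t)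
    (hyy' : ‖y - y'‖ ≤ ((P.T : ℝ) ^ 7)⁻¹) (z : Pt n) :
    psiOf P K ℓ x t z y' ≤ 2 ∧ |psiOf P K ℓ x t z y - psiOf P K ℓ x t z y'| ≤ 1 / P.T := by
  by_cases hz : z ∈ typical P K (weights P K ℓ x t)
  · exact hh.psi_close h hP h1 hy hyy' ((h.loss t h1 hT).maps hz.1)
  · have hT0 := hP.T_pos
    simp only [psiOf, psi_of_notMem_typical hz]
    refine ⟨by norm_num, ?_⟩
    simp only [sub_self, abs_zero]; positivity

theorem integrable_psiOf (h : IsPath P K ℓ x) (hP : Tame P n) (h1 : 1 ≤ t) (hT : t ≤ P.T)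
    {y : Pt n} (hy : ∀ z, psiOf P K ℓ x t z y ≤ 2) :
    Integrable (fun z => psiOf P K ℓ x t z y) (pathLaw P K ℓ x t) := by
  have := isProbabilityMeasure_pathLaw h hP t
  refine .of_bound (C := 2) ?_ (Filter.Eventually.of_forall fun z => ?_)
  · exact ((measurable_psi hP h.compact.isClosed (regular_weights hP h.toIsBody t)
      (h.loss t h1 hT)).comp (measurable_id.prodMk measurable_const)).aestronglyMeasurable
  · rw [Real.norm_of_nonneg (psiOf_nonneg _ _)]; exact hy z

theorem integral_psiOf (h : IsPath P K ℓ x) (hP : Tame P n) (h1 : 1 ≤ t) (hT : t ≤ P.T) (y : Pt n) :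
    ∫ z, psiOf P K ℓ x t z y ∂(pathLaw P K ℓ x t) = adjTypical P K ℓ x t y :=
  integral_psi hP (regular_weights hP h.toIsBody t) (h.loss t h1 hT) y

theorem abs_integral_sub_le {ν : Measure (Pt n)} [IsProbabilityMeasure ν] {f g : Pt n → ℝ}
    (hf : Integrable f ν) (hg : Integrable g ν) {c : ℝ} (hfg : ∀ z, |f z - g z| ≤ c) :
    |∫ z, f z ∂ν - ∫ z, g z ∂ν| ≤ c := by
  rw [← integral_sub hf hg]
  refine (norm_integral_le_of_norm_le_const (f := fun z => f z - g z)
    (Filter.Eventually.of_forall hfg)).trans ?_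
  simp

/-- The deviation of a loss estimate from its target at a point is close to the deviation from
the mean at a nearby point. -/
theorem Healthy.abs_deviation_sub_le (h : IsPath P K ℓ x) (hP : Tuned P n) (h1 : 1 ≤ t)
    (hT : t ≤ P.T) (hh : Healthy P K ℓ x t) {y y' : Pt n} (hy : y ∈ focus P K ℓ x t)
    (hyy' : ‖y - y'‖ ≤ ((P.T : ℝ) ^ 7)⁻¹) (z : Pt n) :
    |(psiOf P K ℓ x t z y - adjExt P K ℓ x t y) - (min 2 (psiOf P K ℓ x t z y') -
      ∫ e, min 2 (psiOf P K ℓ x t e y') ∂(pathLaw P K ℓ x t))| ≤ 3 / P.T := by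
  have hprob := isProbabilityMeasure_pathLaw h hP.toTame t
  have hT0 := hP.T_pos
  have hc := hh.psiOf_close h hP h1 hT hy hyy'
  have hc0 := hh.psiOf_close h hP h1 hT (y := y) (y' := y) hy (by
    rw [sub_self, norm_zero]; positivity)
  simp only [fun z => min_eq_right (hc z).1]
  have h2 := abs_integral_sub_le (integrable_psiOf h hP.toTame h1 hT fun z => (hc0 z).1)
    (integrable_psiOf h hP.toTame h1 hT fun z => (hc z).1) fun z => (hc z).2
  rw [integral_psiOf h hP.toTame h1 hT y] at h2
  have h3 := hh.abs_adjTypical_sub_adjExt_le h hP h1 hT hy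
  have h4 := (hc z).2
  -- The three errors are moving the estimate from `y` to `y'`, moving its mean likewise, and the
  -- truncation bias at `y`.
  have e : 3 / (P.T : ℝ) = 1 / P.T + 1 / P.T + 1 / P.T := by ring
  rw [e]
  rw [abs_le] at *
  constructor <;> linarith [h2.1, h2.2, h3.1, h3.2, h4.1, h4.2]

/-- The integral over the region and the mean over the draw are exchanged by Fubini. The estimate
then cancels exactly and only the truncation bias remains. -/
theorem Healthy.abs_average_deviation_sub_le (h : IsPath P K ℓ x) (hP : Tuned P n) (h1 : 1 ≤ t)
    (hT : t ≤ P.T) (hh : Healthy P K ℓ x t) (z : Pt n) :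
    |(∫ y in focus P K ℓ x t, (psiOf P K ℓ x t z y - adjExt P K ℓ x t y) ∂(weights P K ℓ x t)) -
      (min 2 (∫ y in focus P K ℓ x t, psiOf P K ℓ x t z y ∂(weights P K ℓ x t)) -
      ∫ e, min 2 (∫ y in focus P K ℓ x t, psiOf P K ℓ x t e y ∂(weights P K ℓ x t))
        ∂(pathLaw P K ℓ x t))| ≤ 3 / P.T := by
  have hPt := hP.toTame
  have hT0 := hP.T_pos
  have hα := hP.α_pos
  have hn := hP.one_le_cast
  have hreg := regular_weights (ℓ := ℓ) (x := x) hPt h.toIsBody t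
  have hprob := hreg.prob
  set p := weights P K ℓ x t
  set F := focus P K ℓ x t
  have hFm : MeasurableSet F := (isClosed_focus hPt h.toIsBody t).measurableSet
  have hFE : F ⊆ ellipsoid p (20 * n * P.α) :=
    (focus_subset_ellipsoid hPt h.toIsBody h1).trans (ellipsoid_mono (by nlinarith))
  have hp2 : ∀ z, ∀ y ∈ F, psiOf P K ℓ x t z y ≤ 2 := fun z y hy =>
    (hh.psiOf_close h hP h1 hT (y := y) (y' := y) hy (by
      rw [sub_self, norm_zero]; positivity) z).1
  have hψi : ∀ z, IntegrableOn (psiOf P K ℓ x t z) F p := fun z =>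
    (hreg.integrable (continuous_psi hP.toProper p z (ℓ t z))).integrableOn
  have hle : ∀ z, ∫ y in F, psiOf P K ℓ x t z y ∂p ≤ 2 := fun z => by
    calc _ ≤ ∫ y in F, (2 : ℝ) ∂p :=
          setIntegral_mono_on (hψi z) (integrable_const _) hFm (hp2 z)
      _ = p.real F * 2 := by simp
      _ ≤ 2 := by linarith [measureReal_le_one (μ := p) (s := F)]
  simp only [fun z => min_eq_right (hle z)]
  have hA : ∀ y ∈ F, ‖adjTypical P K ℓ x t y‖ ≤ 2 := fun y hy => by
    rw [← integral_psiOf h hPt h1 hT y]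
    have := isProbabilityMeasure_pathLaw h hPt t
    refine (norm_integral_le_of_norm_le_const (C := 2) (Filter.Eventually.of_forall fun z => ?_)).trans
      (by simp)
    rw [Real.norm_of_nonneg (psiOf_nonneg _ _)]; exact hp2 z y hy
  have hAm : Measurable (adjTypical P K ℓ x t) :=
    measurable_kernelAdjoint hP.toProper
      (measurable_indicator_loss (h.loss t h1 hT) h.compact.isClosed p)
  have hEm : Measurable (adjExt P K ℓ x t) := measurable_kernelAdjoint hP.toProper
    ((h.loss t h1 hT).lipschitz_convexExtension h.nonempty_interior).continuous.measurable
  have hAi : IntegrableOn (adjTypical P K ℓ x t) F p :=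
    Integrable.of_bound hAm.aestronglyMeasurable (C := 2) (by
      filter_upwards [ae_restrict_mem hFm] with y hy using hA y hy)
  have hEi : IntegrableOn (adjExt P K ℓ x t) F p :=
    Integrable.of_bound hEm.aestronglyMeasurable (C := 2 + 2 * (P.T : ℝ) ^ 2) (by
      filter_upwards [ae_restrict_mem hFm] with y hy
      obtain ⟨a, b⟩ := adjExt_bounds h hP h1 hT (focus_subset t hy)
      rwa [Real.norm_of_nonneg a])
  have hswap : ∫ z, (∫ y in F, psiOf P K ℓ x t z y ∂p) ∂(pathLaw P K ℓ x t) =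
      ∫ y in F, adjTypical P K ℓ x t y ∂p :=
    (setIntegral_kernelAdjoint hPt h.compact.isClosed hreg (h.loss t h1 hT) hFm hFE).symm
  rw [hswap, integral_sub (hψi z) hEi, sub_sub_sub_cancel_left, ← integral_sub hAi hEi]
  have h2 : ‖∫ y in F, (adjTypical P K ℓ x t y - adjExt P K ℓ x t y) ∂p‖ ≤ 1 / P.T * p.real F :=
    norm_setIntegral_le_of_norm_le_const (measure_lt_top _ _) fun y hy =>
      hh.abs_adjTypical_sub_adjExt_le h hP h1 hT hy
  refine h2.trans ?_
  have h3 : p.real F ≤ 1 := measureReal_le_one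
  calc 1 / (P.T : ℝ) * p.real F ≤ 1 / P.T * 1 := by gcongr
    _ ≤ 3 / P.T := by rw [mul_one]; gcongr; norm_num

/-- The errors add up to at most `T · e η₁ · 3 / T ≤ 1/2`. This is why deviations are controlled at
level `1/2` and not 1. -/
theorem abs_sum_le_of_close (hP : Tuned P n) {w a b : ℕ → ℝ} (hT : t ≤ P.T)
    (hw : ∀ s, 1 ≤ s → s ≤ t → |w s| ≤ Real.exp 1 * P.η₁)
    (hab : ∀ s, 1 ≤ s → s ≤ t → |a s - b s| ≤ 3 / P.T)
    (hb : |∑ s ∈ Finset.Icc 1 t, w s * b s| ≤ 1 / 2) :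
    |∑ s ∈ Finset.Icc 1 t, w s * a s| ≤ 1 := by
  have hT0 := hP.T_pos
  have hη := hP.η_pos
  have h1 : |∑ s ∈ Finset.Icc 1 t, w s * (a s - b s)| ≤ 1 / 2 := by
    calc _ ≤ ∑ s ∈ Finset.Icc 1 t, |w s * (a s - b s)| := Finset.abs_sum_le_sum_abs _ _
      _ ≤ ∑ _ ∈ Finset.Icc 1 t, Real.exp 1 * P.η₁ * (3 / P.T) := by
          refine Finset.sum_le_sum fun s hs => ?_
          obtain ⟨c, d⟩ := Finset.mem_Icc.1 hs
          rw [abs_mul]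
          exact mul_le_mul (hw s c d) (hab s c d) (abs_nonneg _) (by positivity)
      _ = t * (Real.exp 1 * P.η₁ * (3 / P.T)) := by simp
      _ ≤ P.T * (Real.exp 1 * P.η₁ * (3 / P.T)) := by gcongr
      _ = 3 * (Real.exp 1 * P.η₁) := by field_simp
      _ ≤ 1 / 2 := by
          have := hP.η_le
          have := one_div_hundred_le hP
          linarith
  have e : ∑ s ∈ Finset.Icc 1 t, w s * a s = ∑ s ∈ Finset.Icc 1 t, w s * b s +
      ∑ s ∈ Finset.Icc 1 t, w s * (a s - b s) := by
    rw [← Finset.sum_add_distrib]; exact Finset.sum_congr rfl fun s _ => by ring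
  rw [e]
  exact (abs_add_le _ _).trans (by linarith)

/-- Small deviations of finitely many statistics imply the concentration event. -/
theorem concentrated_of_deviations (h : IsPath P K ℓ x) (hP : Tuned P n) (hT : t ≤ P.T)
    (hh : ∀ s, 1 ≤ s → s ≤ t → Healthy P K ℓ x s)
    (hx : ∀ s, 1 ≤ s → s ≤ t → x s ∈ typicalAt P K ℓ x s)
    {N : Finset (Pt n)} (hN : ∀ y ∈ K, ∃ y' ∈ N, ‖y - y'‖ ≤ ((P.T : ℝ) ^ 7)⁻¹)
    (hdev₁ : |∑ s ∈ Finset.Icc 1 t, P.η₁ * ((typicalAt P K ℓ x s).indicator (ℓ s) (x s) -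
      ∫ e, (typicalAt P K ℓ x s).indicator (ℓ s) e ∂(pathLaw P K ℓ x s))| ≤ 1 / 2)
    (hdev₂ : ∀ y ∈ N, |∑ s ∈ Finset.Icc 1 t, P.η₁ * (min 2 (psiOf P K ℓ x s (x s) y) -
      ∫ e, min 2 (psiOf P K ℓ x s e y) ∂(pathLaw P K ℓ x s))| ≤ 1 / 2)
    (hdev₃ : ∀ y ∈ N, |∑ s ∈ Finset.Icc 1 t, rate P K ℓ x s * (min 2 (psiOf P K ℓ x s (x s) y) -
      ∫ e, min 2 (psiOf P K ℓ x s e y) ∂(pathLaw P K ℓ x s))| ≤ 1 / 2)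
    (hdev₄ : |∑ s ∈ Finset.Icc 1 t, P.η₁ *
      (min 2 (∫ y in focus P K ℓ x s, psiOf P K ℓ x s (x s) y ∂(weights P K ℓ x s)) -
      ∫ e, min 2 (∫ y in focus P K ℓ x s, psiOf P K ℓ x s e y ∂(weights P K ℓ x s))
        ∂(pathLaw P K ℓ x s))| ≤ 1 / 2) :
    Concentrated P K ℓ x t := by
  have hPt := hP.toTame
  have hη := hP.η_pos
  have hηe : |P.η₁| ≤ Real.exp 1 * P.η₁ := by
    rw [abs_of_pos hη]
    have : (1 : ℝ) ≤ Real.exp 1 := Real.one_le_exp zero_le_one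
    nlinarith
  refine max_le (max_le ?_ ?_) (max_le ?_ ?_)
  -- No net and no bias here: every played point is typical, so the indicator can be dropped, and
  -- the mean of the truncated loss under the sampling law is exactly the pairing in `dev₁`.
  · refine ENNReal.ofReal_le_one.2 ?_
    rw [← abs_of_pos hη, ← abs_mul, Finset.mul_sum, ← abs_neg,
      ← Finset.sum_neg_distrib]
    refine le_trans (le_of_eq ?_) (hdev₁.trans (by norm_num))
    congr 1
    refine Finset.sum_congr rfl fun s hs => ?_
    obtain ⟨a, b⟩ := Finset.mem_Icc.1 hs
    rw [indicator_of_mem (hx s a b), pathLaw, typicalAt,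
      ← integral_kernelAdjoint_indicator hPt h.compact.isClosed
      (regular_weights hPt h.toIsBody s) (h.loss s a (b.trans hT))]
    rw [adjTypical, typicalAt]
    ring
  · refine iSup₂_le fun y hy => ENNReal.ofReal_le_one.2 ?_
    obtain ⟨y', hy', hyy'⟩ := hN y (focus_subset t hy)
    rw [toReal_cumEstimate_of_mem hy, ← Finset.sum_sub_distrib, ← abs_of_pos hη, ← abs_mul,
      Finset.mul_sum]
    exact abs_sum_le_of_close (w := fun _ => P.η₁) hP hT (fun _ _ _ => hηe)
      (fun s a b => (hh s a b).abs_deviation_sub_le h hP a (b.trans hT) (focus_anti b hy) hyy' (x s))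
      (hdev₂ y' hy')
  · refine iSup₂_le fun y hy => ENNReal.ofReal_le_one.2 ?_
    obtain ⟨y', hy', hyy'⟩ := hN y (focus_subset t hy)
    have e : ∀ s ∈ Finset.Icc 1 t, rate P K ℓ x s * ((estimate P K ℓ x s y).toReal -
        adjExt P K ℓ x s y) = rate P K ℓ x s * (psiAt P K ℓ x s y - adjExt P K ℓ x s y) :=
      fun s hs => by rw [toReal_estimate_of_mem (focus_anti (Finset.mem_Icc.1 hs).2 hy)]
    rw [Finset.sum_congr rfl e]
    exact abs_sum_le_of_close hP hT (fun s a b => by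
        rw [abs_of_pos (rate_pos hPt s)]; exact (hh s a b).rate_le)
      (fun s a b => (hh s a b).abs_deviation_sub_le h hP a (b.trans hT) (focus_anti b hy) hyy' (x s))
      (hdev₃ y' hy')
  · refine ENNReal.ofReal_le_one.2 ?_
    have e : ∀ s ∈ Finset.Icc 1 t, (∫ y in focus P K ℓ x s, ((estimate P K ℓ x s y).toReal -
        adjExt P K ℓ x s y) ∂(weights P K ℓ x s)) = ∫ y in focus P K ℓ x s,
          (psiOf P K ℓ x s (x s) y - adjExt P K ℓ x s y) ∂(weights P K ℓ x s) := fun s _ =>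
      setIntegral_congr_fun (isClosed_focus hPt h.toIsBody s).measurableSet fun y hy => by
        simp only [toReal_estimate_of_mem hy]; rfl
    rw [Finset.sum_congr rfl e, ← abs_of_pos hη, ← abs_mul, Finset.mul_sum]
    exact abs_sum_le_of_close (w := fun _ => P.η₁) hP hT (fun _ _ _ => hηe)
      (fun s a b => (hh s a b).abs_average_deviation_sub_le h hP a (b.trans hT) (x s)) hdev₄

/-- A finite net of a set of bounded diameter. -/
theorem exists_net (hT : 1 ≤ P.T) (hnT : n ≤ P.T) {c : Pt n} (hK : ∀ y ∈ K, ‖y - c‖ ≤ P.T) :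
    ∃ N : Finset (Pt n), N.card ≤ (2 * P.T ^ 9 + 1) ^ n ∧
      ∀ y ∈ K, ∃ y' ∈ N, ‖y - y'‖ ≤ ((P.T : ℝ) ^ 7)⁻¹ := by
  classical
  have hT0 : (0 : ℝ) < P.T := by exact_mod_cast hT
  have hT1 : (1 : ℝ) ≤ P.T := by exact_mod_cast hT
  -- The net is a grid of spacing `T⁻⁸` reaching `T` in each coordinate. Rounding down costs at most
  -- `√n T⁻⁸ ≤ T⁻⁷`. Grid points need not be in `K`; the formula for the estimate makes sense
  -- everywhere.
  set M : ℤ := (P.T : ℤ) ^ 9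
  set φ : (Fin n → ℤ) → Pt n := fun k =>
    WithLp.toLp 2 fun i => c i + k i * ((P.T : ℝ) ^ 8)⁻¹
  refine ⟨(Fintype.piFinset fun _ : Fin n => Finset.Icc (-M) M).image φ, ?_, fun y hy => ?_⟩
  · refine Finset.card_image_le.trans (le_of_eq ?_)
    rw [Fintype.card_piFinset]
    simp only [Int.card_Icc, Finset.prod_const, Finset.card_univ, Fintype.card_fin, M]
    congr 1
    have : ((P.T : ℤ) ^ 9 + 1 - -(P.T : ℤ) ^ 9) = ((2 * P.T ^ 9 + 1 : ℕ) : ℤ) := by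
      push_cast; ring
    rw [this, Int.toNat_natCast]
  · set k : Fin n → ℤ := fun i => ⌊(y i - c i) * (P.T : ℝ) ^ 8⌋
    have hcoord : ∀ i, |y i - c i| ≤ P.T := fun i => by
      refine le_trans ?_ (hK y hy)
      simpa using PiLp.norm_apply_le (y - c) i
    have hM : ∀ i, |(y i - c i) * (P.T : ℝ) ^ 8| ≤ (M : ℝ) := fun i => by
      rw [abs_mul, abs_of_pos (by positivity : (0 : ℝ) < (P.T : ℝ) ^ 8)]
      simp only [M]
      push_cast
      calc |y i - c i| * (P.T : ℝ) ^ 8 ≤ P.T * (P.T : ℝ) ^ 8 := by gcongr; exact hcoord i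
        _ = _ := by ring
    refine ⟨φ k, Finset.mem_image_of_mem _ (Fintype.mem_piFinset.2 fun i => Finset.mem_Icc.2
      ⟨Int.le_floor.2 ?_, ?_⟩), ?_⟩
    · push_cast; exact (abs_le.1 (hM i)).1
    · exact Int.cast_le.1 ((Int.floor_le _).trans (abs_le.1 (hM i)).2)
    · have hd : ∀ i, ‖(y - φ k) i‖ ≤ ((P.T : ℝ) ^ 8)⁻¹ := fun i => by
        have e : (y - φ k) i = ((y i - c i) * (P.T : ℝ) ^ 8 - k i) * ((P.T : ℝ) ^ 8)⁻¹ := by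
          simp only [φ, PiLp.sub_apply]
          field_simp
          ring
        rw [e, norm_mul, Real.norm_of_nonneg (by positivity : 0 ≤ ((P.T : ℝ) ^ 8)⁻¹)]
        refine mul_le_of_le_one_left (by positivity) ?_
        rw [Real.norm_eq_abs, abs_le]
        have h1 := Int.floor_le ((y i - c i) * (P.T : ℝ) ^ 8)
        have h2 := Int.lt_floor_add_one ((y i - c i) * (P.T : ℝ) ^ 8)
        simp only [k]
        constructor <;> linarith
      rw [EuclideanSpace.norm_eq]
      refine Real.sqrt_le_iff.2 ⟨by positivity, ?_⟩
      have hn : (n : ℝ) ≤ P.T := by exact_mod_cast hnT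
      calc ∑ i, ‖(y - φ k) i‖ ^ 2 ≤ ∑ _ : Fin n, (((P.T : ℝ) ^ 8)⁻¹) ^ 2 := by
            gcongr with i; exact hd i
        _ = n * (((P.T : ℝ) ^ 8)⁻¹) ^ 2 := by simp
        _ ≤ (P.T : ℝ) ^ 2 * (((P.T : ℝ) ^ 8)⁻¹) ^ 2 := by gcongr; nlinarith
        _ = _ := by field_simp

end Deterministic

end KernelBCO

namespace KernelBCO

/-! ### Reduction of a fault to bad events, and the union bound -/

section Fault

variable {n : ℕ} {P : Params} {K : Set (Pt n)}

section Path

variable {ℓ : ℕ → Pt n → ℝ} {x : ℕ → Pt n}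

theorem restartTime_le : restartTime P K ℓ x ≤ P.T := Nat.sInf_le (Or.inr rfl)

theorem not_restarts_of_lt {s : ℕ} (h1 : 1 ≤ s) (hs : s < restartTime P K ℓ x) :
    ¬ Restarts P K ℓ x s := fun h =>
  Nat.notMem_of_lt_sInf hs (Or.inl ⟨h1, hs.le.trans restartTime_le, h⟩)

/-- A fault before the restart time has a first occurrence. -/
theorem exists_fault (hlt : faultTime P K ℓ x < restartTime P K ℓ x) :
    ∃ t, 1 ≤ t ∧ t < restartTime P K ℓ x ∧
      (¬ Concentrated P K ℓ x t ∨ x t ∉ typicalAt P K ℓ x t) ∧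
      ∀ s, 1 ≤ s → s < t → Concentrated P K ℓ x s ∧ ¬ Restarts P K ℓ x s := by
  have hmem : faultTime P K ℓ x ∈ ({t | 1 ≤ t ∧ t ≤ restartTime P K ℓ x ∧
      (¬ Concentrated P K ℓ x t ∨ x t ∉ typicalAt P K ℓ x t)} ∪ {restartTime P K ℓ x}) :=
    Nat.sInf_mem ⟨_, Or.inr rfl⟩
  rcases hmem with ⟨h1, h2, h3⟩ | h
  swap
  -- The set that defines the fault time also contains the restart time; strict inequality excludes
  -- this element.
  · exact absurd h hlt.ne
  refine ⟨_, h1, hlt, h3, fun s hs hst => ⟨?_, not_restarts_of_lt hs (hst.trans hlt)⟩⟩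
  by_contra hc
  exact Nat.notMem_of_lt_sInf hst (Or.inl ⟨hs, (hst.trans hlt).le, Or.inl hc⟩)

end Path

variable {Ω : Type*} {mΩ : MeasurableSpace Ω} {μ : Measure Ω} {ℓ : ℕ → Ω → Pt n → ℝ}
  {X x : ℕ → Ω → Pt n}

/-- The truncated loss. -/
def lossStat (P : Params) (K : Set (Pt n)) (ℓ : ℕ → Ω → Pt n → ℝ) (x : ℕ → Ω → Pt n) (t : ℕ)
    (ω : Ω) : Pt n → ℝ :=
  (typicalAt P K (ℓ · ω) (x · ω) t).indicator (ℓ t ω)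

/-- The loss estimate at `y`. -/
def psiStat (P : Params) (K : Set (Pt n)) (ℓ : ℕ → Ω → Pt n → ℝ) (x : ℕ → Ω → Pt n) (y : Pt n)
    (t : ℕ) (ω : Ω) (z : Pt n) : ℝ :=
  min 2 (psiOf P K (ℓ · ω) (x · ω) t z y)

/-- The average of the loss estimate over the focus region. -/
def averageStat (P : Params) (K : Set (Pt n)) (ℓ : ℕ → Ω → Pt n → ℝ) (x : ℕ → Ω → Pt n)
    (t : ℕ) (ω : Ω) (z : Pt n) : ℝ :=
  min 2 (∫ y in focus P K (ℓ · ω) (x · ω) t, psiOf P K (ℓ · ω) (x · ω) t z y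
    ∂(weights P K (ℓ · ω) (x · ω) t))

theorem Game.statistic_lossStat (hG : Game P K mΩ ℓ X x) (hP : Tame P n) :
    Statistic P K ℓ x (lossStat P K ℓ x) where
  measurable t h1 hT := @Observed.measurable_indicator n P K Ω (history K ℓ x t) ℓ x t
    (hG.observed hP h1 hT)
  mem t h1 hT ω z := by
    have := indicator_loss_mem (P := P) ((hG.path ω).loss t h1 hT)
      (weights P K (ℓ · ω) (x · ω) t) z
    exact ⟨this.1, this.2.trans (by norm_num)⟩

/-- The cap at 2 gives the bound on every path and at every net point, even outside the region. In a
good state the cap is inactive near the region. -/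
theorem Game.statistic_psiStat (hG : Game P K mΩ ℓ X x) (hP : Tame P n) (y : Pt n) :
    Statistic P K ℓ x (psiStat P K ℓ x y) where
  measurable t h1 hT := by
    have h := @Observed.measurable_psi n P K Ω (history K ℓ x t) ℓ x t (hG.observed hP h1 hT)
      (Ω × Pt n) ((history K ℓ x t).prod inferInstance) Prod.fst Prod.snd (fun _ => y)
      measurable_fst measurable_snd measurable_const
    exact measurable_const.min h
  mem t h1 hT ω z := ⟨le_min (by norm_num) (psiOf_nonneg _ _), min_le_left _ _⟩

theorem Game.statistic_averageStat (hG : Game P K mΩ ℓ X x) (hP : Tame P n) :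
    Statistic P K ℓ x (averageStat P K ℓ x) where
  measurable t h1 hT := measurable_const.min (@Observed.measurable_setIntegral_psi n P K Ω
    (history K ℓ x t) ℓ x t (hG.observed hP h1 hT))
  mem t h1 hT ω z := ⟨le_min (by norm_num) (integral_nonneg fun _ => psiOf_nonneg _ _),
    min_le_left _ _⟩

theorem weighting_const (hP : Tame P n) : Weighting P K ℓ x fun _ _ => P.η₁ where
  measurable t _ _ := measurable_const
  abs_le t ω := by
    rw [abs_of_pos hP.η_pos]
    exact le_mul_of_one_le_left hP.η_pos.le (Real.one_le_exp zero_le_one)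

/-- As with the statistics, the cap `e η₁` makes the bound hold on all paths and is inactive in a
good state. -/
theorem Game.weighting_rate (hG : Game P K mΩ ℓ X x) (hP : Tame P n) :
    Weighting P K ℓ x fun t ω => min (rate P K (ℓ · ω) (x · ω) t) (Real.exp 1 * P.η₁) where
  measurable t h1 hT := (@Observed.measurable_rate n P K Ω (history K ℓ x t) ℓ x t
    (hG.observed hP h1 hT)).min measurable_const
  abs_le t ω := by
    have := rate_pos (K := K) (ℓ := (ℓ · ω)) (x := (x · ω)) hP t
    have := hP.η_pos
    rw [abs_of_nonneg (by positivity)]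
    exact min_le_right _ _

/-- The event that a weighted statistic deviates from its mean in round `t`. -/
def deviates (P : Params) (K : Set (Pt n)) (μ : Measure Ω) (ℓ : ℕ → Ω → Pt n → ℝ)
    (X x : ℕ → Ω → Pt n) (w : ℕ → Ω → ℝ) (f : ℕ → Ω → Pt n → ℝ) (t : ℕ) : Set Ω :=
  {ω | 1 / 2 ≤ |∑ s ∈ Finset.Icc 1 t, increment P K μ ℓ X x w f s ω|}

/-- The event of a fault in round `t`, in terms of a net. -/
def badSet (P : Params) (K : Set (Pt n)) (μ : Measure Ω) (ℓ : ℕ → Ω → Pt n → ℝ)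
    (X x : ℕ → Ω → Pt n) (N : Finset (Pt n)) (t : ℕ) : Set Ω :=
  {ω | ω ∈ goodSet P K μ ℓ X x t ∧ X t ω ∉ typicalAt P K (ℓ · ω) (x · ω) t} ∪
  (deviates P K μ ℓ X x (fun _ _ => P.η₁) (lossStat P K ℓ x) t ∪
  (deviates P K μ ℓ X x (fun _ _ => P.η₁) (averageStat P K ℓ x) t ∪
  ⋃ y ∈ N, (deviates P K μ ℓ X x (fun _ _ => P.η₁) (psiStat P K ℓ x y) t ∪
    deviates P K μ ℓ X x (fun t ω => min (rate P K (ℓ · ω) (x · ω) t) (Real.exp 1 * P.η₁))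
      (psiStat P K ℓ x y) t)))

theorem Game.measure_badSet_le [IsProbabilityMeasure μ] (hG : Game P K mΩ ℓ X x)
    (hP : Calibrated P n) (N : Finset (Pt n)) {t : ℕ} (h1 : 1 ≤ t) (hT : t ≤ P.T) :
    μ (badSet P K μ ℓ X x N t) ≤ ENNReal.ofReal ((P.T : ℝ) ^ 4)⁻¹ +
      (2 + 2 * N.card) * ENNReal.ofReal ((P.T : ℝ) ^ (20 * n))⁻¹ := by
  have hPt := hP.toTame
  set δ := ENNReal.ofReal ((P.T : ℝ) ^ (20 * n))⁻¹
  have hη := weighting_const (K := K) (ℓ := ℓ) (x := x) hPt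
  have hr := hG.weighting_rate hPt
  have key : ∀ (w f), Weighting P K ℓ x w → Statistic P K ℓ x f →
    μ (deviates P K μ ℓ X x w f t) ≤ δ := fun w f hw hf =>
      hG.measure_sum_increment_le hP hf hw hT
  refine (measure_union_le _ _).trans (add_le_add (hG.measure_not_typical_le hPt h1 hT) ?_)
  refine (measure_union_le _ _).trans
    ((add_le_add (key _ _ hη (hG.statistic_lossStat hPt)) ((measure_union_le _ _).trans
    (add_le_add (key _ _ hη (hG.statistic_averageStat hPt))
      (measure_biUnion_finset_le _ _)))).trans ?_)
  have : ∑ y ∈ N, μ (deviates P K μ ℓ X x (fun _ _ => P.η₁) (psiStat P K ℓ x y) t ∪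
    deviates P K μ ℓ X x (fun t ω => min (rate P K (ℓ · ω) (x · ω) t) (Real.exp 1 * P.η₁))
      (psiStat P K ℓ x y) t) ≤ ∑ _ ∈ N, (δ + δ) := by
    refine Finset.sum_le_sum fun y _ => (measure_union_le _ _).trans ?_
    exact add_le_add (key _ _ hη (hG.statistic_psiStat hPt y))
      (key _ _ hr (hG.statistic_psiStat hPt y))
  refine (add_le_add le_rfl (add_le_add le_rfl this)).trans (le_of_eq ?_)
  rw [Finset.sum_const, nsmul_eq_mul]
  ring

/-- A fault before the restart time is a bad event of some round. -/
theorem Game.mem_badSet_of_fault (hG : Game P K mΩ ℓ X x) (hP : Tuned P n)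
    {N : Finset (Pt n)} (hN : ∀ y ∈ K, ∃ y' ∈ N, ‖y - y'‖ ≤ ((P.T : ℝ) ^ 7)⁻¹) {ω : Ω}
    (hlaw : ∀ t, 1 ≤ t → t ≤ restartTime P K (ℓ · ω) (x · ω) → ∀ B ∈ basicSets n,
      (μ[(X t ⁻¹' B).indicator fun _ => (1 : ℝ) | history K ℓ x t]) ω =
        (drawLaw P K ℓ x t ω).real B)
    (hlt : faultTime P K (ℓ · ω) (x · ω) < restartTime P K (ℓ · ω) (x · ω)) :
    ∃ t ∈ Finset.Icc 1 P.T, ω ∈ badSet P K μ ℓ X x N t := by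
  obtain ⟨t, h1, htτ, hfault, hgood⟩ := exists_fault hlt
  have hτT : restartTime P K (ℓ · ω) (x · ω) ≤ P.T := restartTime_le
  have hT : t ≤ P.T := htτ.le.trans hτT
  have h := hG.path ω
  by_contra! hbad
  have hh : ∀ s, 1 ≤ s → s ≤ t → Healthy P K (ℓ · ω) (x · ω) s := fun s a b =>
    healthy_of_forall_lt h hP a (b.trans hT) fun r c d => hgood r c (d.trans_le b)
  -- Both halves of the good event: the law is as prescribed since `s` is not after the restart
  -- time, and a healthy state makes atypical draws unlikely.
  have hgs : ∀ s, 1 ≤ s → s ≤ t → ω ∈ goodSet P K μ ℓ X x s := fun s a b =>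
    ⟨hlaw s a (b.trans htτ.le), (hh s a b).kernelLaw_compl_typicalAt_le h hP a⟩
  have hX : ∀ s, 1 ≤ s → s ≤ t → x s ω ∈ typicalAt P K (ℓ · ω) (x · ω) s := by
    intro s a b
    have h2 : X s ω ∈ typicalAt P K (ℓ · ω) (x · ω) s := by
      by_contra hn
      exact hbad s (Finset.mem_Icc.2 ⟨a, b.trans hT⟩) (Or.inl ⟨hgs s a b, hn⟩)
    rwa [hG.point_eq s a (b.trans hT) ω h2.1]
  have hnb := hbad t (Finset.mem_Icc.2 ⟨h1, hT⟩)
  simp only [badSet, mem_union, mem_iUnion, not_or, not_exists] at hnb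
  obtain ⟨-, hb1, hb2, hb3⟩ := hnb
  -- All rounds up to `t` are good, so no increment was set to zero and the controlled sum is the
  -- actual one.
  have conv : ∀ (w : ℕ → Ω → ℝ) (f : ℕ → Ω → Pt n → ℝ), ω ∉ deviates P K μ ℓ X x w f t →
      |∑ s ∈ Finset.Icc 1 t, w s ω * (f s ω (x s ω) -
        ∫ e, f s ω e ∂(pathLaw P K (ℓ · ω) (x · ω) s))| ≤ 1 / 2 := by
    intro w f hwf
    have h2 : |∑ s ∈ Finset.Icc 1 t, increment P K μ ℓ X x w f s ω| ≤ 1 / 2 := by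
      by_contra hc
      exact hwf (not_le.1 hc).le
    refine le_trans (le_of_eq ?_) h2
    congr 1
    refine Finset.sum_congr rfl fun s hs => ?_
    obtain ⟨a, b⟩ := Finset.mem_Icc.1 hs
    rw [increment, indicator_of_mem (hgs s a b)]
    rfl
  have hconc : Concentrated P K (ℓ · ω) (x · ω) t := by
    refine concentrated_of_deviations h hP hT hh hX hN (conv _ _ hb1)
      (fun y hy => conv _ _ (hb3 y hy).1) (fun y hy => ?_) (conv _ _ hb2)
    refine le_trans (le_of_eq ?_) (conv _ _ (hb3 y hy).2)
    congr 1
    refine Finset.sum_congr rfl fun s hs => ?_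
    obtain ⟨a, b⟩ := Finset.mem_Icc.1 hs
    rw [min_eq_left (hh s a b).rate_le]
    rfl
  rcases hfault with hf | hf
  · exact hf hconc
  · exact hf (hX t h1 le_rfl)

/-- Each round contributes `T⁻⁴` for an atypical draw and at most another `T⁻⁴` for all deviations
together; summing over `T` rounds gives `2 T⁻³ < 2 T⁻²`. -/
theorem Game.measure_fault_lt [IsProbabilityMeasure μ] (hG : Game P K mΩ ℓ X x)
    (hP : Calibrated P n) (hlaw : ∀ t, 1 ≤ t → t ≤ P.T → ∀ B : Set (Pt n), MeasurableSet B →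
      ∀ᵐ ω ∂μ, t ≤ restartTime P K (ℓ · ω) (x · ω) →
      (μ[(X t ⁻¹' B).indicator fun _ => (1 : ℝ) | history K ℓ x t]) ω =
        (drawLaw P K ℓ x t ω).real B) :
    μ {ω | faultTime P K (ℓ · ω) (x · ω) < restartTime P K (ℓ · ω) (x · ω)} <
      ENNReal.ofReal (2 / (P.T : ℝ) ^ 2) := by
  have hT0 := hP.T_pos
  have hT1 := hP.T_ge
  have hn := hP.one_le
  have hTn : 1 ≤ P.T := by exact_mod_cast (show (1 : ℝ) ≤ P.T by linarith)
  have hnT : n ≤ P.T := by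
    have := hP.n_le
    have h3 : (0 : ℝ) ≤ n := n.cast_nonneg
    exact_mod_cast (show (n : ℝ) ≤ P.T by linarith)
  obtain ⟨N, hNc, hN⟩ : ∃ N : Finset (Pt n), N.card ≤ (2 * P.T ^ 9 + 1) ^ n ∧
      ∀ y ∈ K, ∃ y' ∈ N, ‖y - y'‖ ≤ ((P.T : ℝ) ^ 7)⁻¹ := by
    -- The diameter bound is part of the data of a path, so some outcome is needed; a probability
    -- space has one.
    rcases isEmpty_or_nonempty Ω with hΩ | ⟨⟨ω⟩⟩
    · exact absurd (measure_univ (μ := μ)) (by rw [univ_eq_empty_iff.2 hΩ]; simp)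
    · obtain ⟨c, hc⟩ := hG.body.nonempty_interior
      exact exists_net hTn hnT fun y hy => (hG.path ω).diam y hy c (interior_subset hc)
  -- The exceptional null set of the prescribed law depends on `B`; restricting to a countable
  -- algebra leaves a single null set.
  have hae : ∀ᵐ ω ∂μ, ∀ t, 1 ≤ t → t ≤ P.T → ∀ B ∈ basicSets n,
      t ≤ restartTime P K (ℓ · ω) (x · ω) →
      (μ[(X t ⁻¹' B).indicator fun _ => (1 : ℝ) | history K ℓ x t]) ω =
        (drawLaw P K ℓ x t ω).real B := by
    refine ae_all_iff.2 fun t => ?_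
    by_cases h1 : 1 ≤ t
    swap
    · exact Filter.Eventually.of_forall fun ω h => absurd h h1
    by_cases hT : t ≤ P.T
    swap
    · exact Filter.Eventually.of_forall fun ω _ h => absurd h hT
    refine Filter.Eventually.mono ?_ fun ω h _ _ => h
    exact (ae_ball_iff (countable_basicSets n)).2 fun B hB =>
      hlaw t h1 hT B (measurableSet_of_mem_basicSets hB)
  have h1 : μ {ω | faultTime P K (ℓ · ω) (x · ω) < restartTime P K (ℓ · ω) (x · ω)} ≤
      μ (⋃ t ∈ Finset.Icc 1 P.T, badSet P K μ ℓ X x N t) := by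
    refine measure_mono_ae ?_
    filter_upwards [hae] with ω hω hlt
    obtain ⟨t, ht, hb⟩ := hG.mem_badSet_of_fault hP.toTuned hN
      (fun t h1 hτ B hB => hω t h1 (hτ.trans restartTime_le) B hB hτ) hlt
    exact mem_iUnion₂.2 ⟨t, ht, hb⟩
  refine (h1.trans (measure_biUnion_finset_le _ _)).trans_lt ?_
  have h2 : ∀ t ∈ Finset.Icc 1 P.T, μ (badSet P K μ ℓ X x N t) ≤
      ENNReal.ofReal (2 * ((P.T : ℝ) ^ 4)⁻¹) := by
    intro t ht
    obtain ⟨a, b⟩ := Finset.mem_Icc.1 ht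
    refine (hG.measure_badSet_le hP N a b).trans ?_
    have hc : (2 + 2 * (N.card : ℝ≥0∞)) = ENNReal.ofReal (2 + 2 * (N.card : ℝ)) := by
      rw [ENNReal.ofReal_add (by norm_num) (by positivity), ENNReal.ofReal_mul (by norm_num)]
      simp
    rw [hc, ← ENNReal.ofReal_mul (by positivity), ← ENNReal.ofReal_add (by positivity)
      (by positivity), two_mul ((P.T : ℝ) ^ 4)⁻¹]
    refine ENNReal.ofReal_le_ofReal (add_le_add le_rfl ?_)
    have hN1 : (N.card : ℝ) ≤ (P.T : ℝ) ^ (10 * n) := by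
      have h3 : (N.card : ℝ) ≤ (2 * (P.T : ℝ) ^ 9 + 1) ^ n := by exact_mod_cast hNc
      refine h3.trans ?_
      rw [pow_mul]
      have h4 : (1 : ℝ) ≤ (P.T : ℝ) ^ 9 := one_le_pow₀ (by linarith)
      gcongr
      rw [pow_succ]
      nlinarith
    have h5 : (1 : ℝ) ≤ (P.T : ℝ) ^ (10 * n) := one_le_pow₀ (by linarith)
    have h6 : 2 + 2 * (N.card : ℝ) ≤ P.T * (P.T : ℝ) ^ (10 * n) := by nlinarith
    rw [← div_eq_mul_inv, div_le_iff₀ (by positivity), inv_mul_eq_div, le_div_iff₀ (by positivity)]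
    calc (2 + 2 * (N.card : ℝ)) * (P.T : ℝ) ^ 4 ≤ (P.T * (P.T : ℝ) ^ (10 * n)) * (P.T : ℝ) ^ 4 := by
          gcongr
      _ = (P.T : ℝ) ^ (10 * n + 5) := by ring
      -- `10 n + 5 ≤ 20 n` because `n ≥ 1`: the deviation probability outweighs the size of the net.
      _ ≤ _ := pow_le_pow_right₀ (by linarith) (by omega)
  refine (Finset.sum_le_sum h2).trans_lt ?_
  rw [Finset.sum_const, nsmul_eq_mul, Nat.card_Icc, Nat.add_sub_cancel,
    ← ENNReal.ofReal_natCast, ← ENNReal.ofReal_mul (by positivity)]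
  refine (ENNReal.ofReal_lt_ofReal_iff (by positivity)).2 ?_
  rw [lt_div_iff₀ (by positivity)]
  have e : (P.T : ℝ) * (2 * ((P.T : ℝ) ^ 4)⁻¹) * (P.T : ℝ) ^ 2 = 2 * (P.T : ℝ)⁻¹ := by field_simp
  rw [e]
  have : (P.T : ℝ)⁻¹ < 1 := inv_lt_one_of_one_lt₀ (by linarith)
  linarith

end Fault

end KernelBCO

namespace KernelBCO

/-! ### Numerical verification of the parameters -/

section Parameters

variable {n T : ℕ}

/-- The square root of `lam`. -/
theorem params_lam_eq (hn : 1 ≤ n) (hM : 1 ≤ Real.log T) : ∃ s : ℝ, 0 < s ∧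
    (params n T).lam = s ^ 2 ∧ √(params n T).lam = s ∧
    n * (params n T).α * s = (params n T).ε ^ 2 / (1000 * (n * Real.log T)) := by
  have hN : (1 : ℝ) ≤ n := by exact_mod_cast hn
  have he := Real.exp_pos 1
  have hα : 0 < (params n T).α := by simp only [params]; positivity
  have hε : 0 < (params n T).ε := by simp only [params]; positivity
  have hs : 0 < (params n T).ε ^ 2 / (1000 * n ^ 2 * (params n T).α * Real.log T) := by positivity
  have h : (params n T).lam =
      ((params n T).ε ^ 2 / (1000 * n ^ 2 * (params n T).α * Real.log T)) ^ 2 := by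
    have : (params n T).lam = (params n T).ε ^ 4 /
        ((10 ^ 3) ^ 2 * (n : ℝ) ^ 4 * (params n T).α ^ 2 * Real.log T ^ 2) := rfl
    rw [this, div_pow]
    ring
  refine ⟨_, hs, h, by rw [h, Real.sqrt_sq hs.le], ?_⟩
  field_simp

theorem params_ε_bounds : 0 < (params n T).ε ∧ (params n T).ε ≤ 1 / 4000 := by
  have := Real.exp_one_gt_d9
  refine ⟨by simp only [params]; positivity, ?_⟩
  simp only [params]
  rw [div_le_div_iff₀ (by positivity) (by positivity)]
  linarith

theorem params_α_bounds : 10 ^ 6 * ((n : ℝ) ^ 2 * Real.log T ^ 2) ≤ (params n T).α ∧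
    (params n T).α ≤ 10 ^ 14 * ((n : ℝ) ^ 2 * Real.log T ^ 2) := by
  have h1 := Real.exp_one_gt_d9
  have h2 := Real.exp_one_lt_d9
  have e : (params n T).α = (2 * Real.exp 1) ^ 17 * ((n : ℝ) ^ 2 * Real.log T ^ 2) := by
    simp only [params]; ring
  have h3 : (10 : ℝ) ^ 6 ≤ (2 * Real.exp 1) ^ 17 :=
    le_trans (by norm_num : (10 : ℝ) ^ 6 ≤ 5 ^ 17) (by gcongr; linarith)
  have h4 : (2 * Real.exp 1) ^ 17 ≤ (10 : ℝ) ^ 14 :=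
    le_trans (b := (6 : ℝ) ^ 17) (by gcongr; linarith) (by norm_num)
  rw [e]
  constructor <;> gcongr

/-- The bounds on the kernel parameters that follow from their definitions. -/
theorem params_kernel_bounds (hn : 1 ≤ n) (hM : 1 ≤ Real.log T) : ∃ s u : ℝ, 0 < s ∧ s ≤ 1 / 1000 ∧
    0 < u ∧ u ≤ 1 / 1000 ∧ (params n T).lam = s ^ 2 ∧ √(params n T).lam = s ∧
    n * (params n T).α * s = u ∧ 0 < coreVar (params n T) n ∧
    (n * Real.log T) ≤ sharpness (params n T) n * s ^ 2 * (params n T).ε ^ 2 ∧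
    sharpness (params n T) n * s ^ 2 * u ≤ 1 / 500 := by
  have hN : (1 : ℝ) ≤ n := by exact_mod_cast hn
  obtain ⟨hε, hε'⟩ := @params_ε_bounds n T
  obtain ⟨hα, -⟩ := @params_α_bounds n T
  obtain ⟨s, hs, hl, hsq, hu⟩ := params_lam_eq hn hM
  have hNM : 1 ≤ n * Real.log T := one_le_mul_of_one_le_of_one_le hN hM
  have hα1 : 1 ≤ (params n T).α := by
    have : (1 : ℝ) ≤ (n : ℝ) ^ 2 * Real.log T ^ 2 :=
      one_le_mul_of_one_le_of_one_le (one_le_pow₀ hN) (one_le_pow₀ hM)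
    linarith
  have hε2 : (params n T).ε ^ 2 ≤ 1 := by nlinarith
  have hu1 : n * (params n T).α * s ≤ 1 / 1000 := by
    rw [hu, div_le_div_iff₀ (by positivity) (by positivity)]
    nlinarith
  have hs1 : s ≤ 1 / 1000 := by
    refine le_trans ?_ hu1
    have : 1 ≤ n * (params n T).α := one_le_mul_of_one_le_of_one_le hN hα1
    nlinarith
  have hs2 : s ^ 2 ≤ 1 / 1000 := by nlinarith
  have hcore : coreVar (params n T) n =
      (params n T).ε ^ 2 / (n * Real.log T) * (s ^ 2 / (2 - s ^ 2)) := by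
    rw [← hl]; rfl
  have hd : 0 < 2 - s ^ 2 := by linarith
  have hd' : 0 < 1 - s ^ 2 := by linarith
  have hcp : 0 < coreVar (params n T) n := by rw [hcore]; positivity
  -- The last factor lies between 1 and 2, so this product is of order `n log T`. It gives both the
  -- decay of the Gaussian tails and, after division by `1000 n log T`, the smallness of the
  -- variation of the kernel.
  have hb : sharpness (params n T) n * s ^ 2 * (params n T).ε ^ 2 =
      n * Real.log T * ((2 - s ^ 2) / (2 * (1 - s ^ 2) ^ 2)) := by
    unfold sharpness
    rw [hcore, hl]
    field_simp
  refine ⟨s, _, hs, hs1, by positivity, hu1, hl, hsq, rfl, hcp, ?_, ?_⟩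
  · rw [hb]
    refine le_mul_of_one_le_right (by positivity) ?_
    rw [one_le_div (by positivity)]
    nlinarith [sq_nonneg s]
  · have : sharpness (params n T) n * s ^ 2 * (n * (params n T).α * s) =
        (sharpness (params n T) n * s ^ 2 * (params n T).ε ^ 2) / (1000 * (n * Real.log T)) := by
      rw [hu]; ring
    rw [this, hb, div_le_iff₀ (by positivity)]
    have h : (2 - s ^ 2) / (2 * (1 - s ^ 2) ^ 2) ≤ 2 := by
      rw [div_le_iff₀ (by positivity)]
      nlinarith [sq_nonneg s]
    nlinarith

theorem params_rate_eq :
    Real.exp 1 * (params n T).η₁ = (20 * Real.exp 1 * √(n * T * Real.log T))⁻¹ := by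
  have := Real.exp_pos 1
  simp only [params]
  field_simp

/-- The volume bound gives `k ≤ 4 n log₂ T`, and `γ = 1 / (5 n log₂ T)` leaves room for one more
cut: `(k + 1) γ ≤ 1`. -/
theorem params_growth (hn : 1 ≤ n) (hM : 1 ≤ Real.log T) (k : ℕ)
    (hk : (2 : ℝ) ^ k ≤ (T : ℝ) ^ (4 * n)) : (1 + (params n T).γ) ^ (k + 1) ≤ Real.exp 1 := by
  have hN : (1 : ℝ) ≤ n := by exact_mod_cast hn
  have hl2 : 0 < Real.log 2 := Real.log_pos (by norm_num)
  have hl2' : Real.log 2 ≤ 1 := by linarith [Real.log_two_lt_d9]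
  have hB : 1 ≤ Real.logb 2 T := by
    rw [Real.logb, one_le_div hl2]; linarith
  have hk' : (k : ℝ) ≤ 4 * n * Real.logb 2 T := by
    have h := Real.log_le_log (by positivity) hk
    rw [Real.log_pow, Real.log_pow] at h
    rw [Real.logb, ← mul_div_assoc, le_div_iff₀ hl2]
    push_cast at h
    exact h
  have hγ : (params n T).γ = 1 / (5 * n * Real.logb 2 T) := rfl
  have hγ0 : 0 ≤ (params n T).γ := by rw [hγ]; positivity
  calc (1 + (params n T).γ) ^ (k + 1) ≤ Real.exp (params n T).γ ^ (k + 1) := by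
        gcongr; linarith [Real.add_one_le_exp (params n T).γ]
    _ = Real.exp ((k + 1 : ℕ) * (params n T).γ) := by rw [Real.exp_nat_mul]
    _ ≤ _ := by
      refine Real.exp_le_exp.2 ?_
      rw [hγ, mul_one_div, div_le_one (by positivity)]
      push_cast
      have : 1 ≤ n * Real.logb 2 T := one_le_mul_of_one_le_of_one_le hN hB
      linarith

theorem sqrt_two_pow_le_exp : √((2 : ℝ) ^ n) ≤ Real.exp n := by
  have h1 : (1 : ℝ) ≤ 2 ^ n := one_le_pow₀ (by norm_num)
  have h2 := Real.exp_one_gt_d9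
  calc √((2 : ℝ) ^ n) ≤ 2 ^ n := Real.sqrt_le_iff.2 ⟨by positivity, by nlinarith⟩
    _ ≤ Real.exp 1 ^ n := by gcongr; linarith
    _ = Real.exp n := by rw [← Real.exp_nat_mul, mul_one]

/-- With `c = e η₁` the exponent to minimize is `-θ/2 + 4 θ² c² T`. The minimizer `1 / (16 c² T)` is
`25 e² n log T`, with minimum `-(25/4) e² n log T`. As `e² ≥ 7`, this beats `-20 n log T` with room
for the constants. -/
theorem params_exists_exponent (hn : 1 ≤ n) (hM : 1 ≤ Real.log T) (hT : 1000 ≤ (T : ℝ))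
    (hS : 1000 * (n * Real.log T) ≤ √(T : ℝ)) :
    ∃ θ : ℝ, 0 ≤ θ ∧ 2 * (θ * (Real.exp 1 * (params n T).η₁)) ≤ 1 ∧
      2 * (Real.exp (-(θ / 2)) * (1 + (2 * (θ * (Real.exp 1 * (params n T).η₁))) ^ 2 +
        3 * ((T : ℝ) ^ 4)⁻¹) ^ T) ≤ ((T : ℝ) ^ (20 * n))⁻¹ := by
  have hN : (1 : ℝ) ≤ n := by exact_mod_cast hn
  have he := Real.exp_one_gt_d9
  have he' := Real.exp_one_lt_d9
  have hT0 : (0 : ℝ) < T := by linarith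
  set e := Real.exp 1 with hedef
  set y := n * Real.log T with hy
  have hy1 : 1 ≤ y := one_le_mul_of_one_le_of_one_le hN hM
  have hR : √(n * T * Real.log T) ^ 2 = y * T := by
    rw [Real.sq_sqrt (by positivity), hy]; ring
  have hR0 : 0 < √(n * T * Real.log T) := Real.sqrt_pos.2 (by positivity)
  have hz : (2 * (25 * e ^ 2 * y * (e * (params n T).η₁))) ^ 2 = 25 / 4 * e ^ 2 * y / T := by
    rw [params_rate_eq, ← hedef]
    have : (2 * (25 * e ^ 2 * y * (20 * e * √(n * T * Real.log T))⁻¹)) ^ 2 =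
        25 / 4 * e ^ 2 * y ^ 2 / √(n * T * Real.log T) ^ 2 := by
      field_simp; norm_num
    rw [this, hR]
    field_simp
  have hTy : 1000 ^ 2 * y ^ 2 ≤ T := by
    have := Real.sq_sqrt hT0.le
    have h := pow_le_pow_left₀ (by positivity) hS 2
    rw [this, mul_pow] at h
    exact h
  have hη : 0 ≤ (params n T).η₁ := by simp only [params]; positivity
  refine ⟨25 * e ^ 2 * y, by positivity, ?_, ?_⟩
  · refine (pow_le_one_iff_of_nonneg (by positivity) two_ne_zero).1 ?_
    rw [hz, div_le_one hT0]
    have : e ^ 2 ≤ 9 := by nlinarith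
    nlinarith
  · rw [hz]
    have h1 : (1 + 25 / 4 * e ^ 2 * y / T + 3 * ((T : ℝ) ^ 4)⁻¹) ^ T ≤
        Real.exp (25 / 4 * e ^ 2 * y + 1) := by
      calc _ ≤ Real.exp (25 / 4 * e ^ 2 * y / T + 3 * ((T : ℝ) ^ 4)⁻¹) ^ T := by
            gcongr
            linarith [Real.add_one_le_exp (25 / 4 * e ^ 2 * y / T + 3 * ((T : ℝ) ^ 4)⁻¹)]
        _ = Real.exp (T * (25 / 4 * e ^ 2 * y / T + 3 * ((T : ℝ) ^ 4)⁻¹)) := by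
            rw [Real.exp_nat_mul]
        _ ≤ _ := by
            refine Real.exp_le_exp.2 ?_
            rw [mul_add, mul_div_cancel₀ _ hT0.ne']
            gcongr
            have : (T : ℝ) * (3 * ((T : ℝ) ^ 4)⁻¹) = 3 / T ^ 3 := by field_simp
            rw [this, div_le_one (by positivity)]
            have : (T : ℝ) ≤ T ^ 3 := le_self_pow₀ (by linarith) (by norm_num)
            linarith
    have h2 : ((T : ℝ) ^ (20 * n))⁻¹ = Real.exp (-(20 * y)) := by
      rw [Real.exp_neg, show 20 * y = (20 * n : ℕ) * Real.log T by rw [hy]; push_cast; ring,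
        Real.exp_nat_mul, Real.exp_log hT0]
    rw [h2]
    calc _ ≤ Real.exp 1 * (Real.exp (-(25 * e ^ 2 * y / 2)) *
            Real.exp (25 / 4 * e ^ 2 * y + 1)) := by
          gcongr; linarith
      _ = Real.exp (1 + (-(25 * e ^ 2 * y / 2) + (25 / 4 * e ^ 2 * y + 1))) := by
          rw [Real.exp_add 1, Real.exp_add (-_)]
      _ ≤ _ := by
          refine Real.exp_le_exp.2 ?_
          have : 7 ≤ e ^ 2 := by nlinarith
          nlinarith

-- With `y = n log T`, the size hypothesis is used as `1000 y ≤ √T`, for the rate and the exponent,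
-- and as `2 ^ 60 y ^ 8 ≤ T`, which dominates polynomial quantities such as `80 n α`, of order `10 ^
-- 16 y ^ 3`. The kernel conditions follow from the definitions of `ε`, `α` and `lam` alone once `n`
-- and `log T` are at least 1.
set_option maxHeartbeats 2000000 in
theorem calibrated_params (hn : 1 ≤ n) (hT : 1000 ≤ T)
    (hS : 2 ^ 30 * (n : ℝ) ^ 8 * Real.log T ^ 8 ≤ √(T : ℝ)) : Calibrated (params n T) n := by
  have hN : (1 : ℝ) ≤ n := by exact_mod_cast hn
  have hT' : (1000 : ℝ) ≤ T := by exact_mod_cast hT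
  have hT0 : (0 : ℝ) < T := by linarith
  have he := Real.exp_one_gt_d9
  have he' := Real.exp_one_lt_d9
  have hM : 1 ≤ Real.log T := by
    rw [Real.le_log_iff_exp_le hT0]; linarith
  have hNM : 1 ≤ n * Real.log T := one_le_mul_of_one_le_of_one_le hN hM
  have hSy : 2 ^ 30 * (n * Real.log T) ^ 8 ≤ √(T : ℝ) := by
    rw [mul_pow, ← mul_assoc]; exact hS
  have hp8 : (n * Real.log T) ^ 4 ≤ (n * Real.log T) ^ 8 := pow_le_pow_right₀ hNM (by norm_num)
  have hp1 : n * Real.log T ≤ (n * Real.log T) ^ 8 := le_self_pow₀ hNM (by norm_num)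
  have hNy : (n : ℝ) ≤ n * Real.log T := le_mul_of_one_le_right (by linarith) hM
  have hsqT : √(T : ℝ) ^ 2 = T := Real.sq_sqrt hT0.le
  have hTS : 2 ^ 60 * (n * Real.log T) ^ 8 ≤ T := by
    have h := pow_le_pow_left₀ (by positivity) hSy 2
    rw [hsqT] at h
    refine le_trans ?_ h
    nlinarith [one_le_pow₀ (n := 8) hNM]
  have hsqTn : 1000 * (n * Real.log T) ≤ √(T : ℝ) := by nlinarith
  obtain ⟨hε, hε'⟩ := @params_ε_bounds n T
  obtain ⟨hα, hα'⟩ := @params_α_bounds n T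
  obtain ⟨s, u, hs, hs1, hu, hu1, hl, hsq, hus, hcp, hb, hbu⟩ := params_kernel_bounds hn hM
  have hε2 : (params n T).ε ^ 2 ≤ 1 / 4 := by nlinarith
  have hs2 : s ^ 2 ≤ 1 := by nlinarith
  have hαp : 0 < (params n T).α := lt_of_lt_of_le (by positivity) hα
  have hb0 : 0 < sharpness (params n T) n * s ^ 2 :=
    pos_of_mul_pos_left (lt_of_lt_of_le (by linarith) hb) (by positivity)
  have hbpos : 0 < sharpness (params n T) n := pos_of_mul_pos_left hb0 (by positivity)
  have hbN : 4 * (n * Real.log T) ≤ sharpness (params n T) n := by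
    have h1 : n * Real.log T ≤ sharpness (params n T) n * s ^ 2 * (1 / 4) :=
      hb.trans (by gcongr)
    nlinarith
  have hroot : √(T : ℝ) ≤ √(n * T * Real.log T) := by
    refine Real.sqrt_le_sqrt ?_
    nlinarith
  have hrate : 2 * (Real.exp 1 * (params n T).η₁) ≤ 1 / (100 * n) := by
    rw [params_rate_eq, ← div_eq_mul_inv, div_le_div_iff₀ (by positivity) (by positivity)]
    nlinarith
  have hrad : 10 * n * (params n T).α * (params n T).lam + 20 * √(params n T).lam * (params n T).ε =
      s * (10 * u + 20 * (params n T).ε) := by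
    rw [hsq, hl, ← hus]; ring
  have hsqn : √(n : ℝ) ≤ n := Real.sqrt_le_iff.2 ⟨by linarith, by nlinarith⟩
  have hsqn0 : 0 < √(n : ℝ) := Real.sqrt_pos.2 (by linarith)
  have hn2 : (n : ℝ) ^ 2 ≤ n ^ 2 * Real.log T ^ 2 :=
    le_mul_of_one_le_right (by positivity) (one_le_pow₀ hM)
  exact
  { lam_pos := by rw [hl]; positivity
    lam_lt := by rw [hl]; nlinarith
    coreVar_pos := hcp
    one_le := hn
    α_ge := by
      have : 80 * n * √(n : ℝ) ≤ 80 * n * n := by gcongr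
      nlinarith
    γ_nonneg := by
      have : 0 ≤ Real.logb 2 T := Real.logb_nonneg (by norm_num) (by linarith)
      simp only [params]; positivity
    η_pos := by simp only [params]; positivity
    ratio := by
      rw [hrad]
      have : sharpness (params n T) n * ((params n T).lam * (2 * (20 * n * (params n T).α)) *
          (2 * (s * (10 * u + 20 * (params n T).ε)) +
            2 * (params n T).lam * (20 * n * (params n T).α))) =
          sharpness (params n T) n * s ^ 2 * u * (40 * (60 * u + 40 * (params n T).ε)) := by
        rw [hl, ← hus]; ring
      rw [this]
      calc _ ≤ 1 / 500 * (40 * (60 * (1 / 1000) + 40 * (1 / 4000 : ℝ))) := by gcongr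
        _ ≤ _ := by norm_num
    ε_nonneg := hε.le
    T_ge := hT'
    n_le := by
      change 100 * (n : ℝ) ≤ T
      nlinarith
    sharp_ge := by linarith
    gauss := by
      calc _ ≤ Real.exp (-(sharpness (params n T) n / 4)) * Real.exp n := by
            gcongr; exact sqrt_two_pow_le_exp
        _ = Real.exp (-(sharpness (params n T) n / 4) + n) := by rw [Real.exp_add]
        _ ≤ 1 := Real.exp_le_one_iff.2 (by linarith)
    gauss_tail := by
      change _ ≤ ((T : ℝ) ^ 10)⁻¹
      rw [hsq]
      calc _ ≤ Real.exp (-(sharpness (params n T) n * (20 * s * (params n T).ε) ^ 2 / 4)) *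
            Real.exp n := by gcongr; exact sqrt_two_pow_le_exp
        _ = Real.exp (-(100 * (sharpness (params n T) n * s ^ 2 * (params n T).ε ^ 2)) + n) := by
            rw [Real.exp_add]; ring_nf
        _ ≤ Real.exp (-(10 * Real.log T)) := Real.exp_le_exp.2 (by nlinarith)
        _ = _ := by
            rw [Real.exp_neg, show (10 : ℝ) * Real.log T = (10 : ℕ) * Real.log T by norm_num,
              Real.exp_nat_mul, Real.exp_log hT0]
    tail := by
      change _ * (((T : ℝ)⁻¹) ^ n)⁻¹ ≤ ((T : ℝ) ^ 8)⁻¹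
      have h1 : (((T : ℝ)⁻¹) ^ n)⁻¹ = Real.exp (n * Real.log T) := by
        rw [inv_pow, inv_inv, Real.exp_nat_mul, Real.exp_log hT0]
      have h2 : ((T : ℝ) ^ 8)⁻¹ = Real.exp (-(8 * Real.log T)) := by
        rw [Real.exp_neg, show (8 : ℝ) * Real.log T = (8 : ℕ) * Real.log T by norm_num,
          Real.exp_nat_mul, Real.exp_log hT0]
      rw [h1, h2, ← Real.exp_add]
      refine Real.exp_le_exp.2 ?_
      have h3 : 100 * (n * Real.log T) ≤ 3 * (params n T).α / (40 * √n) := by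
        rw [le_div_iff₀ (by positivity)]
        calc 100 * (n * Real.log T) * (40 * √n) ≤ 100 * (n * Real.log T) * (40 * n) := by gcongr
          _ = 4000 * (n * Real.log T) * n := by ring
          _ ≤ 4000 * (n * Real.log T) * (n * Real.log T) := by gcongr
          _ = 4000 * (n ^ 2 * Real.log T ^ 2) := by ring
          _ ≤ _ := by nlinarith
      nlinarith
    energy_le := by
      change T * (Real.exp 1 * (params n T).η₁ * 2) + 2 ≤ (T : ℝ)
      have h : Real.exp 1 * (params n T).η₁ * 2 ≤ 1 / 2 := by
        rw [mul_comm]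
        refine hrate.trans ?_
        rw [div_le_div_iff₀ (by positivity) (by positivity)]
        linarith
      nlinarith
    η_le := hrate
    α_le := by
      change 80 * n * (params n T).α + 4 ≤ (T : ℝ)
      calc 80 * n * (params n T).α + 4 ≤
          80 * (n * Real.log T) * (10 ^ 14 * (n ^ 2 * Real.log T ^ 2)) + 4 := by gcongr
        _ = 8 * 10 ^ 15 * (n * Real.log T) ^ 3 + 4 := by ring
        _ ≤ 8 * 10 ^ 15 * (n * Real.log T) ^ 8 + 4 * (n * Real.log T) ^ 8 := by
            have h3 : (n * Real.log T) ^ 3 ≤ (n * Real.log T) ^ 8 :=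
              pow_le_pow_right₀ hNM (by norm_num)
            gcongr
            nlinarith
        _ ≤ 2 ^ 60 * (n * Real.log T) ^ 8 := by
            rw [← add_mul]
            gcongr
            norm_num
        _ ≤ T := hTS
    small_radius := by
      rw [hrad]
      have : 2 * (40 * n * (params n T).α) * (s * (10 * u + 20 * (params n T).ε)) =
          80 * u * (10 * u + 20 * (params n T).ε) := by rw [← hus]; ring
      rw [this]
      calc _ ≤ 80 * (1 / 1000) * (10 * (1 / 1000) + 20 * (1 / 4000 : ℝ)) := by gcongr
        _ < 1 := by norm_num
    growth := fun k hk => params_growth hn hM k hk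
    β_eq := rfl
    exists_exponent := params_exists_exponent hn hM hT' hsqTn }

end Parameters

end KernelBCO
end

theorem mainTheorem3 :
    ∃ T₀ : ℕ, ∀ n T : ℕ, 1 ≤ n → T₀ ≤ T →
      2 ^ 30 * (n : ℝ) ^ 8 * Real.log T ^ 8 ≤ √(T : ℝ) →
      -- the convex body
      ∀ K : Set (Pt n), Convex ℝ K → IsCompact K → (∃ c, Metric.closedBall c 1 ⊆ K) →
        Metric.diam K ≤ T →
      ∀ (Ω : Type*) (mΩ : MeasurableSpace Ω) (μ : Measure Ω), IsProbabilityMeasure μ →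
      -- the loss functions, chosen by an adversary that may depend on the past
      ∀ ℓ : ℕ → Ω → Pt n → ℝ,
        (∀ t ∈ Finset.Icc 1 T, ∀ ω, ConvexOn ℝ K (ℓ t ω) ∧ MapsTo (ℓ t ω) K (Icc 0 1) ∧
          LipschitzOnWith T (ℓ t ω) K) →
        (∀ t ∈ Finset.Icc 1 T, ∀ y ∈ K, Measurable fun ω => ℓ t ω y) →
      -- the points `X t` that are drawn and the points `x t` that are played
      ∀ X x : ℕ → Ω → Pt n,
        (∀ t ∈ Finset.Icc 1 T, Measurable (X t) ∧ Measurable (x t)) →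
        (∀ t ∈ Finset.Icc 1 T, ∀ ω, x t ω ∈ K ∧ (X t ω ∈ K → x t ω = X t ω)) →
        -- until the restart, `X t` has conditional law `K[p_t] p_t` given the past and `ℓ t`
        (∀ t ∈ Finset.Icc 1 T, ∀ B : Set (Pt n), MeasurableSet B →
          ∀ᵐ ω ∂μ, t ≤ restartTime (params n T) K (ℓ · ω) (x · ω) →
            (μ[(X t ⁻¹' B).indicator fun _ => (1 : ℝ) | history K ℓ x t]) ω =
              (kernelLaw (params n T) (weights (params n T) K (ℓ · ω) (x · ω) t)
                (weights (params n T) K (ℓ · ω) (x · ω) t)).real B) →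
      μ {ω | faultTime (params n T) K (ℓ · ω) (x · ω) <
          restartTime (params n T) K (ℓ · ω) (x · ω)} <
        ENNReal.ofReal (2 / (T : ℝ) ^ 2) := by
  -- The threshold 1000 serves only crude numerical comparisons such as `log T ≥ 1`.
  refine ⟨1000, fun n T hn hT hS K hK hKc hball hdiam Ω _ μ hμ ℓ hℓ hℓm X x hXx hx hlaw => ?_⟩
  have hbody : IsBody K := by
    obtain ⟨c, hc⟩ := hball
    exact ⟨hK, hKc, c, interior_mono hc
      (Metric.ball_subset_interior_closedBall (Metric.mem_ball_self one_pos))⟩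
  have hG : Game (params n T) K inferInstance ℓ X x :=
    { path := fun ω =>
        { toIsBody := hbody
          ball := hball
          diam := fun y hy z hz => by
            rw [← dist_eq_norm]
            exact (Metric.dist_le_diam_of_mem hKc.isBounded hy hz).trans hdiam
          loss := fun t h1 h2 => by
            obtain ⟨h, h', h''⟩ := hℓ t (Finset.mem_Icc.2 ⟨h1, h2⟩) ω
            exact ⟨h, h', h''⟩
          mem := fun t h1 h2 => (hx t (Finset.mem_Icc.2 ⟨h1, h2⟩) ω).1 }
      body := hbody
      loss := fun t h1 h2 => hℓm t (Finset.mem_Icc.2 ⟨h1, h2⟩)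
      draw := fun t h1 h2 => (hXx t (Finset.mem_Icc.2 ⟨h1, h2⟩)).1
      point := fun t h1 h2 => (hXx t (Finset.mem_Icc.2 ⟨h1, h2⟩)).2
      point_eq := fun t h1 h2 ω => (hx t (Finset.mem_Icc.2 ⟨h1, h2⟩) ω).2 }
  exact hG.measure_fault_lt (calibrated_params hn hT hS)
    fun t h1 h2 B hB => hlaw t (Finset.mem_Icc.2 ⟨h1, h2⟩) B hB
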